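/- Let $(X_i)_{i\ge 1}$ be i.i.d. $\mathbb{Z}$-valued random variables such that the set $\{z\in\mathbb{Z}:\mathbf{P}(X_1=z)>0\}$ generates the group $\mathbb{Z}$. Let $S_0=0$, $S_n=\sum_{i=1}^n X_i$, and let $G(x)=\sum_{n=0}^{\infty}\mathbf{P}(S_n=x)$ for $x\in\mathbb{Z}$. Assume that $X_1$ is integrable with $\mu=\mathbf{E}[X_1]\neq 0$. A distribution function $F$ on $[0,\infty)$ with $\overline F=1-F>0$ everywhere is called subexponential if $\overline{F*F}(x)\sim 2\overline F(x)$ as $x\to+\infty$; a distribution function on $\mathbb{R}$ is called subexponential if the law of the positive part of a variable with that distribution is subexponential. (i) If $\mu>0$, then $\lim_{x\to+\infty}G(x)=1/\mu$. (ii) If $\mu<0$, then $S^*=\sup_{i\ge 0}S_i<+\infty$ almost surely and $G(x)<+\infty$ for every $x\in\mathbb{Z}$. If moreover $H(x)=\mathbf{P}(S^*\le x)$ is subexponential, then, as $x\to+\infty$ in $\mathbb{Z}$, $$G(x)\sim\frac{1}{|\mu|}\,\mathbf{P}(S^*>x).$$ If $\mu<0$ and the integrated distribution function $I(x)=\bigl(1-\int_x^{+\infty}\mathbf{P}(X_1>t)\,dt\bigr)_+$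 is subexponential, then $\mathbf{P}(S^*>x)\sim(1-I(x))/|\mu|$ as $x\to+\infty$. Finally, $I$ is subexponential whenever there are $\alpha\in(0,2)$, $p\in(0,1]$, $q=1-p$ and a slowly varying function $L$ such that, as $x\to+\infty$, $\mathbf{P}(|X_1|>x)\sim L(x)x^{-\alpha}$, $\mathbf{P}(X_1>x)\sim pL(x)x^{-\alpha}$ and $\mathbf{P}(X_1<-x)\sim qL(x)x^{-\alpha}$ (read as $o(L(x)x^{-\alpha})$ if $q=0$). -/

import Mathlib

open MeasureTheory ProbabilityTheory Filter Topology Asymptotics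
open scoped ENNReal

noncomputable section

namespace RandomWalk

variable {Ω : Type*} [MeasurableSpace Ω]

/-- The random walk `S_n = X_1 + ⋯ + X_n`, `S_0 = 0`; the step `X_{i+1}` is `X i`. -/
def walk (X : ℕ → Ω → ℤ) (n : ℕ) (ω : Ω) : ℤ := ∑ i ∈ Finset.range n, X i ω

/-- The Green function `G(x) = ∑_{n ≥ 0} P(S_n = x)`, with values in `[0, ∞]`. -/
def green (P : Measure Ω) (X : ℕ → Ω → ℤ) (x : ℤ) : ℝ≥0∞ :=
  ∑' n : ℕ, P {ω | walk X n ω = x}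

/-- `S* = sup_{n ≥ 0} S_n`, with values in `[0, ∞]` inside the extended reals. -/
def walkSup (X : ℕ → Ω → ℤ) (ω : Ω) : EReal := ⨆ n : ℕ, (((walk X n ω : ℤ) : ℝ) : EReal)

/-- The law of the integer random variable `Y` is not carried by a proper subgroup of `ℤ`:
the points charged by the law generate `ℤ`. -/
def IsAperiodic (P : Measure Ω) (Y : Ω → ℤ) : Prop :=
  AddSubgroup.closure {z : ℤ | P {ω | Y ω = z} ≠ 0} = ⊤

/-- The integrated distribution function `I(x) = (1 - ∫_x^∞ P(Y > t) dt)_+`. -/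
def integratedCDF (P : Measure Ω) (Y : Ω → ℤ) (x : ℝ) : ℝ :=
  max (1 - ∫ t in Set.Ioi x, P.real {ω | t < (Y ω : ℝ)}) 0

/-- The tails of `Y` are those of the domain of attraction of an `α`-stable law:
`P(|Y| > x) ∼ L(x) x^{-α}`, `P(Y > x) ∼ p L(x) x^{-α}`, `P(Y < -x) ∼ q L(x) x^{-α}`
(read as `o(L(x) x^{-α})` when `p = 0`, respectively `q = 0`), with `L` slowly varying. -/
structure HasStableTails (P : Measure Ω) (Y : Ω → ℤ) (α p q : ℝ) (L : ℝ → ℝ) : Prop where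
  alpha_mem : α ∈ Set.Ioo (0 : ℝ) 2
  p_nonneg : 0 ≤ p
  q_nonneg : 0 ≤ q
  add_eq_one : p + q = 1
  measurable : Measurable L
  eventually_pos : ∀ᶠ x in atTop, 0 < L x
  slowly_varying : ∀ c : ℝ, 0 < c → Tendsto (fun x => L (c * x) / L x) atTop (𝓝 1)
  tail_abs : Tendsto (fun x : ℝ => P.real {ω | x < |(Y ω : ℝ)|} / (L x * x ^ (-α))) atTop (𝓝 1)
  tail_right : Tendsto (fun x : ℝ => P.real {ω | x < (Y ω : ℝ)} / (L x * x ^ (-α))) atTop (𝓝 p)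
  tail_left : Tendsto (fun x : ℝ => P.real {ω | (Y ω : ℝ) < -x} / (L x * x ^ (-α))) atTop (𝓝 q)

end RandomWalk

/-- The law of the positive part of a real random variable with law `ν`
(this is `ν` itself when `ν` is carried by `[0, ∞)`). -/
def positivePartLaw (ν : Measure ℝ) : Measure ℝ := ν.map (fun x => max x 0)

/-- The distribution function `F` on `ℝ` is subexponential: it is the distribution function of a
(necessarily unique) probability measure `ν`, and the law `ρ` of the positive part (equal to `ν`
when `F` vanishes on the negative half-line) has positive tails that satisfy
`(ρ * ρ)(x, ∞) ∼ 2 ρ(x, ∞)` as `x → ∞`. -/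
def IsSubexponential (F : ℝ → ℝ) : Prop :=
  ∃ ν : Measure ℝ, IsProbabilityMeasure ν ∧ (∀ x : ℝ, ν.real (Set.Iic x) = F x) ∧
    (∀ x : ℝ, 0 < (positivePartLaw ν).real (Set.Ioi x)) ∧
    (fun x : ℝ => (Measure.conv (positivePartLaw ν) (positivePartLaw ν)).real (Set.Ioi x))
      ~[atTop] (fun x : ℝ => 2 * (positivePartLaw ν).real (Set.Ioi x))

end

/-! Take `μ < 0`. By the strong law the walk tends to `-∞`, so `S*` is finite. With `S'` the maximum
after the first step, `S'` is independent of `X 0`, distributed as `S*`, and `S* = max 0 (X 0 +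
S')`. Let `h`, `f` be the laws of `S*`, `X 0`, let `w` be the law of `X 0 + S'` restricted to the
negative integers, and let `p` be the mass of `w`. Then `h + w = f * h + p δ₀` (`IIDSteps.lindley`).
Let `v` be the renewal function of the normalized law `w / p`, carried by the nonpositive integers.
Convolving with `v` gives the Poisson equation `h * v = f * (h * v) + p δ₀` (`poisson_of_lindley`).
Since `h * v` is bounded and vanishes at `+∞`, iteration along the walk gives `h * v = p G`
(`green_eq_of_poisson`), that is `p G(x) = ∑_{y ≥ 0} P(S* = x + y) u(y)` with `u(y) = v(-y)`. The
undershoot `(X 0 + S')⁻` has mean `|μ|` (`integral_undershoot`) and is aperiodic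
(`undershoot_aperiodic`), so `u → p / |μ|` by the renewal theorem (`IsRenewal.tendsto`). As `x → -∞`
the formula yields `G → 1 / |μ|`; applied to `-X` this is (i). As `x → +∞`, a long tail of `S*` lets
`u` be replaced by its limit (`tendsto_weighted_tail`), which gives the Green function asymptotics
in (ii). For the tail of `S*`, let `a` be the ladder height law and `q = P(S* = 0)`, so that `h = q
δ₀ + a * h`. Combined with the Poisson equation this gives the Wiener–Hopf identity `p δ₀ + q f * v
= p a + q v` (`ladder_eq_of_poisson`). Hence the tail of `a` is `q / p` times the step tail averaged
by `u`, asymptotically `q / |μ|` times the integrated tail. The tail of `S*` solves a renewal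
equation with kernel `a` of mass `1 - q`; `tendsto_div_of_defective_renewal` divides by `q`, and
subexponentiality makes intermediate jumps negligible (`eventually_sum_le`). Stable tails with `p >
0` are dominatedly varying, which makes the integrated tail long and dominatedly varying, hence
subexponential. -/

/-! ### The renewal theorem for integer renewal sequences -/

namespace RenewalSequence

/-- `u` is the renewal sequence of the step law whose tails are `r k = P(step > k)`. -/
structure IsRenewal (r u : ℕ → ℝ) : Prop where
  antitone : Antitone r
  nonneg : ∀ n, 0 ≤ r n
  zero : r 0 = 1
  sum_eq : ∀ n, ∑ k ∈ Finset.range (n + 1), r k * u (n - k) = 1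

variable {r u : ℕ → ℝ}

/-- In generating functions `sum_eq` reads `R * U = 1 / (1 - z)`, and `R` is invertible because its
constant term is `r 0 = 1`. -/
theorem exists_isRenewal (anti : Antitone r) (nonneg : ∀ n, 0 ≤ r n) (zero : r 0 = 1) :
    ∃ u, IsRenewal r u := by
  let R : PowerSeries ℝ := PowerSeries.mk r
  let U : PowerSeries ℝ := R⁻¹ * PowerSeries.mk (fun _ => 1)
  have hU : R * U = PowerSeries.mk (fun _ => 1) := by
    rw [← mul_assoc, PowerSeries.mul_inv_cancel, one_mul]
    simp [R, zero]
  refine ⟨fun n => PowerSeries.coeff n U, anti, nonneg, zero, fun n => ?_⟩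
  have := congrArg (PowerSeries.coeff n) hU
  rw [PowerSeries.coeff_mul, Finset.Nat.sum_antidiagonal_eq_sum_range_succ
    (fun i j => PowerSeries.coeff i R * PowerSeries.coeff j U)] at this
  simpa [R] using this

namespace IsRenewal

/-- Difference of two consecutive summed equations: the usual renewal recursion, with `P(step = k +
1) = r k - r (k + 1)`. -/
theorem step (h : IsRenewal r u) (n : ℕ) :
    u (n + 1) = ∑ k ∈ Finset.range (n + 1), (r k - r (k + 1)) * u (n - k) := by
  have h1 := h.sum_eq (n + 1)
  have h2 := h.sum_eq n
  rw [Finset.sum_range_succ'] at h1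
  simp only [h.zero, Nat.sub_zero, one_mul, Nat.add_sub_add_right] at h1
  simp only [sub_mul, Finset.sum_sub_distrib]
  linarith

theorem nonneg_renewal (h : IsRenewal r u) (n : ℕ) : 0 ≤ u n := by
  induction n using Nat.strong_induction_on with
  | _ n ih =>
    rcases n with _ | n
    · have := h.sum_eq 0
      simp [h.zero] at this
      simp [this]
    · rw [h.step n]
      exact Finset.sum_nonneg fun k _ =>
        mul_nonneg (sub_nonneg.2 (h.antitone k.le_succ)) (ih _ (by omega))

theorem le_one (h : IsRenewal r u) (n : ℕ) : u n ≤ 1 := by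
  have h1 := h.sum_eq n
  rw [Finset.sum_range_succ'] at h1
  simp only [h.zero, Nat.sub_zero, one_mul] at h1
  have : 0 ≤ ∑ k ∈ Finset.range n, r (k + 1) * u (n - (k + 1)) :=
    Finset.sum_nonneg fun k _ => mul_nonneg (h.nonneg _) (h.nonneg_renewal _)
  linarith

end IsRenewal

/-- A fixed index set makes dominated convergence for series applicable to convolutions. -/
theorem tsum_range_truncate (a b : ℕ → ℝ) (n : ℕ) :
    ∑ k ∈ Finset.range (n + 1), a k * b (n - k) =
      ∑' k, a k * (if k ≤ n then b (n - k) else 0) := by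
  rw [tsum_eq_sum (s := Finset.range (n + 1))]
  · refine Finset.sum_congr rfl fun k hk => ?_
    rw [if_pos (Nat.lt_succ_iff.1 (Finset.mem_range.1 hk))]
  · intro k hk
    rw [if_neg (by simpa [Nat.lt_succ_iff] using hk), mul_zero]

/-- Passing to the limit in a convolution along an arbitrary filter. -/
theorem tendsto_convolution {F : Filter ℕ} (hF : F ≤ atTop) {a b : ℕ → ℝ} (ha : Summable a)
    (ha0 : ∀ n, 0 ≤ a n) (hb : ∀ n, |b n| ≤ 1) {l : ℕ → ℝ} (i : ℕ)
    (hl : ∀ k, Tendsto (fun n => b (n - (i + k))) F (𝓝 (l k))) :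
    Tendsto (fun n => ∑ k ∈ Finset.range (n - i + 1), a k * b (n - i - k)) F
      (𝓝 (∑' k, a k * l k)) := by
  simp_rw [tsum_range_truncate]
  refine tendsto_tsum_of_dominated_convergence ha (fun k => ?_) (Eventually.of_forall ?_)
  · refine Tendsto.const_mul _ ((hl k).congr' ?_)
    filter_upwards [hF (eventually_ge_atTop (i + k))] with n hn
    rw [if_pos (by omega), Nat.sub_sub]
  · intro n k
    rw [norm_mul, Real.norm_of_nonneg (ha0 k)]
    refine mul_le_of_le_one_right (ha0 k) ?_
    split_ifs
    · exact hb _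
    · simp

variable {p : ℕ → ℝ} {M e lim : ℝ}

/-- Maximum principle: the largest limit point of a solution of the renewal equation is determined
by the summed renewal equation. -/
theorem limit_eq_of_isLargest (hp0 : ∀ n, 0 ≤ p n) (hp : HasSum p 1)
    (haper : ∀ d : ℕ, (∀ n, p n ≠ 0 → d ∣ n + 1) → d = 1)
    (hr0 : ∀ n, 0 ≤ r n) (hr : HasSum r M) (hu : ∀ n, |u n| ≤ 1)
    (hstep : ∀ n, u (n + 1) = ∑ k ∈ Finset.range (n + 1), p k * u (n - k))
    (hsum : ∀ n, ∑ k ∈ Finset.range (n + 1), r k * u (n - k) = e)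
    (U : Ultrafilter ℕ) (hU : (U : Filter ℕ) ≤ atTop) (hlim : Tendsto u U (𝓝 lim))
    (hub : ∀ c, lim < c → ∀ᶠ n in atTop, u n < c) : lim * M = e := by
  -- By compactness all shifts converge along the same ultrafilter, so no diagonal extraction is
  -- needed.
  have hex : ∀ k, ∃ l, Tendsto (fun n => u (n - k)) U (𝓝 l) := by
    intro k
    have hc : IsCompact (Set.Icc (-1 : ℝ) 1) := isCompact_Icc
    obtain ⟨l, -, hl⟩ := hc.ultrafilter_le_nhds (U.map fun n => u (n - k)) (by
      rw [le_principal_iff]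
      exact Filter.mem_map.2 (Eventually.of_forall fun n => abs_le.1 (hu _)))
    exact ⟨l, hl⟩
  choose l hl using hex
  have hle : ∀ k, l k ≤ lim := by
    intro k
    refine le_of_forall_gt_imp_ge_of_dense fun c hc => ?_
    refine le_of_tendsto (hl k) (hU ?_)
    exact ((tendsto_sub_atTop_nat k).eventually (hub c hc)).mono fun n hn => hn.le
  -- `l i` is a `p`-average of the values `l (i + 1 + j)`, none above `lim`; if the average equals
  -- `lim`, so does every value carrying weight.
  have hclosed : ∀ i, l i = lim → ∀ j, p j ≠ 0 → l (i + (j + 1)) = lim := by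
    intro i hi j hj
    have h1 : Tendsto (fun n => u (n - i)) U (𝓝 (∑' k, p k * l (i + 1 + k))) := by
      refine (tendsto_convolution hU hp.summable hp0 hu (i + 1)
        (fun k => hl (i + 1 + k))).congr' ?_
      filter_upwards [hU (eventually_ge_atTop (i + 1))] with n hn
      rw [← hstep]
      congr 1
      omega
    have h2 : ∑' k, p k * l (i + 1 + k) = lim := (tendsto_nhds_unique h1 (hl i)).trans hi
    have hbl : ∀ k, |l k| ≤ 1 := fun k =>
      le_of_tendsto (hl k).abs (Eventually.of_forall fun n => hu _)
    have hs : Summable fun k => p k * l (i + 1 + k) := by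
      refine Summable.of_norm_bounded hp.summable fun k => ?_
      rw [norm_mul, Real.norm_of_nonneg (hp0 k)]
      exact mul_le_of_le_one_right (hp0 k) (hbl _)
    have h3 : HasSum (fun k => p k * (lim - l (i + 1 + k))) 0 := by
      have := (hp.mul_right lim).sub hs.hasSum
      rw [h2, one_mul, sub_self] at this
      simpa only [mul_sub] using this
    have h4 := (hasSum_zero_iff_of_nonneg
      (fun k => mul_nonneg (hp0 k) (sub_nonneg.2 (hle _)))).1 h3
    have h5 := congrFun h4 j
    simp only [Pi.zero_apply, mul_eq_zero, hj, false_or] at h5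
    rw [show i + (j + 1) = i + 1 + j by ring]
    linarith
  let s : Set ℕ := {n | ∃ j, p j ≠ 0 ∧ n = j + 1}
  have hcl : ∀ m ∈ AddSubmonoid.closure s, ∀ i, l i = lim → l (i + m) = lim := by
    intro m hm
    induction hm using AddSubmonoid.closure_induction with
    | mem x hx => obtain ⟨j, hj, rfl⟩ := hx; exact fun i hi => hclosed i hi j hj
    | zero => exact fun i hi => hi
    | add x y _ _ hx hy => intro i hi; rw [← add_assoc]; exact hy _ (hx _ hi)
  have hl0 : l 0 = lim := tendsto_nhds_unique (hl 0) hlim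
  -- The charged steps have gcd `1`, so the semigroup they generate contains every integer from some
  -- `K` on, and `l` is constant there.
  obtain ⟨K, hK⟩ := Nat.exists_mem_closure_of_ge s
  have hgcd : Nat.setGcd s = 1 := haper _ fun n hn => Nat.setGcd_dvd_of_mem ⟨n, hn, rfl⟩
  have hl1 : ∀ k, l (K + k) = lim := by
    intro k
    have := hcl (K + k) (hK _ (by omega) (by simp [hgcd])) 0 hl0
    rwa [zero_add] at this
  have h6 := tendsto_convolution hU hr.summable hr0 hu K (fun k => hl (K + k))
  simp only [hsum, hl1] at h6
  rw [(hr.mul_right lim).tsum_eq] at h6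
  rw [mul_comm]
  exact tendsto_nhds_unique h6 tendsto_const_nhds

/-- The two-sided bound on `u` and the free constant `e` allow the use for both `u` and `-u`, which
identifies limsup and liminf. -/
theorem limsup_mul_eq (hp0 : ∀ n, 0 ≤ p n) (hp : HasSum p 1)
    (haper : ∀ d : ℕ, (∀ n, p n ≠ 0 → d ∣ n + 1) → d = 1)
    (hr0 : ∀ n, 0 ≤ r n) (hr : HasSum r M) (hu : ∀ n, |u n| ≤ 1)
    (hstep : ∀ n, u (n + 1) = ∑ k ∈ Finset.range (n + 1), p k * u (n - k))
    (hsum : ∀ n, ∑ k ∈ Finset.range (n + 1), r k * u (n - k) = e) :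
    limsup u atTop * M = e := by
  have hb1 : IsBoundedUnder (· ≤ ·) atTop u :=
    isBoundedUnder_of ⟨1, fun n => (abs_le.1 (hu n)).2⟩
  have hb2 : IsBoundedUnder (· ≥ ·) atTop u :=
    isBoundedUnder_of ⟨-1, fun n => (abs_le.1 (hu n)).1⟩
  obtain ⟨U, hU, hlim⟩ := mapClusterPt_iff_ultrafilter.1
    (MapClusterPt.limsup (u := u) (f := atTop) hb2.isCoboundedUnder_le hb1)
  exact limit_eq_of_isLargest hp0 hp haper hr0 hr hu hstep hsum U hU hlim
    fun c hc => eventually_lt_of_limsup_lt hc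

/-- **Renewal theorem**: an aperiodic renewal sequence with finite mean step `M` tends to
`1 / M`. -/
theorem IsRenewal.tendsto (h : IsRenewal r u) (hr : HasSum r M)
    (haper : ∀ d : ℕ, (∀ n, r n ≠ r (n + 1) → d ∣ n + 1) → d = 1) :
    Tendsto u atTop (𝓝 (1 / M)) := by
  have hM : 0 < M := by
    have := le_hasSum hr 0 fun n _ => h.nonneg n
    rw [h.zero] at this
    linarith
  have hp0 : ∀ n, 0 ≤ r n - r (n + 1) := fun n => sub_nonneg.2 (h.antitone n.le_succ)
  have hp : HasSum (fun n => r n - r (n + 1)) 1 := by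
    rw [hasSum_iff_tendsto_nat_of_nonneg hp0]
    simp only [Finset.sum_range_sub', h.zero]
    simpa using hr.summable.tendsto_atTop_zero.const_sub 1
  have hap : ∀ d : ℕ, (∀ n, r n - r (n + 1) ≠ 0 → d ∣ n + 1) → d = 1 :=
    fun d hd => haper d fun n hn => hd n (sub_ne_zero.2 hn)
  have hu : ∀ n, |u n| ≤ 1 := fun n => abs_le.2 ⟨by linarith [h.nonneg_renewal n], h.le_one n⟩
  have h1 : limsup u atTop * M = 1 := limsup_mul_eq hp0 hp hap h.nonneg hr hu h.step h.sum_eq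
  have h2 : limsup (fun n => -u n) atTop * M = -1 := by
    refine limsup_mul_eq hp0 hp hap h.nonneg hr (fun n => by simpa using hu n)
      (fun n => ?_) (fun n => ?_)
    · simp [h.step n]
    · simp [h.sum_eq n]
  have hb1 : IsBoundedUnder (· ≤ ·) atTop u :=
    isBoundedUnder_of ⟨1, fun n => (abs_le.1 (hu n)).2⟩
  have hb3 : IsBoundedUnder (· ≤ ·) atTop (fun n => -u n) :=
    isBoundedUnder_of ⟨1, fun n => by have := abs_le.1 (hu n); linarith⟩
  rw [tendsto_order]
  constructor
  · intro c hc
    have : limsup (fun n => -u n) atTop < -c := by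
      rw [show limsup (fun n => -u n) atTop = -(1 / M) by field_simp; linarith]
      linarith
    filter_upwards [eventually_lt_of_limsup_lt this hb3] with n hn
    linarith
  · intro c hc
    have : limsup u atTop < c := by
      rwa [show limsup u atTop = 1 / M by field_simp; linarith]
    exact eventually_lt_of_limsup_lt this hb1

end RenewalSequence

/-! ### Weighted tails and defective renewal equations -/

namespace RenewalSequence

/-- The tail sum `∑_{j ≥ k} t j`. -/
noncomputable def tailSum (t : ℕ → ℝ) (k : ℕ) : ℝ := ∑' j, t (k + j)

variable {t : ℕ → ℝ}

theorem summable_shift (ht : Summable t) (k : ℕ) : Summable fun j => t (k + j) := by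
  simpa only [add_comm k] using (summable_nat_add_iff k).2 ht

theorem tailSum_eq_add (ht : Summable t) (k : ℕ) : tailSum t k = t k + tailSum t (k + 1) := by
  rw [tailSum, (summable_shift ht k).tsum_eq_zero_add, tailSum]
  simp only [add_zero, add_assoc, add_comm 1]

theorem tailSum_antitone (ht : Summable t) (ht0 : ∀ n, 0 ≤ t n) : Antitone (tailSum t) :=
  antitone_nat_of_succ_le fun n => by rw [tailSum_eq_add ht n]; linarith [ht0 n]

/-- If single terms are negligible with respect to the tails of a summable sequence, averaging
a convergent sequence against the tails gives its limit. -/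
theorem tendsto_weighted_tail (ht : Summable t) (ht0 : ∀ n, 0 ≤ t n) (hpos : ∀ k, 0 < tailSum t k)
    (hsmall : Tendsto (fun k => t k / tailSum t k) atTop (𝓝 0)) {v : ℕ → ℝ} {l : ℝ}
    (hv : Tendsto v atTop (𝓝 l)) :
    Tendsto (fun k => (∑' y, t (k + y) * v y) / tailSum t k) atTop (𝓝 l) := by
  obtain ⟨D, hD⟩ : ∃ D, ∀ y, |v y - l| ≤ D := by
    obtain ⟨D, hD⟩ := (hv.sub_const l).norm.bddAbove_range
    exact ⟨D, fun y => hD ⟨y, rfl⟩⟩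
  have hD0 : 0 ≤ D := (abs_nonneg _).trans (hD 0)
  rw [Metric.tendsto_atTop]
  intro ε hε
  -- Indices `y ≥ N` cost at most `ε / 2` of the tail; the `N` others cost `D` times single terms,
  -- negligible by `hsmall`.
  obtain ⟨N, hN⟩ := Metric.tendsto_atTop.1 hv (ε / 2) (by positivity)
  have h1 : Tendsto (fun k => D * ∑ y ∈ Finset.range N, t (k + y) / tailSum t (k + y)) atTop
      (𝓝 0) := by
    have : Tendsto (fun k => ∑ y ∈ Finset.range N, t (k + y) / tailSum t (k + y)) atTop
        (𝓝 (∑ y ∈ Finset.range N, 0)) :=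
      tendsto_finsetSum _ fun y _ => hsmall.comp (tendsto_add_atTop_nat y)
    simpa using this.const_mul D
  obtain ⟨k₀, hk₀⟩ := Metric.tendsto_atTop.1 h1 (ε / 2) (by positivity)
  refine ⟨k₀, fun k hk => ?_⟩
  have hk1 := hk₀ k hk
  rw [Real.dist_eq, sub_zero] at hk1
  have hk2 := (le_abs_self _).trans_lt hk1
  have hsk := summable_shift ht k
  have hs1 : Summable fun y => t (k + y) * (v y - l) := by
    refine Summable.of_norm_bounded (hsk.mul_right D) fun y => ?_
    rw [norm_mul, Real.norm_of_nonneg (ht0 _)]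
    exact mul_le_mul_of_nonneg_left (hD y) (ht0 _)
  have hs2 : Summable fun y => if y < N then D * t (k + y) else 0 :=
    summable_of_ne_finset_zero (s := Finset.range N) fun y hy => if_neg (by simpa using hy)
  have hs2' : ∑' y, (if y < N then D * t (k + y) else 0) =
      D * ∑ y ∈ Finset.range N, t (k + y) := by
    rw [tsum_eq_sum (s := Finset.range N) fun y hy => if_neg (by simpa using hy), Finset.mul_sum]
    exact Finset.sum_congr rfl fun y hy => if_pos (by simpa using hy)
  have h2 : (∑' y, t (k + y) * v y) / tailSum t k - l =
      (∑' y, t (k + y) * (v y - l)) / tailSum t k := by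
    have : ∑' y, t (k + y) * v y = ∑' y, t (k + y) * (v y - l) + tailSum t k * l := by
      rw [tailSum, ← tsum_mul_right, ← hs1.tsum_add (hsk.mul_right l)]
      exact tsum_congr fun y => by ring
    rw [this, add_div, mul_div_cancel_left₀ _ (hpos k).ne']
    ring
  have h3 : |∑' y, t (k + y) * (v y - l)| ≤
      ε / 2 * tailSum t k + D * ∑ y ∈ Finset.range N, t (k + y) := by
    rw [← hs2', tailSum, ← tsum_mul_left, ← (hsk.mul_left _).tsum_add hs2, ← Real.norm_eq_abs]
    refine tsum_of_norm_bounded ((hsk.mul_left _).add hs2).hasSum fun y => ?_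
    rw [norm_mul, Real.norm_of_nonneg (ht0 _), mul_comm, Real.norm_eq_abs]
    split_ifs with hy
    · nlinarith [ht0 (k + y), hD y]
    · have := (hN y (not_lt.1 hy)).le
      rw [Real.dist_eq] at this
      nlinarith [ht0 (k + y)]
  -- Replacing the tail at `k` by the smaller tail at `k + y` enlarges each quotient and puts it in
  -- the form of `hsmall`.
  have h4 : (D * ∑ y ∈ Finset.range N, t (k + y)) / tailSum t k ≤
      D * ∑ y ∈ Finset.range N, t (k + y) / tailSum t (k + y) := by
    rw [mul_div_assoc, Finset.sum_div]
    gcongr with y _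
    · exact ht0 _
    · exact hpos _
    · exact tailSum_antitone ht ht0 (Nat.le_add_right _ _)
  rw [Real.dist_eq, h2, abs_div, abs_of_pos (hpos k)]
  calc _ ≤ (ε / 2 * tailSum t k + D * ∑ y ∈ Finset.range N, t (k + y)) / tailSum t k := by
        gcongr; exact (hpos k).le
    _ = ε / 2 + (D * ∑ y ∈ Finset.range N, t (k + y)) / tailSum t k := by
        rw [add_div, mul_div_cancel_right₀ _ (hpos k).ne']
    _ < ε := by linarith

/-- A bounded nonnegative subsolution of a defective renewal equation with vanishing forcing
vanishes at infinity. -/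
theorem tendsto_zero_of_le_convolution {a E δ : ℕ → ℝ} {p K : ℝ} (ha0 : ∀ n, 0 ≤ a n)
    (ha : HasSum a p) (hp : p < 1) (hE0 : ∀ n, 0 ≤ E n) (hEK : ∀ n, E n ≤ K)
    (hδ : Tendsto δ atTop (𝓝 0))
    (hle : ∀ n, E n ≤ δ n + ∑ k ∈ Finset.range (n + 1), a k * E (n - k)) :
    Tendsto E atTop (𝓝 0) := by
  have hb1 : IsBoundedUnder (· ≤ ·) atTop E := isBoundedUnder_of ⟨K, hEK⟩
  have hb2 : IsBoundedUnder (· ≥ ·) atTop E := isBoundedUnder_of ⟨0, hE0⟩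
  obtain ⟨U, hU, hlim⟩ := mapClusterPt_iff_ultrafilter.1
    (MapClusterPt.limsup (u := E) (f := atTop) hb2.isCoboundedUnder_le hb1)
  set L := limsup E atTop with hL
  have hex : ∀ k, ∃ l, 0 ≤ l ∧ l ≤ K ∧ Tendsto (fun n => E (n - k)) U (𝓝 l) := by
    intro k
    have hc : IsCompact (Set.Icc (0 : ℝ) K) := isCompact_Icc
    obtain ⟨l, hl', hl⟩ := hc.ultrafilter_le_nhds (U.map fun n => E (n - k)) (by
      rw [le_principal_iff]
      exact Filter.mem_map.2 (Eventually.of_forall fun n => ⟨hE0 _, hEK _⟩))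
    exact ⟨l, hl'.1, hl'.2, hl⟩
  choose l hl0 hlK hl using hex
  have hlL : ∀ k, l k ≤ L := by
    intro k
    refine le_of_forall_gt_imp_ge_of_dense fun c hc => ?_
    refine le_of_tendsto (hl k) (hU ?_)
    exact ((tendsto_sub_atTop_nat k).eventually (eventually_lt_of_limsup_lt hc hb1)).mono
      fun n hn => hn.le
  have hK0 : 0 ≤ K := (hE0 0).trans (hEK 0)
  have hconv : Tendsto (fun n => ∑ k ∈ Finset.range (n + 1), a k * E (n - k)) U
      (𝓝 (∑' k, a k * l k)) := by
    simp_rw [tsum_range_truncate]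
    refine tendsto_tsum_of_dominated_convergence (ha.summable.mul_right K) (fun k => ?_)
      (Eventually.of_forall ?_)
    · refine Tendsto.const_mul _ ((hl k).congr' ?_)
      filter_upwards [hU (eventually_ge_atTop k)] with n hn
      rw [if_pos hn]
    · intro n k
      rw [norm_mul, Real.norm_of_nonneg (ha0 k)]
      refine mul_le_mul_of_nonneg_left ?_ (ha0 k)
      split_ifs
      · rw [Real.norm_of_nonneg (hE0 _)]; exact hEK _
      · simpa using hK0
  -- In the limit along an ultrafilter realizing the limsup `L`, the inequality becomes `L ≤ p * L`
  -- with `p < 1`.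
  have h1 : L ≤ 0 + ∑' k, a k * l k :=
    le_of_tendsto_of_tendsto hlim ((hδ.mono_left hU).add hconv) (Eventually.of_forall hle)
  have hsl : Summable fun k => a k * l k := by
    refine Summable.of_nonneg_of_le (fun k => mul_nonneg (ha0 k) (hl0 k)) (fun k => ?_)
      (ha.summable.mul_right K)
    exact mul_le_mul_of_nonneg_left (hlK k) (ha0 k)
  have h2 : ∑' k, a k * l k ≤ p * L := by
    rw [← ha.tsum_eq, ← tsum_mul_right]
    exact hsl.tsum_le_tsum (fun k => mul_le_mul_of_nonneg_left (hlL k) (ha0 k))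
      (ha.summable.mul_right L)
  have hL0 : L ≤ 0 := by nlinarith
  rw [tendsto_order]
  exact ⟨fun c hc => Eventually.of_forall fun n => hc.trans_le (hE0 n),
    fun c hc => eventually_lt_of_limsup_lt (hL0.trans_lt hc) hb1⟩

/-- Asymptotics of the solution of a defective renewal equation with a subexponential forcing. -/
theorem tendsto_div_of_defective_renewal {a T A b : ℕ → ℝ} {p c : ℝ} (ha0 : ∀ n, 0 ≤ a n)
    (ha00 : a 0 = 0) (ha : HasSum a p) (hp : p < 1) (hb : ∀ n, 0 < b n) (hbanti : Antitone b)
    (hlong : ∀ k, Tendsto (fun n => b (n - k) / b n) atTop (𝓝 1))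
    (hA : Tendsto (fun n => A n / b n) atTop (𝓝 c)) (hT0 : ∀ n, 0 ≤ T n)
    (hT : ∀ n, T n = A n + ∑ k ∈ Finset.range (n + 1), a k * T (n - k))
    (hw : ∀ ε > 0, ∃ m, ∀ᶠ n in atTop, ∑ k ∈ Finset.Ioc m n, a k * b (n - k) ≤ ε * b n) :
    Tendsto (fun n => T n / b n) atTop (𝓝 (c / (1 - p))) := by
  set R : ℕ → ℝ := fun n => T n / b n with hR
  have hR0 : ∀ n, 0 ≤ R n := fun n => div_nonneg (hT0 n) (hb n).le
  have hp0 : 0 ≤ p := ha.nonneg ha0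
  -- `D` measures how far `b` is from being shift invariant under `a`: `hlong` handles finitely many
  -- `k`, `hw` the rest.
  set D : ℕ → ℝ := fun n => ∑ k ∈ Finset.range (n + 1), a k * (b (n - k) / b n - 1) with hD
  have hterm : ∀ n k, 0 ≤ a k * (b (n - k) / b n - 1) := fun n k =>
    mul_nonneg (ha0 k) (sub_nonneg.2 ((one_le_div (hb n)).2 (hbanti (Nat.sub_le _ _))))
  have hD0 : ∀ n, 0 ≤ D n := fun n => Finset.sum_nonneg fun k _ => hterm n k
  have hDlim : Tendsto D atTop (𝓝 0) := by
    rw [Metric.tendsto_atTop']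
    intro ε hε
    obtain ⟨m, hm⟩ := hw (ε / 2) (by positivity)
    have h1 : Tendsto (fun n => ∑ k ∈ Finset.range (m + 1), a k * (b (n - k) / b n - 1)) atTop
        (𝓝 0) := by
      have : Tendsto (fun n => ∑ k ∈ Finset.range (m + 1), a k * (b (n - k) / b n - 1)) atTop
          (𝓝 (∑ k ∈ Finset.range (m + 1), a k * (1 - 1))) :=
        tendsto_finsetSum _ fun k _ => ((hlong k).sub_const 1).const_mul _
      simpa using this
    obtain ⟨N, hN⟩ := eventually_atTop.1 (hm.and ((h1.eventually_lt_const
      (show (0 : ℝ) < ε / 2 by positivity)).and (eventually_gt_atTop m)))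
    refine ⟨N, fun n hn => ?_⟩
    obtain ⟨h2, h3, h4⟩ := hN n hn.le
    rw [Real.dist_eq, sub_zero, abs_of_nonneg (hD0 n)]
    have h5 : D n = ∑ k ∈ Finset.range (m + 1), a k * (b (n - k) / b n - 1) +
        ∑ k ∈ Finset.Ioc m n, a k * (b (n - k) / b n - 1) := by
      rw [hD]
      simp only
      rw [← Finset.sum_range_add_sum_Ico _ (show m + 1 ≤ n + 1 by omega)]
      exact congrArg _ (Finset.sum_congr (by ext; simp) fun _ _ => rfl)
    have h6 : ∑ k ∈ Finset.Ioc m n, a k * (b (n - k) / b n - 1) ≤ ε / 2 := by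
      calc _ ≤ ∑ k ∈ Finset.Ioc m n, a k * b (n - k) / b n :=
            Finset.sum_le_sum fun k _ => by
              rw [mul_sub, mul_div_assoc, mul_one]; linarith [ha0 k]
        _ ≤ ε / 2 := by
            rw [← Finset.sum_div, div_le_iff₀ (hb n)]
            exact h2
    linarith
  -- Writing `b (n - k) / b n = 1 + (b (n - k) / b n - 1)` splits the equation into a renewal
  -- equation for `R` and an error controlled by `D`.
  have hRrec : ∀ n, R n = A n / b n + ∑ k ∈ Finset.range (n + 1), a k * R (n - k) +
      ∑ k ∈ Finset.range (n + 1), a k * (b (n - k) / b n - 1) * R (n - k) := by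
    intro n
    rw [add_assoc, ← Finset.sum_add_distrib, hR]
    simp only
    rw [hT n, add_div, Finset.sum_div]
    congr 1
    refine Finset.sum_congr rfl fun k _ => ?_
    have := (hb (n - k)).ne'
    have := (hb n).ne'
    field_simp
    ring
  obtain ⟨C, hC0, hC⟩ : ∃ C, 0 ≤ C ∧ ∀ n, A n / b n ≤ C := by
    obtain ⟨C, hC⟩ := hA.bddAbove_range
    exact ⟨max C 0, le_max_right _ _, fun n => (hC ⟨n, rfl⟩).trans (le_max_left _ _)⟩
  have hasum : ∀ n, ∑ k ∈ Finset.range (n + 1), a k ≤ p := fun n => sum_le_hasSum _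
    (fun k _ => ha0 k) ha
  obtain ⟨n₀, hn₀⟩ := eventually_atTop.1 (hDlim.eventually_lt_const
    (show (0 : ℝ) < (1 - p) / 2 by linarith))
  obtain ⟨K, hK⟩ : ∃ K, ∀ n, R n ≤ K := by
    -- This `K` dominates `R` below `n₀` and satisfies `C + p * K + (1 - p) / 2 * K ≤ K`, so the
    -- bound propagates by induction.
    refine ⟨∑ j ∈ Finset.range n₀, R j + C / ((1 - p) / 2), fun n => ?_⟩
    set K := ∑ j ∈ Finset.range n₀, R j + C / ((1 - p) / 2) with hKdef
    have hq : 0 < (1 - p) / 2 := by linarith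
    have hsum0 : 0 ≤ ∑ j ∈ Finset.range n₀, R j := Finset.sum_nonneg fun j _ => hR0 j
    have hK0 : 0 ≤ K := add_nonneg hsum0 (by positivity)
    have hKC : C ≤ (1 - p) / 2 * K := by
      rw [hKdef, mul_add, mul_div_cancel₀ _ hq.ne']
      linarith [mul_nonneg hq.le hsum0]
    induction n using Nat.strong_induction_on with
    | _ n ih =>
      rcases lt_or_ge n n₀ with hn | hn
      · have := Finset.single_le_sum (fun j _ => hR0 j) (Finset.mem_range.2 hn)
        have h2 : 0 ≤ C / ((1 - p) / 2) := by positivity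
        linarith
      · have hbd : ∀ k, a k * R (n - k) ≤ a k * K := by
          intro k
          rcases k.eq_zero_or_pos with rfl | hk
          · simp [ha00]
          -- For `n = 0` truncated subtraction gives `n - k = 0`, out of reach of the induction;
          -- there `R 0 = A 0 / b 0`.
          · rcases n.eq_zero_or_pos with rfl | hn'
            · refine mul_le_mul_of_nonneg_left ?_ (ha0 k)
              rw [Nat.zero_sub, hRrec]
              simp only [zero_add, Finset.sum_range_one, ha00, zero_mul, add_zero]
              refine (hC 0).trans (hKC.trans ?_)
              nlinarith
            · exact mul_le_mul_of_nonneg_left (ih _ (by omega)) (ha0 k)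
        have hbd2 : ∀ k, a k * (b (n - k) / b n - 1) * R (n - k) ≤
            a k * (b (n - k) / b n - 1) * K := by
          intro k
          have h1 : 0 ≤ b (n - k) / b n - 1 :=
            sub_nonneg.2 ((one_le_div (hb n)).2 (hbanti (Nat.sub_le _ _)))
          nlinarith [hbd k]
        have h1 : ∑ k ∈ Finset.range (n + 1), a k * R (n - k) ≤ p * K := by
          refine (Finset.sum_le_sum fun k _ => hbd k).trans ?_
          rw [← Finset.sum_mul]
          exact mul_le_mul_of_nonneg_right (hasum n) hK0
        have h2 : ∑ k ∈ Finset.range (n + 1), a k * (b (n - k) / b n - 1) * R (n - k) ≤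
            (1 - p) / 2 * K := by
          refine (Finset.sum_le_sum fun k _ => hbd2 k).trans ?_
          rw [← Finset.sum_mul]
          exact mul_le_mul_of_nonneg_right (hn₀ n hn).le hK0
        rw [hRrec n]
        linarith [hC n]
  set l := c / (1 - p) with hl
  -- `l` is the fixed point of the limiting equation; subtracting it leaves a defective inequality
  -- for `|R - l|` with vanishing forcing.
  have hlp : c + p * l = l := by
    rw [hl]
    have : 1 - p ≠ 0 := by linarith
    field_simp
    ring
  rw [tendsto_iff_dist_tendsto_zero]
  have hsp : Tendsto (fun n => |l| * |p - ∑ k ∈ Finset.range (n + 1), a k|) atTop (𝓝 0) := by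
    have := (((tendsto_add_atTop_iff_nat 1).2 ha.tendsto_sum_nat).const_sub p).abs.const_mul |l|
    simpa using this
  refine tendsto_zero_of_le_convolution (p := p) (K := K + |l|)
    (δ := fun n => |A n / b n - c| + K * D n + |l| * |p - ∑ k ∈ Finset.range (n + 1), a k|)
    ha0 ha hp (fun n => dist_nonneg) (fun n => ?_) ?_ (fun n => ?_)
  · rw [Real.dist_eq]
    refine (abs_sub _ _).trans ?_
    rw [abs_of_nonneg (hR0 n)]
    linarith [hK n]
  · have h1 : Tendsto (fun n => |A n / b n - c|) atTop (𝓝 0) := by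
      simpa using (hA.sub_const c).abs
    simpa using (h1.add (hDlim.const_mul K)).add hsp
  · have h1 : R n - l = (A n / b n - c) +
        ∑ k ∈ Finset.range (n + 1), a k * (b (n - k) / b n - 1) * R (n - k) +
        ∑ k ∈ Finset.range (n + 1), a k * (R (n - k) - l) -
        l * (p - ∑ k ∈ Finset.range (n + 1), a k) := by
      simp only [mul_sub, Finset.sum_sub_distrib, ← Finset.sum_mul] at *
      rw [hRrec n]
      linarith
    have h2 : |∑ k ∈ Finset.range (n + 1), a k * (b (n - k) / b n - 1) * R (n - k)| ≤ K * D n := by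
      rw [abs_of_nonneg (Finset.sum_nonneg fun k _ => mul_nonneg (hterm n k) (hR0 _)), hD,
        Finset.mul_sum]
      refine Finset.sum_le_sum fun k _ => ?_
      rw [mul_comm K]
      exact mul_le_mul_of_nonneg_left (hK _) (hterm n k)
    have h3 : |∑ k ∈ Finset.range (n + 1), a k * (R (n - k) - l)| ≤
        ∑ k ∈ Finset.range (n + 1), a k * dist (R (n - k)) l := by
      refine (Finset.abs_sum_le_sum_abs _ _).trans (le_of_eq ?_)
      refine Finset.sum_congr rfl fun k _ => ?_
      rw [abs_mul, abs_of_nonneg (ha0 k), Real.dist_eq]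
    rw [Real.dist_eq, h1]
    refine (abs_sub _ _).trans ?_
    rw [abs_mul]
    have h4 := abs_add_three (A n / b n - c)
      (∑ k ∈ Finset.range (n + 1), a k * (b (n - k) / b n - 1) * R (n - k))
      (∑ k ∈ Finset.range (n + 1), a k * (R (n - k) - l))
    linarith

end RenewalSequence

/-! ### Convolution of nonnegative functions on `ℤ` -/

namespace IntConv

/-- Convolution of `[0, ∞]`-valued functions on `ℤ`. -/
noncomputable def conv (a b : ℤ → ℝ≥0∞) (x : ℤ) : ℝ≥0∞ := ∑' y, a y * b (x - y)

theorem conv_comm (a b : ℤ → ℝ≥0∞) : conv a b = conv b a := by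
  funext x
  rw [conv, ← (Equiv.subLeft x).tsum_eq]
  exact tsum_congr fun y => by simp [mul_comm]

theorem conv_assoc (a b c : ℤ → ℝ≥0∞) : conv (conv a b) c = conv a (conv b c) := by
  funext x
  simp only [conv, ← ENNReal.tsum_mul_right, ← ENNReal.tsum_mul_left]
  rw [ENNReal.tsum_comm]
  refine tsum_congr fun y => ?_
  rw [← (Equiv.addRight y).tsum_eq]
  refine tsum_congr fun z => ?_
  simp only [Equiv.coe_addRight, add_sub_cancel_right, mul_assoc]
  congr 3
  ring

theorem conv_add (a b c : ℤ → ℝ≥0∞) : conv a (b + c) = conv a b + conv a c := by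
  funext x
  simp only [conv, Pi.add_apply, mul_add, ENNReal.tsum_add]

theorem add_conv (a b c : ℤ → ℝ≥0∞) : conv (a + b) c = conv a c + conv b c := by
  rw [conv_comm, conv_add, conv_comm c, conv_comm c]

theorem conv_single (a : ℤ → ℝ≥0∞) (t : ℝ≥0∞) : conv a (Pi.single 0 t) = t • a := by
  funext x
  rw [conv, tsum_eq_single x]
  · simp [mul_comm]
  · intro y hy
    rw [Pi.single_eq_of_ne (sub_ne_zero.2 hy.symm), mul_zero]

theorem single_conv (a : ℤ → ℝ≥0∞) (t : ℝ≥0∞) : conv (Pi.single 0 t) a = t • a := by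
  rw [conv_comm, conv_single]

theorem conv_smul (a b : ℤ → ℝ≥0∞) (t : ℝ≥0∞) : conv a (t • b) = t • conv a b := by
  rw [← conv_single b, ← conv_assoc, conv_single]

/-- In `[0, ∞]` an identity is subtracted by adding a common finite term to both sides and
cancelling it. -/
theorem add_left_cancel_of_ne_top {a b c : ℤ → ℝ≥0∞} (ha : ∀ x, a x ≠ ⊤) (h : a + b = a + c) :
    b = c := by
  funext x
  exact (ENNReal.add_right_inj (ha x)).1 (congrFun h x)

theorem add_right_cancel_of_ne_top {a b c : ℤ → ℝ≥0∞} (ha : ∀ x, a x ≠ ⊤) (h : b + a = c + a) :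
    b = c :=
  add_left_cancel_of_ne_top ha (by rwa [add_comm a, add_comm a])

variable {f h w v a : ℤ → ℝ≥0∞} {p q : ℝ≥0∞}

/-- From the Lindley equation for `h` and the renewal equation for `v`, the function `h * v`
solves the Poisson equation. -/
theorem poisson_of_lindley (hp : p ≠ ⊤) (hv : ∀ x, v x ≠ ⊤)
    (lindley : h + w = conv f h + Pi.single 0 p)
    (renewal : p • v = Pi.single 0 p + conv w v) :
    conv h v = conv f (conv h v) + Pi.single 0 p := by
  have hfin : ∀ x, conv w v x ≠ ⊤ := fun x => by
    have := congrFun renewal x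
    refine ne_top_of_le_ne_top (ENNReal.mul_ne_top hp (hv x)) ?_
    change _ ≤ (p • v) x
    rw [this]
    exact le_add_self
  refine add_right_cancel_of_ne_top hfin ?_
  -- Lindley convolved with `v` produces `p • v`; its renewal expansion matches the term `conv w v`
  -- on the left.
  rw [← add_conv, lindley, add_conv, conv_assoc, single_conv, renewal, add_assoc]

/-- The Wiener–Hopf factorization read off from the Poisson equation for `h * v` and
the ladder equation for `h`. -/
theorem ladder_eq_of_poisson (hhv : ∀ x, conv h v x ≠ ⊤)
    (poisson : conv h v = conv f (conv h v) + Pi.single 0 p)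
    (ladder : h = Pi.single 0 q + conv a h) :
    Pi.single 0 p + q • conv f v = p • a + q • v := by
  -- `conv h v` and `conv h k` differ by `p δ₀`. Expanding both by the ladder equation and comparing
  -- leaves the identity plus a common `conv h k`.
  set k := conv f v with hk
  have e0 : conv h v = conv h k + Pi.single 0 p := by
    rwa [← conv_assoc, conv_comm f, conv_assoc] at poisson
  have hfin : ∀ x, conv h k x ≠ ⊤ := fun x => by
    refine ne_top_of_le_ne_top (hhv x) ?_
    rw [e0]
    exact le_self_add
  have e1 : conv h v = q • v + conv a (conv h v) := by
    conv_lhs => rw [ladder]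
    rw [add_conv, single_conv, conv_assoc]
  have e2 : conv h k = q • k + conv a (conv h k) := by
    conv_lhs => rw [ladder]
    rw [add_conv, single_conv, conv_assoc]
  have e3 : conv a (conv h v) = conv a (conv h k) + p • a := by
    rw [e0, conv_add, conv_single]
  refine add_left_cancel_of_ne_top hfin ?_
  calc conv h k + (Pi.single 0 p + q • k) = (conv h k + Pi.single 0 p) + q • k := by abel
    _ = conv h v + q • k := by rw [← e0]
    _ = (q • k + conv a (conv h k)) + (p • a + q • v) := by rw [e1, e3]; abel
    _ = conv h k + (p • a + q • v) := by rw [← e2]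

end IntConv

/-! ### Markov property, maximum and ladder decomposition of the walk -/

namespace RandomWalk

open IntConv

variable {Ω : Type*} {X : ℕ → Ω → ℤ}

/-- The σ-algebra generated by the first `n` steps. -/
@[reducible] def pastAlg (X : ℕ → Ω → ℤ) (n : ℕ) : MeasurableSpace Ω :=
  ⨆ i ∈ Set.Iio n, MeasurableSpace.comap (X i) inferInstance

/-- The sequence of steps after time `n`. -/
def shiftSeq (X : ℕ → Ω → ℤ) (n : ℕ) (ω : Ω) (i : ℕ) : ℤ := X (n + i) ω

theorem walk_zero (ω : Ω) : walk X 0 ω = 0 := by simp [walk]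

theorem walk_succ (n : ℕ) (ω : Ω) : walk X (n + 1) ω = walk X n ω + X n ω :=
  Finset.sum_range_succ _ _

theorem walk_add (n k : ℕ) (ω : Ω) :
    walk X (n + k) ω = walk X n ω + ∑ i ∈ Finset.range k, shiftSeq X n ω i :=
  Finset.sum_range_add _ _ _

theorem measurable_walk_past {k n : ℕ} (hk : k ≤ n) : Measurable[pastAlg X n] (walk X k) := by
  unfold walk
  refine Finset.measurable_sum _ fun i hi => ?_
  have hin : i ∈ Set.Iio n := (Finset.mem_range.1 hi).trans_le hk
  exact (comap_measurable (X i)).mono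
    (le_iSup₂ (f := fun i (_ : i ∈ Set.Iio n) => MeasurableSpace.comap (X i) inferInstance) i hin)
    le_rfl

/-- The maximum of the partial sums of an integer sequence (`0` when they are unbounded). -/
noncomputable def pathMax (ξ : ℕ → ℤ) : ℤ := ⨆ n : ℕ, ∑ i ∈ Finset.range n, ξ i

theorem measurable_pathMax : Measurable pathMax := by
  unfold pathMax
  exact Measurable.iSup fun n => Finset.measurable_sum _ fun i _ => measurable_pi_apply i

/-- The maximum of the walk after time `n`, relative to its position at time `n`. -/
noncomputable def maxAfter (X : ℕ → Ω → ℤ) (n : ℕ) (ω : Ω) : ℤ := pathMax (shiftSeq X n ω)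

/-- The walk is bounded above along the trajectory `ω`. -/
def IsBddPath (X : ℕ → Ω → ℤ) (ω : Ω) : Prop := BddAbove (Set.range fun n => walk X n ω)

theorem IsBddPath.shift {ω : Ω} (h : IsBddPath X ω) (n : ℕ) :
    BddAbove (Set.range fun k => ∑ i ∈ Finset.range k, shiftSeq X n ω i) := by
  obtain ⟨C, hC⟩ := h
  refine ⟨C - walk X n ω, ?_⟩
  rintro _ ⟨k, rfl⟩
  have := hC ⟨n + k, rfl⟩
  simp only [walk_add] at this
  simp only
  linarith

theorem IsBddPath.le_maxAfter {ω : Ω} (h : IsBddPath X ω) (n k : ℕ) :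
    walk X (n + k) ω ≤ walk X n ω + maxAfter X n ω := by
  rw [walk_add]
  have := le_ciSup (h.shift n) k
  simp only [maxAfter, pathMax]
  linarith

theorem IsBddPath.maxAfter_nonneg {ω : Ω} (h : IsBddPath X ω) (n : ℕ) : 0 ≤ maxAfter X n ω := by
  have := h.le_maxAfter n 0
  simpa using this

theorem IsBddPath.exists_eq_maxAfter {ω : Ω} (h : IsBddPath X ω) (n : ℕ) :
    ∃ k, walk X (n + k) ω = walk X n ω + maxAfter X n ω := by
  obtain ⟨k, hk⟩ := Int.csSup_mem (Set.range_nonempty _) (h.shift n)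
  refine ⟨k, ?_⟩
  simp only at hk
  rw [walk_add, hk]
  rfl

theorem IsBddPath.walk_le_max {ω : Ω} (h : IsBddPath X ω) (n : ℕ) :
    walk X n ω ≤ maxAfter X 0 ω := by
  have := h.le_maxAfter 0 n
  simpa [walk_zero] using this

theorem IsBddPath.exists_eq_max {ω : Ω} (h : IsBddPath X ω) :
    ∃ k, walk X k ω = maxAfter X 0 ω := by
  obtain ⟨k, hk⟩ := h.exists_eq_maxAfter 0
  exact ⟨k, by simpa [walk_zero] using hk⟩

theorem IsBddPath.walkSup_eq {ω : Ω} (h : IsBddPath X ω) :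
    walkSup X ω = ((maxAfter X 0 ω : ℝ) : EReal) := by
  refine le_antisymm (iSup_le fun n => ?_) ?_
  · exact_mod_cast h.walk_le_max n
  · obtain ⟨k, hk⟩ := h.exists_eq_max
    rw [← hk]
    exact le_iSup (fun n => (((walk X n ω : ℤ) : ℝ) : EReal)) k

/-- Decomposition of the maximum at a time before which the walk stays below its value then. -/
theorem IsBddPath.max_eq_add {ω : Ω} (h : IsBddPath X ω) (n : ℕ)
    (hn : ∀ k < n, walk X k ω ≤ walk X n ω) :
    maxAfter X 0 ω = walk X n ω + maxAfter X n ω := by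
  refine le_antisymm ?_ ?_
  · obtain ⟨k, hk⟩ := h.exists_eq_max
    rw [← hk]
    rcases lt_or_ge k n with hkn | hkn
    · linarith [hn k hkn, h.maxAfter_nonneg n]
    · obtain ⟨j, rfl⟩ := Nat.exists_eq_add_of_le hkn
      exact h.le_maxAfter n j
  · obtain ⟨k, hk⟩ := h.exists_eq_maxAfter n
    rw [← hk]
    exact h.walk_le_max _

/-- The Lindley recursion for the maximum. -/
theorem IsBddPath.max_eq {ω : Ω} (h : IsBddPath X ω) :
    maxAfter X 0 ω = max 0 (X 0 ω + maxAfter X 1 ω) := by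
  have hw : walk X 1 ω = X 0 ω := by simp [walk]
  refine le_antisymm ?_ (max_le (h.maxAfter_nonneg 0) ?_)
  · obtain ⟨k, hk⟩ := h.exists_eq_max
    rw [← hk]
    rcases k.eq_zero_or_pos with rfl | hk0
    · simp [walk_zero]
    · obtain ⟨j, rfl⟩ := Nat.exists_eq_add_of_le hk0
      have := h.le_maxAfter 1 j
      rw [hw] at this
      exact le_max_of_le_right this
  · obtain ⟨k, hk⟩ := h.exists_eq_maxAfter 1
    rw [← hw, ← hk]
    exact h.walk_le_max _

/-- The event that the walk enters `(0, ∞)` for the first time at time `n`, at the point `y`. -/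
def ladderEvent (X : ℕ → Ω → ℤ) (n : ℕ) (y : ℤ) : Set Ω :=
  {ω | 0 < y ∧ walk X n ω = y ∧ ∀ k < n, walk X k ω ≤ 0}

theorem measurableSet_ladderEvent (n : ℕ) (y : ℤ) :
    MeasurableSet[pastAlg X n] (ladderEvent X n y) := by
  have h1 : MeasurableSet[pastAlg X n] {ω | walk X n ω = y} :=
    measurable_walk_past le_rfl (measurableSet_singleton y)
  have h2 : MeasurableSet[pastAlg X n] {ω | ∀ k < n, walk X k ω ≤ 0} := by
    have : {ω | ∀ k < n, walk X k ω ≤ 0} = ⋂ k, ⋂ (_ : k < n), {ω | walk X k ω ≤ 0} := by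
      ext; simp
    rw [this]
    refine MeasurableSet.iInter fun k => MeasurableSet.iInter fun hk => ?_
    exact measurable_walk_past hk.le (MeasurableSet.of_discrete (s := Set.Iic 0))
  exact (MeasurableSet.const _).inter (h1.inter h2)

variable [MeasurableSpace Ω] {P : Measure Ω}

/-- The steps are measurable, independent and identically distributed. -/
structure IIDSteps (P : Measure Ω) (X : ℕ → Ω → ℤ) : Prop where
  meas : ∀ i, Measurable (X i)
  indep : iIndepFun X P
  ident : ∀ i, IdentDistrib (X i) (X 0) P P

namespace IIDSteps

theorem measurable_walk (H : IIDSteps P X) (n : ℕ) : Measurable (walk X n) :=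
  Finset.measurable_sum _ fun i _ => H.meas i

theorem measurable_shiftSeq (H : IIDSteps P X) (n : ℕ) : Measurable (shiftSeq X n) :=
  measurable_pi_lambda _ fun i => H.meas (n + i)

/-- Stationarity: both laws are the infinite product of the step law. -/
theorem map_shiftSeq (H : IIDSteps P X) (n : ℕ) :
    P.map (shiftSeq X n) = P.map (shiftSeq X 0) := by
  have key : ∀ n, P.map (shiftSeq X n) = Measure.infinitePi (fun _ : ℕ => P.map (X 0)) := by
    intro n
    have h1 : iIndepFun (fun i => X (n + i)) P := H.indep.precomp (add_right_injective n)
    have h2 := h1.map_fun_eq_infinitePi_map (fun i => H.meas (n + i))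
    simp only [(H.ident _).map_eq] at h2
    exact h2
  rw [key, key]

theorem pastAlg_le (H : IIDSteps P X) (n : ℕ) : pastAlg X n ≤ ‹MeasurableSpace Ω› :=
  iSup₂_le fun i _ => (H.meas i).comap_le

/-- The Markov property. -/
theorem measure_inter_shiftSeq (H : IIDSteps P X) (n : ℕ) {A : Set Ω}
    (hA : MeasurableSet[pastAlg X n] A) {B : Set (ℕ → ℤ)} (hB : MeasurableSet B) :
    P (A ∩ {ω | shiftSeq X n ω ∈ B}) = P A * P {ω | shiftSeq X 0 ω ∈ B} := by
  have h1 : Indep (pastAlg X n)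
      (⨆ i ∈ Set.Ici n, MeasurableSpace.comap (X i) inferInstance) P :=
    indep_iSup_of_disjoint (fun i => (H.meas i).comap_le) H.indep.iIndep
      (Set.disjoint_left.2 fun i hi hi' => not_lt.2 (Set.mem_Ici.1 hi') (Set.mem_Iio.1 hi))
  have h2 : Measurable[⨆ i ∈ Set.Ici n, MeasurableSpace.comap (X i) inferInstance]
      (shiftSeq X n) := by
    refine (@measurable_pi_iff _ _ _ (⨆ i ∈ Set.Ici n, MeasurableSpace.comap (X i) inferInstance)
      _ _).2 fun i => ?_
    have hin : n + i ∈ Set.Ici n := Nat.le_add_right _ _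
    exact (comap_measurable (X (n + i))).mono
      (le_iSup₂ (f := fun i (_ : i ∈ Set.Ici n) => MeasurableSpace.comap (X i) inferInstance)
        (n + i) hin) le_rfl
  have h3 := (Indep_iff _ _ _).1 h1 A (shiftSeq X n ⁻¹' B) hA (h2 hB)
  have h4 : P (shiftSeq X n ⁻¹' B) = P (shiftSeq X 0 ⁻¹' B) := by
    rw [← Measure.map_apply (H.measurable_shiftSeq n) hB,
      ← Measure.map_apply (H.measurable_shiftSeq 0) hB, H.map_shiftSeq n]
  rw [h4] at h3
  exact h3

end IIDSteps

theorem measure_eq_tsum_inter {Y : Ω → ℤ} (hY : Measurable Y) (A : Set Ω) :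
    P A = ∑' y, P ({ω | Y ω = y} ∩ A) := by
  have h := measure_iUnion (μ := P.restrict A) (f := fun y : ℤ => {ω | Y ω = y})
    (fun i j hij => Set.disjoint_left.2 fun ω h1 h2 => hij (h1.symm.trans h2))
    (fun y => hY (measurableSet_singleton y))
  have hU : (⋃ y : ℤ, {ω | Y ω = y}) = Set.univ := by ext; simp
  rw [hU, Measure.restrict_apply_univ] at h
  rw [h]
  exact tsum_congr fun y => Measure.restrict_apply (hY (measurableSet_singleton y))

/-- The law of an integer random variable as a function on `ℤ`. -/
def massFun (P : Measure Ω) (Y : Ω → ℤ) (x : ℤ) : ℝ≥0∞ := P {ω | Y ω = x}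

theorem tsum_massFun [IsProbabilityMeasure P] {Y : Ω → ℤ} (hY : Measurable Y) :
    ∑' x, massFun P Y x = 1 := by
  have := measure_eq_tsum_inter (P := P) hY Set.univ
  simpa [massFun] using this.symm

namespace IIDSteps

theorem measurable_maxAfter (H : IIDSteps P X) (n : ℕ) : Measurable (maxAfter X n) :=
  measurable_pathMax.comp (H.measurable_shiftSeq n)

theorem measure_inter_maxAfter (H : IIDSteps P X) (n : ℕ) {A : Set Ω}
    (hA : MeasurableSet[pastAlg X n] A) (B : Set ℤ) :
    P (A ∩ {ω | maxAfter X n ω ∈ B}) = P A * P {ω | maxAfter X 0 ω ∈ B} :=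
  H.measure_inter_shiftSeq n hA (measurable_pathMax (MeasurableSet.of_discrete (s := B)))

theorem massFun_walk_succ (H : IIDSteps P X) (n : ℕ) :
    massFun P (walk X (n + 1)) = conv (massFun P (walk X n)) (massFun P (X 0)) := by
  funext x
  rw [massFun, measure_eq_tsum_inter (H.measurable_walk n)]
  refine tsum_congr fun y => ?_
  have h1 := H.measure_inter_shiftSeq n (A := {ω | walk X n ω = y})
    (measurable_walk_past le_rfl (measurableSet_singleton y))
    (B := {ξ | ξ 0 = x - y})
    (measurable_pi_apply (X := fun _ : ℕ => ℤ) 0 (measurableSet_singleton (x - y)))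
  simp only [massFun]
  simp only [Set.mem_ofPred_eq, shiftSeq, add_zero] at h1
  rw [← h1]
  congr 1
  ext ω
  simp only [Set.mem_inter_iff, Set.mem_ofPred_eq, walk_succ]
  constructor <;> rintro ⟨h1, h2⟩ <;> exact ⟨h1, by omega⟩

/-- Markov property at time `1`: the later maximum is independent of the first step and distributed
as the overall one. -/
theorem massFun_add_maxAfter (H : IIDSteps P X) :
    massFun P (fun ω => X 0 ω + maxAfter X 1 ω) =
      conv (massFun P (X 0)) (massFun P (maxAfter X 0)) := by
  funext x
  rw [massFun, measure_eq_tsum_inter (H.meas 0)]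
  refine tsum_congr fun y => ?_
  have hm : MeasurableSet[pastAlg X 1] {ω | X 0 ω = y} := by
    have := (measurable_walk_past (X := X) (le_refl 1)) (measurableSet_singleton y)
    simpa [walk, Set.preimage] using this
  have h1 := H.measure_inter_maxAfter 1 hm {x - y}
  simp only [massFun]
  simp only [Set.mem_singleton_iff] at h1
  rw [← h1]
  congr 1
  ext ω
  simp only [Set.mem_inter_iff, Set.mem_ofPred_eq]
  constructor <;> rintro ⟨h1, h2⟩ <;> exact ⟨h1, by omega⟩

/-- The Lindley equation for the law of the maximum. -/
theorem lindley (H : IIDSteps P X) (hbdd : ∀ᵐ ω ∂P, IsBddPath X ω) :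
    massFun P (maxAfter X 0) +
      (fun x => if x < 0 then massFun P (fun ω => X 0 ω + maxAfter X 1 ω) x else 0) =
    conv (massFun P (X 0)) (massFun P (maxAfter X 0)) +
      Pi.single 0 (P {ω | X 0 ω + maxAfter X 1 ω < 0}) := by
  rw [← H.massFun_add_maxAfter]
  funext x
  simp only [Pi.add_apply]
  -- Taking the positive part of `X 0 + maxAfter X 1` moves its negative mass to `0` and leaves the
  -- mass on `(0, ∞)` in place.
  rcases lt_trichotomy x 0 with hx | rfl | hx
  · rw [if_pos hx, Pi.single_eq_of_ne hx.ne, add_zero]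
    have : massFun P (maxAfter X 0) x = 0 := by
      rw [massFun, measure_eq_zero_iff_ae_notMem]
      filter_upwards [hbdd] with ω hω h
      have h1 := hω.maxAfter_nonneg 0
      have h2 : maxAfter X 0 ω = x := h
      omega
    rw [this, zero_add]
  · have hm : MeasurableSet {ω | X 0 ω + maxAfter X 1 ω < 0} :=
      ((H.meas 0).add (H.measurable_maxAfter 1)) (MeasurableSet.of_discrete (s := Set.Iio 0))
    have hd : Disjoint {ω | X 0 ω + maxAfter X 1 ω = 0} {ω | X 0 ω + maxAfter X 1 ω < 0} :=
      Set.disjoint_left.2 fun ω h1 h2 => by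
        simp only [Set.mem_ofPred_eq] at h1 h2
        omega
    rw [if_neg (lt_irrefl 0), add_zero, Pi.single_eq_same, massFun, massFun,
      ← measure_union hd hm]
    refine measure_congr ?_
    filter_upwards [hbdd] with ω hω
    have := hω.max_eq
    apply propext
    change maxAfter X 0 ω = 0 ↔ X 0 ω + maxAfter X 1 ω = 0 ∨ X 0 ω + maxAfter X 1 ω < 0
    omega
  · rw [if_neg (by omega), add_zero, Pi.single_eq_of_ne (by omega), add_zero]
    refine measure_congr ?_
    filter_upwards [hbdd] with ω hω
    have := hω.max_eq
    apply propext
    change maxAfter X 0 ω = x ↔ X 0 ω + maxAfter X 1 ω = x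
    omega

end IIDSteps

/-- The (defective) law of the first strict ascending ladder height. -/
noncomputable def ladderMass (P : Measure Ω) (X : ℕ → Ω → ℤ) (y : ℤ) : ℝ≥0∞ :=
  ∑' n, P (ladderEvent X n y)

theorem ladderMass_of_nonpos {y : ℤ} (hy : y ≤ 0) : ladderMass P X y = 0 := by
  simp [ladderMass, ladderEvent, not_lt.2 hy]

/-- Decomposition of the law of the maximum at the first ladder epoch. -/
theorem IIDSteps.ladder (H : IIDSteps P X) (hbdd : ∀ᵐ ω ∂P, IsBddPath X ω) :
    massFun P (maxAfter X 0) = Pi.single 0 (massFun P (maxAfter X 0) 0) +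
      conv (ladderMass P X) (massFun P (maxAfter X 0)) := by
  have hterm : ∀ x : ℤ, conv (ladderMass P X) (massFun P (maxAfter X 0)) x =
      ∑' q : ℤ × ℕ, P (ladderEvent X q.2 q.1 ∩ {ω | maxAfter X q.2 ω = x - q.1}) := by
    intro x
    rw [ENNReal.tsum_prod']
    refine tsum_congr fun y => ?_
    rw [ladderMass, ← ENNReal.tsum_mul_right]
    refine tsum_congr fun n => ?_
    exact (H.measure_inter_maxAfter n (measurableSet_ladderEvent n y) {x - y}).symm
  have hdisj : ∀ x : ℤ, Pairwise (Function.onFun Disjoint fun q : ℤ × ℕ =>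
      ladderEvent X q.2 q.1 ∩ {ω | maxAfter X q.2 ω = x - q.1}) := by
    rintro x ⟨y, n⟩ ⟨y', n'⟩ hne
    refine Set.disjoint_left.2 ?_
    rintro ω ⟨⟨h1, h2, h3⟩, -⟩ ⟨⟨h1', h2', h3'⟩, -⟩
    simp only at h1 h2 h3 h1' h2' h3'
    rcases lt_trichotomy n n' with hn | rfl | hn
    · have := h3' n hn; omega
    · exact hne (by rw [← h2, ← h2'])
    · have := h3 n' hn; omega
  have hmeas : ∀ (x : ℤ) (q : ℤ × ℕ), MeasurableSet
      (ladderEvent X q.2 q.1 ∩ {ω | maxAfter X q.2 ω = x - q.1}) := fun x q =>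
    (H.pastAlg_le _ _ (measurableSet_ladderEvent _ _)).inter
      (H.measurable_maxAfter _ (measurableSet_singleton _))
  funext x
  rw [Pi.add_apply, hterm, ← measure_iUnion (hdisj x) (hmeas x)]
  rcases eq_or_ne x 0 with rfl | hx
  · rw [Pi.single_eq_same]
    have : P (⋃ q : ℤ × ℕ, ladderEvent X q.2 q.1 ∩ {ω | maxAfter X q.2 ω = 0 - q.1}) = 0 := by
      rw [measure_iUnion_null_iff]
      intro q
      rw [measure_eq_zero_iff_ae_notMem]
      filter_upwards [hbdd] with ω hω h
      have h1 := hω.maxAfter_nonneg q.2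
      have h2 : maxAfter X q.2 ω = 0 - q.1 := h.2
      have h3 := h.1.1
      omega
    rw [this, add_zero]
  · rw [Pi.single_eq_of_ne hx, zero_add]
    refine measure_congr ?_
    filter_upwards [hbdd] with ω hω
    apply propext
    change maxAfter X 0 ω = x ↔
      ω ∈ ⋃ q : ℤ × ℕ, ladderEvent X q.2 q.1 ∩ {ω | maxAfter X q.2 ω = x - q.1}
    rw [Set.mem_iUnion]
    constructor
    · intro h
      have hex : ∃ k, 0 < walk X k ω := by
        obtain ⟨k, hk⟩ := hω.exists_eq_max
        have := hω.maxAfter_nonneg 0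
        exact ⟨k, by omega⟩
      classical
      have hspec := Nat.find_spec hex
      have hmin : ∀ k < Nat.find hex, walk X k ω ≤ 0 := fun k hk => not_lt.1 (Nat.find_min hex hk)
      refine ⟨(walk X (Nat.find hex) ω, Nat.find hex), ⟨hspec, rfl, hmin⟩, ?_⟩
      have := hω.max_eq_add (Nat.find hex) fun k hk => (hmin k hk).trans hspec.le
      simp only [Set.mem_ofPred_eq]
      omega
    · rintro ⟨⟨y, n⟩, ⟨h1, h2, h3⟩, h4⟩
      simp only [Set.mem_ofPred_eq] at h1 h2 h3 h4
      have := hω.max_eq_add n fun k hk => (h3 k hk).trans (by omega)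
      omega

end RandomWalk

/-! ### Walks with negative drift: the Green function through the descending renewal sequence -/

namespace RandomWalk

open IntConv RenewalSequence

variable {Ω : Type*} [MeasurableSpace Ω] {P : Measure Ω} {X : ℕ → Ω → ℤ}

theorem conv_massFun {Y : Ω → ℤ} (hY : Measurable Y) (b : ℤ → ℝ≥0∞) (x : ℤ) :
    conv (massFun P Y) b x = ∫⁻ ω, b (x - Y ω) ∂P := by
  have h1 : ∫⁻ ω, b (x - Y ω) ∂P = ∫⁻ y, b (x - y) ∂(P.map Y) :=
    (lintegral_map (f := fun y => b (x - y)) (measurable_of_countable _) hY).symm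
  rw [h1, lintegral_countable', conv]
  refine tsum_congr fun y => ?_
  rw [Measure.map_apply hY (measurableSet_singleton y), mul_comm]
  rfl

theorem massFun_eq_zero {Y : Ω → ℤ} {x : ℤ} (h : ∀ᵐ ω ∂P, Y ω ≠ x) : massFun P Y x = 0 :=
  measure_eq_zero_iff_ae_notMem.2 h

/-- The function `x ↦ u (-x)` on the nonpositive integers, extended by `0`. -/
noncomputable def reflect (u : ℕ → ℝ) (x : ℤ) : ℝ≥0∞ :=
  if x ≤ 0 then ENNReal.ofReal (u (-x).toNat) else 0

/-- Convolution with a function on the nonpositive integers averages `a` over `[x, ∞)`, which is how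
tails enter. -/
theorem conv_reflect (a : ℤ → ℝ≥0∞) (u : ℕ → ℝ) (x : ℤ) :
    conv a (reflect u) x = ∑' y : ℕ, a (x + y) * ENNReal.ofReal (u y) := by
  have hinj : Function.Injective (fun y : ℕ => -(y : ℤ)) := fun a b h => by simpa using h
  rw [conv_comm, conv, ← hinj.tsum_eq]
  · refine tsum_congr fun y => ?_
    simp [reflect, mul_comm]
  · intro z hz
    have hz' : z ≤ 0 := by
      by_contra hcon
      simp [reflect, hcon] at hz
    exact ⟨(-z).toNat, by simp; omega⟩

theorem reflect_le_one {u : ℕ → ℝ} (hu : ∀ n, u n ≤ 1) (x : ℤ) : reflect u x ≤ 1 := by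
  unfold reflect
  split_ifs
  · exact ENNReal.ofReal_le_one.2 (hu _)
  · exact zero_le_one

theorem tendsto_reflect {u : ℕ → ℝ} {l : ℝ} (hu : Tendsto u atTop (𝓝 l)) :
    Tendsto (reflect u) atBot (𝓝 (ENNReal.ofReal l)) := by
  have h1 : Tendsto (fun x : ℤ => (-x).toNat) atBot atTop := by
    refine tendsto_atTop.2 fun n => ?_
    filter_upwards [eventually_le_atBot (-(n : ℤ))] with x hx
    omega
  refine ((ENNReal.continuous_ofReal.tendsto l).comp (hu.comp h1)).congr' ?_
  filter_upwards [eventually_le_atBot 0] with x hx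
  simp [reflect, hx]

namespace IIDSteps

/-- By the strong law of large numbers a walk with negative mean drifts to `-∞`. -/
theorem tendsto_walk_atBot (H : IIDSteps P X) (hint : Integrable (fun ω => (X 0 ω : ℝ)) P)
    (hneg : ∫ ω, (X 0 ω : ℝ) ∂P < 0) : ∀ᵐ ω ∂P, Tendsto (fun n => walk X n ω) atTop atBot := by
  have hcast : Measurable (fun z : ℤ => (z : ℝ)) := measurable_of_countable _
  have h := strong_law_ae_real (fun i ω => (X i ω : ℝ)) hint
    (fun i j hij => (H.indep.indepFun hij).comp hcast hcast)
    (fun i => (H.ident i).comp hcast)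
  filter_upwards [h] with ω hω
  rw [← tendsto_intCast_atBot_iff (R := ℝ)]
  have h1 : Tendsto (fun n : ℕ => (∑ i ∈ Finset.range n, (X i ω : ℝ)) / n * n) atTop atBot :=
    Tendsto.neg_mul_atTop hneg hω tendsto_natCast_atTop_atTop
  refine h1.congr' ?_
  filter_upwards [eventually_gt_atTop 0] with n hn
  have : (n : ℝ) ≠ 0 := by positivity
  simp [walk, div_mul_cancel₀ _ this]

theorem ae_isBddPath (H : IIDSteps P X) (hint : Integrable (fun ω => (X 0 ω : ℝ)) P)
    (hneg : ∫ ω, (X 0 ω : ℝ) ∂P < 0) : ∀ᵐ ω ∂P, IsBddPath X ω := by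
  filter_upwards [H.tendsto_walk_atBot hint hneg] with ω hω
  exact bddAbove_range_of_tendsto_atTop_atBot hω

variable [IsProbabilityMeasure P]

/-- The mean undershoot of the Lindley recursion is the absolute value of the drift. -/
theorem integral_undershoot (H : IIDSteps P X) (hint : Integrable (fun ω => (X 0 ω : ℝ)) P)
    (hbdd : ∀ᵐ ω ∂P, IsBddPath X ω) :
    Integrable (fun ω => (((-(X 0 ω + maxAfter X 1 ω)).toNat : ℕ) : ℝ)) P ∧
      ∫ ω, (((-(X 0 ω + maxAfter X 1 ω)).toNat : ℕ) : ℝ) ∂P = -∫ ω, (X 0 ω : ℝ) ∂P := by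
  have hm0 := H.measurable_maxAfter 0
  have hm1 := H.measurable_maxAfter 1
  have hcast : Measurable (fun z : ℤ => (z : ℝ)) := measurable_of_countable _
  -- The maximum need not be integrable, so the two equal means cannot simply be cancelled. Their
  -- difference is dominated by `|X 0|`, its truncations have mean zero by stationarity, and
  -- dominated convergence removes the truncation.
  have hS : ∀ᵐ ω ∂P, |((maxAfter X 0 ω : ℤ) : ℝ) - ((maxAfter X 1 ω : ℤ) : ℝ)| ≤ |(X 0 ω : ℝ)| := by
    filter_upwards [hbdd] with ω hω
    have h1 := hω.max_eq
    have h2 := hω.maxAfter_nonneg 1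
    have h3 : |maxAfter X 0 ω - maxAfter X 1 ω| ≤ |X 0 ω| := by
      rw [abs_le]
      have := neg_abs_le (X 0 ω)
      have := le_abs_self (X 0 ω)
      have := abs_nonneg (X 0 ω)
      constructor <;> omega
    exact_mod_cast h3
  have hdiff : Integrable (fun ω => ((maxAfter X 0 ω : ℤ) : ℝ) - ((maxAfter X 1 ω : ℤ) : ℝ)) P :=
    hint.mono ((hcast.comp hm0).sub (hcast.comp hm1)).aestronglyMeasurable hS
  have htrunc : ∀ K : ℕ, ∫ ω, (min ((maxAfter X 0 ω : ℤ) : ℝ) K -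
      min ((maxAfter X 1 ω : ℤ) : ℝ) K) ∂P = 0 := by
    intro K
    have hb : ∀ j, Integrable (fun ω => min ((maxAfter X j ω : ℤ) : ℝ) K) P := by
      intro j
      have hmj : Measurable (fun ω => min ((maxAfter X j ω : ℤ) : ℝ) K) :=
        (hcast.comp (H.measurable_maxAfter j)).min measurable_const
      refine Integrable.of_bound hmj.aestronglyMeasurable (K : ℝ) ?_
      filter_upwards [hbdd] with ω hω
      have h1 : (0 : ℝ) ≤ ((maxAfter X j ω : ℤ) : ℝ) := by exact_mod_cast hω.maxAfter_nonneg j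
      rw [Real.norm_of_nonneg (le_min h1 (Nat.cast_nonneg K))]
      exact min_le_right _ _
    rw [integral_sub (hb 0) (hb 1), sub_eq_zero]
    have hF : Measurable (fun ξ : ℕ → ℤ => min ((pathMax ξ : ℤ) : ℝ) K) :=
      (hcast.comp measurable_pathMax).min measurable_const
    have key : ∀ j, ∫ ω, min ((maxAfter X j ω : ℤ) : ℝ) K ∂P =
        ∫ ξ, min ((pathMax ξ : ℤ) : ℝ) K ∂(P.map (shiftSeq X j)) := fun j =>
      (integral_map (H.measurable_shiftSeq j).aemeasurable hF.aestronglyMeasurable).symm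
    rw [key, key, H.map_shiftSeq 1]
  have hzero : ∫ ω, (((maxAfter X 0 ω : ℤ) : ℝ) - ((maxAfter X 1 ω : ℤ) : ℝ)) ∂P = 0 := by
    have hlim := tendsto_integral_of_dominated_convergence (μ := P)
      (F := fun (K : ℕ) ω => min ((maxAfter X 0 ω : ℤ) : ℝ) K - min ((maxAfter X 1 ω : ℤ) : ℝ) K)
      (f := fun ω => ((maxAfter X 0 ω : ℤ) : ℝ) - ((maxAfter X 1 ω : ℤ) : ℝ))
      (fun ω => |(X 0 ω : ℝ)|)
      (fun K => (((hcast.comp hm0).min measurable_const).sub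
        ((hcast.comp hm1).min measurable_const)).aestronglyMeasurable) hint.abs
      (fun K => by
        filter_upwards [hS] with ω hω
        refine le_trans ?_ hω
        have := abs_min_sub_min_le_max ((maxAfter X 0 ω : ℤ) : ℝ) K ((maxAfter X 1 ω : ℤ) : ℝ) K
        simpa using this)
      (Eventually.of_forall fun ω => by
        refine tendsto_const_nhds.congr' ?_
        have h1 := tendsto_natCast_atTop_atTop (R := ℝ)
        filter_upwards [h1.eventually_ge_atTop ((maxAfter X 0 ω : ℤ) : ℝ),
          h1.eventually_ge_atTop ((maxAfter X 1 ω : ℤ) : ℝ)] with K h2 h3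
        rw [min_eq_left h2, min_eq_left h3])
    simp only [htrunc] at hlim
    exact (tendsto_nhds_unique hlim tendsto_const_nhds)
  -- This is `z⁻ = z⁺ - z` for `z = X 0 + maxAfter X 1`, whose positive part is the maximum.
  have hae : (fun ω => (((-(X 0 ω + maxAfter X 1 ω)).toNat : ℕ) : ℝ)) =ᵐ[P]
      fun ω => (((maxAfter X 0 ω : ℤ) : ℝ) - ((maxAfter X 1 ω : ℤ) : ℝ)) - (X 0 ω : ℝ) := by
    filter_upwards [hbdd] with ω hω
    have h1 := hω.max_eq
    have h2 : (((-(X 0 ω + maxAfter X 1 ω)).toNat : ℕ) : ℤ) =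
        maxAfter X 0 ω - maxAfter X 1 ω - X 0 ω := by omega
    exact_mod_cast h2
  refine ⟨(hdiff.sub hint).congr hae.symm, ?_⟩
  rw [integral_congr_ae hae, integral_sub hdiff hint, hzero, zero_sub]

end IIDSteps

/-- The expectation of a natural random variable is the sum of its tails. -/
theorem hasSum_measureReal_lt {Y : Ω → ℕ} [IsFiniteMeasure P] (hY : Measurable Y)
    (hint : Integrable (fun ω => (Y ω : ℝ)) P) :
    HasSum (fun k : ℕ => P.real {ω | k < Y ω}) (∫ ω, (Y ω : ℝ) ∂P) := by
  have hm : ∀ k : ℕ, MeasurableSet {ω | k < Y ω} := fun k =>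
    hY (MeasurableSet.of_discrete (s := Set.Ioi k))
  have h1 : ∫⁻ ω, ENNReal.ofReal (Y ω) ∂P = ∑' k : ℕ, P {ω | k < Y ω} := by
    have h2 : ∀ ω, ENNReal.ofReal (Y ω) = ∑' k : ℕ, Set.indicator {ω | k < Y ω} 1 ω := by
      intro ω
      rw [tsum_eq_sum (s := Finset.range (Y ω))]
      · rw [Finset.sum_congr rfl (g := fun _ => 1)]
        · simp
        · intro k hk
          exact Set.indicator_of_mem (by simpa using hk) _
      · intro k hk
        exact Set.indicator_of_notMem (by simpa using hk) _
    simp_rw [h2]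
    rw [lintegral_tsum fun k => (measurable_one.indicator (hm k)).aemeasurable]
    exact tsum_congr fun k => lintegral_indicator_one (hm k)
  have h3 := ofReal_integral_eq_lintegral_ofReal hint (Eventually.of_forall fun ω => by positivity)
  rw [h1] at h3
  have h4 : ∑' k : ℕ, P {ω | k < Y ω} ≠ ⊤ := by rw [← h3]; exact ENNReal.ofReal_ne_top
  have h5 := ENNReal.hasSum_toReal h4
  rw [← ENNReal.tsum_toReal_eq (fun k => measure_ne_top _ _), ← h3,
    ENNReal.toReal_ofReal (integral_nonneg fun ω => by positivity)] at h5
  exact h5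

end RandomWalk

/-! ### Aperiodicity of the undershoot and the Poisson equation. -/

namespace RandomWalk

open IntConv RenewalSequence

variable {Ω : Type*} [MeasurableSpace Ω] {P : Measure Ω} {X : ℕ → Ω → ℤ}

namespace IIDSteps

theorem massFun_add_maxAfter_ne_zero (H : IIDSteps P X) {s x : ℤ}
    (hs : massFun P (maxAfter X 0) s ≠ 0) (hx : massFun P (X 0) x ≠ 0) :
    massFun P (fun ω => X 0 ω + maxAfter X 1 ω) (s + x) ≠ 0 := by
  rw [H.massFun_add_maxAfter, conv]
  refine ne_of_gt (lt_of_lt_of_le ?_ (ENNReal.le_tsum x))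
  rw [add_sub_cancel_right]
  exact pos_iff_ne_zero.2 (mul_ne_zero hx hs)

theorem massFun_max_ne_zero (H : IIDSteps P X) (hbdd : ∀ᵐ ω ∂P, IsBddPath X ω) {x : ℤ}
    (hx : massFun P (fun ω => X 0 ω + maxAfter X 1 ω) x ≠ 0) (hx0 : 0 ≤ x) :
    massFun P (maxAfter X 0) x ≠ 0 := by
  have h := congrFun (H.lindley hbdd) x
  rw [← H.massFun_add_maxAfter] at h
  simp only [Pi.add_apply, not_lt.2 hx0, if_false, add_zero] at h
  rw [h]
  exact ne_of_gt (lt_of_lt_of_le (pos_iff_ne_zero.2 hx) le_self_add)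

theorem massFun_max_zero_ne_zero (H : IIDSteps P X) (hbdd : ∀ᵐ ω ∂P, IsBddPath X ω)
    (h0 : P {ω | X 0 ω + maxAfter X 1 ω < 0} ≠ 0) : massFun P (maxAfter X 0) 0 ≠ 0 := by
  have h := congrFun (H.lindley hbdd) 0
  simp only [Pi.add_apply, lt_irrefl, if_false, add_zero, Pi.single_eq_same] at h
  rw [h]
  exact ne_of_gt (lt_of_lt_of_le (pos_iff_ne_zero.2 h0) le_add_self)

/-- The support of the maximum is stable under reduction modulo a downward step. -/
theorem massFun_max_emod_ne_zero (H : IIDSteps P X) (hbdd : ∀ᵐ ω ∂P, IsBddPath X ω) {b : ℕ}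
    (hb : 0 < b) (hfb : massFun P (X 0) (-b) ≠ 0) (s : ℕ)
    (hs : massFun P (maxAfter X 0) s ≠ 0) :
    massFun P (maxAfter X 0) ((s % b : ℕ) : ℤ) ≠ 0 := by
  induction s using Nat.strong_induction_on with
  | _ s ih =>
    rcases lt_or_ge s b with h | h
    · rwa [Nat.mod_eq_of_lt h]
    · rw [Nat.mod_eq_sub_mod h]
      refine ih (s - b) (by omega) ?_
      have := H.massFun_max_ne_zero hbdd (H.massFun_add_maxAfter_ne_zero hs hfb) (by omega)
      rwa [show (s : ℤ) + -(b : ℤ) = ((s - b : ℕ) : ℤ) by omega] at this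

/-- Once the maximum is reduced to `s % b < b`, one downward step of size `b` lands strictly below
`0`. -/
theorem undershoot_ne_zero (H : IIDSteps P X) (hbdd : ∀ᵐ ω ∂P, IsBddPath X ω) {b : ℕ}
    (hb : 0 < b) (hfb : massFun P (X 0) (-b) ≠ 0) (s : ℕ)
    (hs : massFun P (maxAfter X 0) s ≠ 0) :
    massFun P (fun ω => X 0 ω + maxAfter X 1 ω) (((s % b : ℕ) : ℤ) + -(b : ℤ)) ≠ 0 :=
  H.massFun_add_maxAfter_ne_zero (H.massFun_max_emod_ne_zero hbdd hb hfb s hs) hfb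

theorem exists_downward_step (hneg : ∫ ω, (X 0 ω : ℝ) ∂P < 0) :
    ∃ b : ℕ, 0 < b ∧ massFun P (X 0) (-b) ≠ 0 := by
  by_contra hcon
  push Not at hcon
  have h1 : ∀ᵐ ω ∂P, 0 ≤ X 0 ω := by
    have h2 : ∀ b : ℕ, ∀ᵐ ω ∂P, 0 < b → X 0 ω ≠ -b := by
      intro b
      rcases b.eq_zero_or_pos with rfl | hb
      · simp
      · filter_upwards [measure_eq_zero_iff_ae_notMem.1 (hcon b hb)] with ω hω _
        exact hω
    filter_upwards [ae_all_iff.2 h2] with ω hω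
    by_contra h
    exact hω (-X 0 ω).toNat (by omega) (by omega)
  have h3 : 0 ≤ ∫ ω, (X 0 ω : ℝ) ∂P :=
    integral_nonneg_of_ae (h1.mono fun ω hω => Int.cast_nonneg hω)
  linarith

variable [IsProbabilityMeasure P]

theorem exists_max_ne_zero (H : IIDSteps P X) (hbdd : ∀ᵐ ω ∂P, IsBddPath X ω) :
    ∃ s : ℕ, massFun P (maxAfter X 0) s ≠ 0 := by
  by_contra hcon
  push Not at hcon
  have h1 : ∀ x, massFun P (maxAfter X 0) x = 0 := by
    intro x
    rcases lt_or_ge x 0 with hx | hx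
    · refine massFun_eq_zero ?_
      filter_upwards [hbdd] with ω hω h
      have := hω.maxAfter_nonneg 0
      omega
    · have := hcon x.toNat
      rwa [Int.toNat_of_nonneg hx] at this
  have h2 := tsum_massFun (P := P) (H.measurable_maxAfter 0)
  simp [h1] at h2

theorem undershoot_pos (H : IIDSteps P X) (hbdd : ∀ᵐ ω ∂P, IsBddPath X ω)
    (hneg : ∫ ω, (X 0 ω : ℝ) ∂P < 0) : P {ω | X 0 ω + maxAfter X 1 ω < 0} ≠ 0 := by
  obtain ⟨b, hb, hfb⟩ := exists_downward_step hneg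
  obtain ⟨s, hs⟩ := H.exists_max_ne_zero hbdd
  have h := H.undershoot_ne_zero hbdd hb hfb s hs
  refine ne_of_gt (lt_of_lt_of_le (pos_iff_ne_zero.2 h) (measure_mono fun ω hω => ?_))
  have h1 : X 0 ω + maxAfter X 1 ω = ((s % b : ℕ) : ℤ) + -(b : ℤ) := hω
  have h2 := Nat.mod_lt s hb
  change X 0 ω + maxAfter X 1 ω < 0
  omega

/-- The undershoot of the Lindley recursion is aperiodic. -/
theorem undershoot_aperiodic (H : IIDSteps P X) (hbdd : ∀ᵐ ω ∂P, IsBddPath X ω)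
    (hneg : ∫ ω, (X 0 ω : ℝ) ∂P < 0) (haper : IsAperiodic P (X 0)) (d : ℕ)
    (hd : ∀ n : ℕ, massFun P (fun ω => X 0 ω + maxAfter X 1 ω) (-((n : ℤ) + 1)) ≠ 0 → d ∣ n + 1) :
    d = 1 := by
  have h0 := H.massFun_max_zero_ne_zero hbdd (H.undershoot_pos hbdd hneg)
  -- Undershoots of size `b - s % b` have positive probability; `s = 0` then gives `d ∣ b` for every
  -- downward step.
  have hdown : ∀ b : ℕ, 0 < b → massFun P (X 0) (-b) ≠ 0 → ∀ s : ℕ,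
      massFun P (maxAfter X 0) s ≠ 0 → d ∣ b - s % b := by
    intro b hb hfb s hs
    have h1 := H.undershoot_ne_zero hbdd hb hfb s hs
    have h2 := Nat.mod_lt s hb
    have h3 := hd (b - s % b - 1) (by convert h1 using 2; omega)
    rwa [show b - s % b - 1 + 1 = b - s % b by omega] at h3
  have hdown0 : ∀ b : ℕ, 0 < b → massFun P (X 0) (-b) ≠ 0 → d ∣ b := by
    intro b hb hfb
    simpa using hdown b hb hfb 0 (by simpa using h0)
  obtain ⟨b, hb, hfb⟩ := exists_downward_step hneg
  have hsub : ∀ z : ℤ, massFun P (X 0) z ≠ 0 → (d : ℤ) ∣ z := by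
    intro z hz
    rcases lt_or_ge z 0 with hz0 | hz0
    · have h1 := hdown0 (-z).toNat (by omega) (by
        rwa [show (-((-z).toNat : ℤ)) = z by omega])
      have h2 : (d : ℤ) ∣ ((-z).toNat : ℤ) := by exact_mod_cast h1
      rw [Int.toNat_of_nonneg (by omega)] at h2
      exact (dvd_neg).1 h2
    · obtain ⟨n, rfl⟩ := Int.eq_ofNat_of_zero_le hz0
      -- A step `n ≥ 0` followed by zero maximum puts mass at `n`; then `d ∣ b` and `d ∣ b - n % b`
      -- force `d ∣ n`.
      have h1 : massFun P (maxAfter X 0) n ≠ 0 := by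
        have := H.massFun_max_ne_zero hbdd (H.massFun_add_maxAfter_ne_zero h0 hz) (by omega)
        simpa using this
      have h2 := hdown b hb hfb n h1
      have h3 := hdown0 b hb hfb
      have h4 : d ∣ n % b := by
        have h5 := (Nat.dvd_sub_iff_right (Nat.mod_lt n hb).le h3).1 h2
        exact h5
      have h5 : d ∣ n := by
        rw [← Nat.mod_add_div n b]
        exact dvd_add h4 (h3.mul_right _)
      exact_mod_cast h5
  have hle : AddSubgroup.closure {z : ℤ | P {ω | X 0 ω = z} ≠ 0} ≤
      AddSubgroup.zmultiples (d : ℤ) := by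
    rw [AddSubgroup.closure_le]
    intro z hz
    exact Int.mem_zmultiples_iff.2 (hsub z hz)
  rw [haper] at hle
  have h1 : (d : ℤ) ∣ 1 := Int.mem_zmultiples_iff.1 (hle (AddSubgroup.mem_top 1))
  exact Nat.dvd_one.1 (by exact_mod_cast h1)

/-- The Poisson equation for the law of the maximum convolved with the renewal sequence of the
undershoot, together with the renewal theorem for the latter. -/
theorem exists_descending_renewal (H : IIDSteps P X)
    (hint : Integrable (fun ω => (X 0 ω : ℝ)) P) (hneg : ∫ ω, (X 0 ω : ℝ) ∂P < 0)
    (haper : IsAperiodic P (X 0)) :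
    ∃ (p : ℝ) (u : ℕ → ℝ), 0 < p ∧ (∀ n, 0 ≤ u n) ∧ (∀ n, u n ≤ 1) ∧
      Tendsto u atTop (𝓝 (p / |∫ ω, (X 0 ω : ℝ) ∂P|)) ∧
      conv (massFun P (maxAfter X 0)) (reflect u) =
        conv (massFun P (X 0)) (conv (massFun P (maxAfter X 0)) (reflect u)) +
          Pi.single 0 (ENNReal.ofReal p) := by
  have hbdd := H.ae_isBddPath hint hneg
  set Z : Ω → ℤ := fun ω => X 0 ω + maxAfter X 1 ω with hZ
  have hZm : Measurable Z := (H.meas 0).add (H.measurable_maxAfter 1)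
  have hmeasIio : ∀ k : ℤ, MeasurableSet {ω | Z ω < k} := fun k =>
    hZm (MeasurableSet.of_discrete (s := Set.Iio k))
  set p : ℝ := P.real {ω | Z ω < 0} with hp
  have hp0 : 0 < p := measureReal_nonneg.lt_of_ne' (by
    rw [Measure.real, ENNReal.toReal_ne_zero]
    exact ⟨H.undershoot_pos hbdd hneg, measure_ne_top _ _⟩)
  -- Tails of the undershoot conditioned to be positive; by `integral_undershoot` their sum is `|μ|
  -- / p`.
  set r : ℕ → ℝ := fun k => P.real {ω | Z ω < -(k : ℤ)} / p with hr
  have hrdiff : ∀ k : ℕ, massFun P Z (-((k : ℤ) + 1)) = ENNReal.ofReal (p * (r k - r (k + 1))) := by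
    intro k
    have h1 : P.real {ω | Z ω < -(k : ℤ)} =
        P.real {ω | Z ω = -((k : ℤ) + 1)} + P.real {ω | Z ω < -((k + 1 : ℕ) : ℤ)} := by
      rw [← measureReal_union _ (hmeasIio _)]
      · congr 1
        ext ω
        simp only [Set.mem_union, Set.mem_ofPred_eq]
        omega
      · refine Set.disjoint_left.2 fun ω h1 h2 => ?_
        simp only [Set.mem_ofPred_eq] at h1 h2
        omega
    have h2 : p * (r k - r (k + 1)) = P.real {ω | Z ω = -((k : ℤ) + 1)} := by
      simp only [hr]
      rw [mul_sub, mul_div_cancel₀ _ hp0.ne', mul_div_cancel₀ _ hp0.ne']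
      linarith
    rw [h2, ofReal_measureReal]
    rfl
  have hranti : Antitone r := by
    refine antitone_nat_of_succ_le fun k => ?_
    simp only [hr]
    refine div_le_div_of_nonneg_right (measureReal_mono fun ω hω => ?_) hp0.le
    simp only [Set.mem_ofPred_eq] at hω ⊢
    omega
  have hr0 : r 0 = 1 := by
    simp only [hr, Nat.cast_zero, neg_zero]
    exact div_self hp0.ne'
  have hrnn : ∀ n, 0 ≤ r n := fun n => div_nonneg measureReal_nonneg hp0.le
  obtain ⟨u, hu⟩ := exists_isRenewal hranti hrnn hr0
  have hrsum : HasSum r (|∫ ω, (X 0 ω : ℝ) ∂P| / p) := by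
    obtain ⟨hi1, hi2⟩ := H.integral_undershoot hint hbdd
    have hYm : Measurable fun ω => (-Z ω).toNat := (measurable_of_countable Int.toNat).comp hZm.neg
    have h1 := hasSum_measureReal_lt hYm hi1
    rw [hi2, ← abs_of_neg hneg] at h1
    have h2 : r = fun k : ℕ => P.real {ω | k < (-Z ω).toNat} / p := by
      funext k
      have : {ω | Z ω < -(k : ℤ)} = {ω | k < (-Z ω).toNat} := by
        ext ω
        simp only [Set.mem_ofPred_eq]
        omega
      simp only [hr, this]
    rw [h2]
    exact h1.div_const p
  have htend := hu.tendsto hrsum (fun d hd => by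
    refine H.undershoot_aperiodic hbdd hneg haper d fun n hn => hd n fun hcon => hn ?_
    change massFun P Z _ = 0
    rw [hrdiff, hcon, sub_self, mul_zero, ENNReal.ofReal_zero])
  rw [one_div_div] at htend
  refine ⟨p, u, hp0, hu.nonneg_renewal, hu.le_one, htend, ?_⟩
  have hpP : P {ω | Z ω < 0} = ENNReal.ofReal p := (ofReal_measureReal).symm
  have hlind := H.lindley hbdd
  rw [show P {ω | X 0 ω + maxAfter X 1 ω < 0} = ENNReal.ofReal p from hpP] at hlind
  refine poisson_of_lindley ENNReal.ofReal_ne_top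
    (fun x => ne_top_of_le_ne_top ENNReal.one_ne_top (reflect_le_one hu.le_one x)) hlind ?_
  -- The renewal equation is the recursion `hu.step` at negative points, `u 0 = 1` at `0`, and
  -- trivial at positive ones.
  funext x
  rw [Pi.smul_apply, Pi.add_apply, conv_reflect, smul_eq_mul]
  have hu0 : u 0 = 1 := by simpa [hr0] using hu.sum_eq 0
  rcases lt_trichotomy x 0 with hx | rfl | hx
  · obtain ⟨n, rfl⟩ : ∃ n : ℕ, x = -((n : ℤ) + 1) := ⟨(-x - 1).toNat, by omega⟩
    rw [Pi.single_eq_of_ne hx.ne, zero_add, tsum_eq_sum (s := Finset.range (n + 1)),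
      ← Finset.sum_range_reflect]
    · have h1 : reflect u (-((n : ℤ) + 1)) = ENNReal.ofReal (u (n + 1)) := by
        rw [reflect, if_pos hx.le]
        congr 2
      rw [h1, hu.step, ← ENNReal.ofReal_mul hp0.le, Finset.mul_sum, ENNReal.ofReal_sum_of_nonneg]
      · refine Finset.sum_congr rfl fun k hk => ?_
        have hk' := Finset.mem_range.1 hk
        have h2 : -((n : ℤ) + 1) + ((n + 1 - 1 - k : ℕ) : ℤ) = -((k : ℤ) + 1) := by omega
        rw [h2, if_pos (by omega)]
        change _ = massFun P Z _ * _
        rw [hrdiff, ← ENNReal.ofReal_mul (mul_nonneg hp0.le (sub_nonneg.2 (hranti k.le_succ)))]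
        congr 1
        rw [show n + 1 - 1 - k = n - k by omega]
        ring
      · intro k _
        exact mul_nonneg hp0.le (mul_nonneg (sub_nonneg.2 (hranti k.le_succ))
          (hu.nonneg_renewal _))
    · intro y hy
      rw [if_neg (by have := Finset.mem_range.not.1 hy; omega), zero_mul]
  · rw [Pi.single_eq_same, ENNReal.tsum_eq_zero.2]
    · simp [reflect, hu0]
    · intro y
      rw [if_neg (by omega), zero_mul]
  · rw [Pi.single_eq_of_ne hx.ne', ENNReal.tsum_eq_zero.2]
    · simp [reflect, not_le.2 hx]
    · intro y
      rw [if_neg (by omega), zero_mul]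

/-- The convolution is the mean of `reflect u (x - S*)`, and `x - S*` is eventually positive, where
`reflect u` vanishes. -/
theorem tendsto_conv_max_atTop (H : IIDSteps P X) {u : ℕ → ℝ} (hu : ∀ n, u n ≤ 1) :
    Tendsto (conv (massFun P (maxAfter X 0)) (reflect u)) atTop (𝓝 0) := by
  have hm := H.measurable_maxAfter 0
  have h := tendsto_lintegral_filter_of_dominated_convergence (μ := P) (l := (atTop : Filter ℤ))
    (F := fun x ω => reflect u (x - maxAfter X 0 ω)) (f := fun _ => 0) (fun _ => 1)
    (Eventually.of_forall fun x => (measurable_of_countable fun y => reflect u (x - y)).comp hm)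
    (Eventually.of_forall fun x => Eventually.of_forall fun ω => reflect_le_one hu _)
    (by simp) (Eventually.of_forall fun ω => by
      refine tendsto_const_nhds.congr' ?_
      filter_upwards [eventually_gt_atTop (maxAfter X 0 ω)] with x hx
      rw [reflect, if_neg (by omega)])
  simpa only [← conv_massFun hm, lintegral_zero] using h

/-- Here `x - S*` tends to `-∞`, so the limit of `u` appears; this becomes the renewal theorem for
the Green function. -/
theorem tendsto_conv_max_atBot (H : IIDSteps P X) {u : ℕ → ℝ} (hu : ∀ n, u n ≤ 1) {l : ℝ}
    (hl : Tendsto u atTop (𝓝 l)) :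
    Tendsto (conv (massFun P (maxAfter X 0)) (reflect u)) atBot (𝓝 (ENNReal.ofReal l)) := by
  have hm := H.measurable_maxAfter 0
  have h := tendsto_lintegral_filter_of_dominated_convergence (μ := P) (l := (atBot : Filter ℤ))
    (F := fun x ω => reflect u (x - maxAfter X 0 ω)) (f := fun _ => ENNReal.ofReal l) (fun _ => 1)
    (Eventually.of_forall fun x => (measurable_of_countable fun y => reflect u (x - y)).comp hm)
    (Eventually.of_forall fun x => Eventually.of_forall fun ω => reflect_le_one hu _)
    (by simp) (Eventually.of_forall fun ω =>
      (tendsto_reflect hl).comp (tendsto_atBot_add_const_right _ _ tendsto_id))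
  simpa only [← conv_massFun hm, lintegral_const, measure_univ, mul_one] using h

theorem conv_max_le_one (H : IIDSteps P X) {u : ℕ → ℝ} (hu : ∀ n, u n ≤ 1) (x : ℤ) :
    conv (massFun P (maxAfter X 0)) (reflect u) x ≤ 1 := by
  rw [conv_massFun (H.measurable_maxAfter 0)]
  refine (lintegral_mono fun ω => reflect_le_one hu _).trans ?_
  simp

/-- A bounded solution of the Poisson equation vanishing at `+∞` is the Green function. -/
theorem green_eq_of_poisson (H : IIDSteps P X) (hint : Integrable (fun ω => (X 0 ω : ℝ)) P)
    (hneg : ∫ ω, (X 0 ω : ℝ) ∂P < 0) {g : ℤ → ℝ≥0∞} {p : ℝ≥0∞} (hg1 : ∀ x, g x ≤ 1)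
    (hg : Tendsto g atTop (𝓝 0))
    (poisson : g = conv (massFun P (X 0)) g + Pi.single 0 p) (x : ℤ) :
    g x = p * green P X x := by
  have hiter : ∀ n : ℕ, g = conv (massFun P (walk X n)) g +
      ∑ k ∈ Finset.range n, p • massFun P (walk X k) := by
    intro n
    induction n with
    | zero =>
      have h1 : massFun P (walk X 0) = Pi.single 0 1 := by
        funext y
        rcases eq_or_ne y 0 with rfl | hy
        · simp [massFun, walk_zero]
        · rw [Pi.single_eq_of_ne hy]
          exact massFun_eq_zero (Eventually.of_forall fun ω => by rw [walk_zero]; exact hy.symm)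
      simp [h1, single_conv]
    | succ n ih =>
      conv_lhs => rw [ih]
      conv_lhs => rw [poisson]
      rw [conv_add, ← conv_assoc, ← H.massFun_walk_succ, conv_single, Finset.sum_range_succ]
      abel
  -- The remainder after `n` iterations is the mean of `g (x - S_n)`, with `x - S_n` tending to
  -- `+∞`.
  have hlim : Tendsto (fun n => conv (massFun P (walk X n)) g x) atTop (𝓝 0) := by
    have h := tendsto_lintegral_filter_of_dominated_convergence (μ := P) (l := (atTop : Filter ℕ))
      (F := fun n ω => g (x - walk X n ω)) (f := fun _ => 0) (fun _ => 1)
      (Eventually.of_forall fun n =>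
        (measurable_of_countable fun y => g (x - y)).comp (H.measurable_walk n))
      (Eventually.of_forall fun n => Eventually.of_forall fun ω => hg1 _)
      (by simp) (by
        filter_upwards [H.tendsto_walk_atBot hint hneg] with ω hω
        exact hg.comp (tendsto_atTop_add_const_left _ _ (tendsto_neg_atBot_atTop.comp hω)))
    simpa only [← conv_massFun (H.measurable_walk _), lintegral_zero] using h
  have hsum : Tendsto (fun n => ∑ k ∈ Finset.range n, p * massFun P (walk X k) x) atTop
      (𝓝 (∑' k, p * massFun P (walk X k) x)) := ENNReal.summable.hasSum.tendsto_sum_nat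
  have h1 := hlim.add hsum
  rw [zero_add, ENNReal.tsum_mul_left] at h1
  refine tendsto_nhds_unique (tendsto_const_nhds.congr fun n => ?_) h1
  have := congrFun (hiter n) x
  rw [this]
  simp

end IIDSteps

end RandomWalk

/-! ### Subexponential laws on the half-line -/

namespace HalfLineLaw

variable {ρ : Measure ℝ}

theorem conv_Ioi (x : ℝ) : (Measure.conv ρ ρ).real (Set.Ioi x) =
    (ρ.prod ρ).real {z : ℝ × ℝ | x < z.1 + z.2} := by
  rw [Measure.conv, map_measureReal_apply (by fun_prop) measurableSet_Ioi]
  rfl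

theorem ae_nonneg (h0 : ρ (Set.Iio 0) = 0) : ∀ᵐ x ∂ρ, 0 ≤ x := by
  filter_upwards [measure_eq_zero_iff_ae_notMem.1 h0] with x hx using not_lt.1 hx

theorem ae_nonneg_prod (h0 : ρ (Set.Iio 0) = 0) :
    ∀ᵐ z : ℝ × ℝ ∂(ρ.prod ρ), 0 ≤ z.1 ∧ 0 ≤ z.2 := by
  have h := ae_nonneg h0
  have h1 : ∀ᵐ z : ℝ × ℝ ∂(ρ.prod ρ), 0 ≤ z.1 :=
    Measure.quasiMeasurePreserving_fst.ae h
  have h2 : ∀ᵐ z : ℝ × ℝ ∂(ρ.prod ρ), 0 ≤ z.2 :=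
    Measure.quasiMeasurePreserving_snd.ae h
  filter_upwards [h1, h2] with z hz1 hz2 using ⟨hz1, hz2⟩

variable [IsProbabilityMeasure ρ]

theorem tail_antitone : Antitone fun x : ℝ => ρ.real (Set.Ioi x) := fun _ _ h =>
  measureReal_mono (Set.Ioi_subset_Ioi h)

theorem tendsto_tail : Tendsto (fun x : ℝ => ρ.real (Set.Ioi x)) atTop (𝓝 0) := by
  have h : Tendsto (fun x : ℝ => 1 - cdf ρ x) atTop (𝓝 (1 - 1)) :=
    (tendsto_cdf_atTop ρ).const_sub 1
  rw [sub_self] at h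
  refine h.congr fun x => ?_
  rw [cdf_eq_real, ← probReal_compl_eq_one_sub measurableSet_Iic, Set.compl_Iic]

theorem measureReal_Iic (x : ℝ) : ρ.real (Set.Iic x) = 1 - ρ.real (Set.Ioi x) := by
  rw [← probReal_compl_eq_one_sub measurableSet_Ioi, Set.compl_Ioi]

theorem measureReal_Ioc {x y : ℝ} (h : x ≤ y) :
    ρ.real (Set.Ioc x y) = ρ.real (Set.Ioi x) - ρ.real (Set.Ioi y) := by
  rw [eq_sub_iff_add_eq, ← measureReal_union _ measurableSet_Ioi, Set.Ioc_union_Ioi_eq_Ioi h]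
  exact Set.disjoint_left.2 fun z h1 h2 => not_lt.2 h1.2 h2

/-- Lower bound for the tail of the sum, splitting the first coordinate at `y` and `x`. -/
theorem conv_tail_ge (h0 : ρ (Set.Iio 0) = 0) {x y : ℝ} (hxy : y ≤ x) :
    ρ.real (Set.Ioi x) + (1 - ρ.real (Set.Ioi y)) * ρ.real (Set.Ioi x) +
      (ρ.real (Set.Ioi y) - ρ.real (Set.Ioi x)) * ρ.real (Set.Ioi (x - y)) ≤
    (Measure.conv ρ ρ).real (Set.Ioi x) := by
  have hA : ρ.real (Set.Ioi x) = (ρ.prod ρ).real (Set.Ioi x ×ˢ Set.univ) := by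
    rw [measureReal_prod_prod]; simp
  rw [conv_Ioi, ← measureReal_Iic y, ← measureReal_Ioc hxy, ← measureReal_prod_prod,
    ← measureReal_prod_prod]
  conv_lhs => rw [hA]
  rw [← measureReal_union, ← measureReal_union]
  · refine ENNReal.toReal_mono (measure_ne_top _ _) (measure_mono_ae ?_)
    filter_upwards [ae_nonneg_prod h0] with z hz hmem
    change x < z.1 + z.2
    rcases hmem with (h | h) | h
    · have : x < z.1 := h.1
      linarith [hz.2]
    · have : x < z.2 := h.2
      linarith [hz.1]
    · have h1 : y < z.1 := h.1.1
      have h2 : x - y < z.2 := h.2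
      linarith
  · refine Set.disjoint_left.2 fun z h1 h2 => ?_
    have h3 : z.1 ≤ x := h2.1.2
    have h4 : y < z.1 := h2.1.1
    rcases h1 with h1 | h1
    · exact not_lt.2 h3 h1.1
    · exact not_lt.2 h1.1 h4
  · exact measurableSet_Ioc.prod measurableSet_Ioi
  · refine Set.disjoint_left.2 fun z h1 h2 => ?_
    have h3 : x < z.1 := h1.1
    have h4 : z.1 ≤ y := h2.1
    linarith
  · exact measurableSet_Iic.prod measurableSet_Ioi

/-- Subexponential laws are long-tailed. -/
theorem tendsto_tail_ratio (h0 : ρ (Set.Iio 0) = 0) (hpos : ∀ x, 0 < ρ.real (Set.Ioi x))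
    (hsub : Tendsto (fun x => (Measure.conv ρ ρ).real (Set.Ioi x) / ρ.real (Set.Ioi x)) atTop (𝓝 2))
    {y : ℝ} (hy : 0 ≤ y) :
    Tendsto (fun x => ρ.real (Set.Ioi (x - y)) / ρ.real (Set.Ioi x)) atTop (𝓝 1) := by
  set t : ℝ → ℝ := fun x => ρ.real (Set.Ioi x) with ht
  -- This is the upper bound obtained by solving `conv_tail_ge` for `t (x - y) / t x`; it tends to
  -- `1`, while monotonicity gives the lower bound `1`.
  have h1 : Tendsto (fun x => ((Measure.conv ρ ρ).real (Set.Ioi x) / t x - 2 + t y) /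
      (t y - t x)) atTop (𝓝 ((2 - 2 + t y) / (t y - 0))) :=
    ((hsub.sub_const 2).add_const (t y)).div ((tendsto_tail (ρ := ρ)).const_sub (t y))
      (by simpa using (hpos y).ne')
  rw [sub_self, zero_add, sub_zero, div_self (hpos y).ne'] at h1
  refine tendsto_of_tendsto_of_tendsto_of_le_of_le' tendsto_const_nhds h1
    (Eventually.of_forall fun x => ?_) ?_
  · exact (one_le_div (hpos x)).2 (tail_antitone (by linarith))
  · filter_upwards [eventually_ge_atTop y, (tendsto_tail (ρ := ρ)).eventually_lt_const (hpos y)] with x hx hxy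
    have h2 := conv_tail_ge h0 hx
    have h3 : t x < t y := hxy
    have h4 : 0 < t x := hpos x
    rw [le_div_iff₀ (by linarith), div_mul_eq_mul_div, div_le_iff₀ h4]
    have h5 : ((Measure.conv ρ ρ).real (Set.Ioi x) / t x - 2 + t y) * t x =
        (Measure.conv ρ ρ).real (Set.Ioi x) - 2 * t x + t y * t x := by
      field_simp
    rw [h5]
    simp only [ht] at *
    linarith

/-- A long-tailed law with dominatedly varying tail is subexponential. -/
theorem tendsto_conv_of_dominated (h0 : ρ (Set.Iio 0) = 0) (hpos : ∀ x, 0 < ρ.real (Set.Ioi x))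
    (hlong : ∀ y, 0 ≤ y →
      Tendsto (fun x => ρ.real (Set.Ioi (x - y)) / ρ.real (Set.Ioi x)) atTop (𝓝 1))
    {C : ℝ} (hdom : ∀ᶠ x in atTop, ρ.real (Set.Ioi (x / 2)) ≤ C * ρ.real (Set.Ioi x)) :
    Tendsto (fun x => (Measure.conv ρ ρ).real (Set.Ioi x) / ρ.real (Set.Ioi x)) atTop (𝓝 2) := by
  set t : ℝ → ℝ := fun x => ρ.real (Set.Ioi x) with ht
  have hC : 0 ≤ C := by
    obtain ⟨x, hx⟩ := hdom.exists
    by_contra hcon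
    have := mul_neg_of_neg_of_pos (not_le.1 hcon) (hpos x)
    have := hpos (x / 2)
    linarith
  -- If the sum exceeds `x`, either one coordinate exceeds `x - m`, or one exceeds `x / 2` and the
  -- other exceeds `m`.
  have hup : ∀ m x : ℝ, (Measure.conv ρ ρ).real (Set.Ioi x) ≤
      2 * t (x - m) + 2 * (t (x / 2) * t m) := by
    intro m x
    rw [conv_Ioi]
    have hA : t (x - m) = (ρ.prod ρ).real (Set.Ioi (x - m) ×ˢ Set.univ) := by
      rw [measureReal_prod_prod]; simp [ht]
    have hB : t (x - m) = (ρ.prod ρ).real (Set.univ ×ˢ Set.Ioi (x - m)) := by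
      rw [measureReal_prod_prod]; simp [ht]
    have hD : t (x / 2) * t m = (ρ.prod ρ).real (Set.Ioi (x / 2) ×ˢ Set.Ioi m) := by
      rw [measureReal_prod_prod]
    have hE : t (x / 2) * t m = (ρ.prod ρ).real (Set.Ioi m ×ˢ Set.Ioi (x / 2)) := by
      rw [measureReal_prod_prod, mul_comm]
    calc _ ≤ (ρ.prod ρ).real ((Set.Ioi (x - m) ×ˢ Set.univ ∪ Set.univ ×ˢ Set.Ioi (x - m)) ∪
          (Set.Ioi (x / 2) ×ˢ Set.Ioi m ∪ Set.Ioi m ×ˢ Set.Ioi (x / 2))) := by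
          refine measureReal_mono fun z hz => ?_
          have hz' : x < z.1 + z.2 := hz
          simp only [Set.mem_union, Set.mem_prod, Set.mem_Ioi, Set.mem_univ, and_true, true_and]
          by_contra hcon
          simp only [not_or, not_lt, not_and] at hcon
          obtain ⟨⟨h1, h2⟩, h3, h4⟩ := hcon
          rcases lt_or_ge (x / 2) z.1 with h5 | h5
          · linarith [h3 h5]
          · have := h4 (by linarith)
            linarith
      _ ≤ _ := by
          refine (measureReal_union_le _ _).trans ?_
          have h1 := measureReal_union_le (μ := ρ.prod ρ)
            (Set.Ioi (x - m) ×ˢ Set.univ) (Set.univ ×ˢ Set.Ioi (x - m))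
          have h2 := measureReal_union_le (μ := ρ.prod ρ)
            (Set.Ioi (x / 2) ×ˢ Set.Ioi m) (Set.Ioi m ×ˢ Set.Ioi (x / 2))
          rw [← hA, ← hB] at h1
          rw [← hD, ← hE] at h2
          linarith
  have hlow : ∀ x, 2 * t x - t x * t x ≤ (Measure.conv ρ ρ).real (Set.Ioi x) := by
    intro x
    have := conv_tail_ge h0 (le_refl x)
    simp only [ht] at *
    linarith
  rw [tendsto_order]
  constructor
  · intro c hc
    filter_upwards [(tendsto_tail (ρ := ρ)).eventually_lt_const (show (0 : ℝ) < 2 - c by linarith)] with x hx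
    rw [lt_div_iff₀ (hpos x)]
    have h1 := hlow x
    have h2 : 0 < t x := hpos x
    have h3 : t x < 2 - c := hx
    change c * t x < _
    nlinarith
  · intro c hc
    have hev : Tendsto (fun m => 2 * (C * t m)) atTop (𝓝 0) := by
      simpa using ((tendsto_tail (ρ := ρ)).const_mul C).const_mul 2
    obtain ⟨m, hm, hm0⟩ := ((hev.eventually_lt_const
      (show (0 : ℝ) < (c - 2) / 2 by linarith)).and (eventually_ge_atTop 0)).exists
    have h1 := (hlong m hm0).const_mul 2
    rw [mul_one] at h1
    filter_upwards [h1.eventually_lt_const (show (2 : ℝ) < 2 + (c - 2) / 2 by linarith), hdom]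
      with x hx1 hx2
    have hx := hpos x
    have h2 := hup m x
    rw [div_lt_iff₀ hx]
    have h3 : 2 * t (x - m) < (2 + (c - 2) / 2) * t x := by
      have := mul_lt_mul_of_pos_right hx1 hx
      rwa [mul_assoc, div_mul_cancel₀ _ hx.ne'] at this
    have h4 : t (x / 2) * t m ≤ C * t x * t m := mul_le_mul_of_nonneg_right hx2 (hpos m).le
    have h5 : 2 * (C * t m) * t x ≤ (c - 2) / 2 * t x := mul_le_mul_of_nonneg_right hm.le hx.le
    change _ < c * t x
    nlinarith

/-- If the tails of a summable sequence are asymptotic to a multiple of a subexponential tail, then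
the big-jump contributions to the convolution are negligible. -/
theorem eventually_sum_le (h0 : ρ (Set.Iio 0) = 0) (hpos : ∀ x, 0 < ρ.real (Set.Ioi x))
    (hsub : Tendsto (fun x => (Measure.conv ρ ρ).real (Set.Ioi x) / ρ.real (Set.Ioi x)) atTop (𝓝 2))
    {a A : ℕ → ℝ} {c : ℝ} (ha : ∀ n, 0 ≤ a n) (hA0 : ∀ n, 0 ≤ A n)
    (hA : ∀ n, A n = a (n + 1) + A (n + 1))
    (hAc : Tendsto (fun n : ℕ => A n / ρ.real (Set.Ioi (n : ℝ))) atTop (𝓝 c)) {ε : ℝ} (hε : 0 < ε) :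
    ∃ m : ℕ, ∀ᶠ n : ℕ in atTop, ∑ k ∈ Finset.Ioc m n, a k * ρ.real (Set.Ioi ((n - k : ℕ) : ℝ)) ≤
      ε * ρ.real (Set.Ioi (n : ℝ)) := by
  set t : ℝ → ℝ := fun x => ρ.real (Set.Ioi x) with ht
  have hc0 : 0 ≤ c := ge_of_tendsto hAc
    (Eventually.of_forall fun n => div_nonneg (hA0 n) (hpos n).le)
  -- The estimates below add up to `(c + δ) * (1 + 2 * δ) - (c - δ) = δ * (2 + 2 * c + 2 * δ)`.
  obtain ⟨δ, hδ0, hδ⟩ : ∃ δ : ℝ, 0 < δ ∧ δ * (3 + 2 * c + 2 * δ) ≤ ε := by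
    refine ⟨min 1 (ε / (5 + 2 * c)), by positivity, ?_⟩
    have h1 : min 1 (ε / (5 + 2 * c)) ≤ 1 := min_le_left _ _
    have h2 : min 1 (ε / (5 + 2 * c)) ≤ ε / (5 + 2 * c) := min_le_right _ _
    have h3 : (0 : ℝ) < min 1 (ε / (5 + 2 * c)) := by positivity
    calc _ ≤ ε / (5 + 2 * c) * (5 + 2 * c) :=
          mul_le_mul h2 (by linarith) (by positivity) (by positivity)
      _ = ε := by field_simp
  have hnat := tendsto_natCast_atTop_atTop (R := ℝ)
  obtain ⟨m, hm⟩ := eventually_atTop.1 ((hAc.eventually_lt_const (show c < c + δ by linarith)).and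
    ((hAc.eventually_const_lt (show c - δ < c by linarith)).and
      ((tendsto_tail (ρ := ρ)).comp hnat |>.eventually_lt_const hδ0)))
  have hupA : ∀ n ≥ m, A n ≤ (c + δ) * t n := fun n hn =>
    ((div_lt_iff₀ (hpos n)).1 (hm n hn).1).le
  have hloA : ∀ n ≥ m, (c - δ) * t n ≤ A n := fun n hn =>
    ((lt_div_iff₀ (hpos n)).1 (hm n hn).2.1).le
  have htm : t m ≤ δ := (hm m le_rfl).2.2.le
  have hAsum : ∀ K n : ℕ, K ≤ n → ∑ k ∈ Finset.Ioc K n, a k + A n = A K := by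
    intro K n hKn
    induction n, hKn using Nat.le_induction with
    | base => simp
    | succ n hn ih =>
      rw [← Finset.insert_Ioc_right_eq_Ioc_add_one hn, Finset.sum_insert (by simp), ← ih, hA n]
      ring
  -- Each tail is the probability that a variable `B` of law `ρ` exceeds `n - k`. For fixed `B` the
  -- sum over `k` telescopes to a value of `A`, which is then compared with the tail of a second,
  -- independent variable of law `ρ`.
  have hkey : ∀ n ≥ m, ∑ k ∈ Finset.Ioc m n, a k * t ((n - k : ℕ) : ℝ) + A n ≤
      (c + δ) * (ρ.prod ρ).real {z : ℝ × ℝ | (m : ℝ) < z.1 ∧ (n : ℝ) - 1 - z.2 < z.1} := by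
    intro n hn
    have hmeas : MeasurableSet {z : ℝ × ℝ | (m : ℝ) < z.1 ∧ (n : ℝ) - 1 - z.2 < z.1} :=
      (measurableSet_lt measurable_const measurable_fst).inter
        (measurableSet_lt (measurable_const.sub measurable_snd) measurable_fst)
    have hpt : ∀ᵐ B ∂ρ, ∑ k ∈ Finset.Ioc m n, ENNReal.ofReal (a k) *
        Set.indicator (Set.Ioi ((n - k : ℕ) : ℝ)) 1 B + ENNReal.ofReal (A n) ≤
        ENNReal.ofReal (c + δ) *
          ρ ((fun A => (A, B)) ⁻¹' {z : ℝ × ℝ | (m : ℝ) < z.1 ∧ (n : ℝ) - 1 - z.2 < z.1}) := by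
      filter_upwards [ae_nonneg h0] with B hB
      -- Only `k > K` contribute; rounding down accounts for `n - 1` in place of `n` in the
      -- comparison event.
      set K := max m ⌊(n : ℝ) - B⌋₊ with hK
      have hKn : K ≤ n := max_le hn (by
        refine Nat.floor_le_of_le ?_
        linarith)
      have hpre : (fun A => (A, B)) ⁻¹' {z : ℝ × ℝ | (m : ℝ) < z.1 ∧ (n : ℝ) - 1 - z.2 < z.1} =
          Set.Ioi (max (m : ℝ) (n - 1 - B)) := by
        ext z
        simp
      have hKle : max (m : ℝ) (n - 1 - B) ≤ K := by
        refine max_le (by exact_mod_cast le_max_left _ _) ?_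
        have h1 := Nat.lt_floor_add_one ((n : ℝ) - B)
        have h2 : ((⌊(n : ℝ) - B⌋₊ : ℕ) : ℝ) ≤ K := by exact_mod_cast le_max_right _ _
        linarith
      have hle1 : ∑ k ∈ Finset.Ioc m n, ENNReal.ofReal (a k) *
          Set.indicator (Set.Ioi ((n - k : ℕ) : ℝ)) 1 B ≤
          ∑ k ∈ Finset.Ioc K n, ENNReal.ofReal (a k) := by
        rw [← Finset.sum_subset (show Finset.Ioc K n ⊆ Finset.Ioc m n from
          Finset.Ioc_subset_Ioc_left (le_max_left _ _))]
        · refine Finset.sum_le_sum fun k _ => mul_le_of_le_one_right' ?_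
          exact Set.indicator_le_self' (fun _ _ => zero_le_one) B
        · intro k hk1 hk2
          rw [Set.indicator_of_notMem, mul_zero]
          intro hmem
          have h1 : ((n - k : ℕ) : ℝ) < B := hmem
          rw [Nat.cast_sub (Finset.mem_Ioc.1 hk1).2] at h1
          refine hk2 (Finset.mem_Ioc.2 ⟨max_lt (Finset.mem_Ioc.1 hk1).1 ?_, (Finset.mem_Ioc.1 hk1).2⟩)
          refine (Nat.floor_lt' ?_).2 (by linarith)
          have := (Finset.mem_Ioc.1 hk1).1
          omega
      calc _ ≤ ∑ k ∈ Finset.Ioc K n, ENNReal.ofReal (a k) + ENNReal.ofReal (A n) := by gcongr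
        _ = ENNReal.ofReal (A K) := by
            rw [← ENNReal.ofReal_sum_of_nonneg fun k _ => ha k,
              ← ENNReal.ofReal_add (Finset.sum_nonneg fun k _ => ha k) (hA0 n), hAsum K n hKn]
        _ ≤ ENNReal.ofReal ((c + δ) * t K) := ENNReal.ofReal_le_ofReal (hupA K (le_max_left _ _))
        _ = ENNReal.ofReal (c + δ) * ρ (Set.Ioi (K : ℝ)) := by
            rw [ENNReal.ofReal_mul (by positivity), ht, ofReal_measureReal]
        _ ≤ _ := by
            rw [hpre]
            gcongr
    have hint := lintegral_mono_ae hpt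
    rw [lintegral_const_mul' _ _ ENNReal.ofReal_ne_top, ← Measure.prod_apply_symm hmeas,
      lintegral_add_right _ measurable_const, lintegral_const, measure_univ, mul_one,
      lintegral_finsetSum _ fun k _ =>
        (measurable_one.indicator measurableSet_Ioi).const_mul _] at hint
    have hsum : ∑ k ∈ Finset.Ioc m n, ∫⁻ B, ENNReal.ofReal (a k) *
        Set.indicator (Set.Ioi ((n - k : ℕ) : ℝ)) 1 B ∂ρ =
        ENNReal.ofReal (∑ k ∈ Finset.Ioc m n, a k * t ((n - k : ℕ) : ℝ)) := by
      rw [ENNReal.ofReal_sum_of_nonneg fun k _ => mul_nonneg (ha k) measureReal_nonneg]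
      refine Finset.sum_congr rfl fun k _ => ?_
      rw [lintegral_const_mul _ (measurable_one.indicator measurableSet_Ioi),
        lintegral_indicator_one measurableSet_Ioi, ENNReal.ofReal_mul (ha k),
        ofReal_measureReal]
    rw [hsum, ← ENNReal.ofReal_add (Finset.sum_nonneg fun k _ =>
      mul_nonneg (ha k) measureReal_nonneg) (hA0 n), ← ofReal_measureReal (μ := ρ.prod ρ),
      ← ENNReal.ofReal_mul (by positivity)] at hint
    exact (ENNReal.ofReal_le_ofReal_iff (by positivity)).1 hint
  -- The disjoint event that the first coordinate is at most `m` and the second exceeds `n - 1` is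
  -- removed from the tail of the sum, taking away almost one of its two big jumps.
  have hprod : ∀ n : ℕ, (ρ.prod ρ).real {z : ℝ × ℝ | (m : ℝ) < z.1 ∧ (n : ℝ) - 1 - z.2 < z.1} ≤
      (Measure.conv ρ ρ).real (Set.Ioi ((n : ℝ) - 1)) - (1 - t m) * t ((n : ℝ) - 1) := by
    intro n
    rw [conv_Ioi, ← measureReal_Iic (ρ := ρ) m, ht, ← measureReal_prod_prod, le_sub_iff_add_le,
      ← measureReal_union]
    · refine ENNReal.toReal_mono (measure_ne_top _ _) (measure_mono_ae ?_)
      filter_upwards [ae_nonneg_prod h0] with z hz hmem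
      change (n : ℝ) - 1 < z.1 + z.2
      rcases hmem with h | h
      · have := h.2
        linarith
      · have : (n : ℝ) - 1 < z.2 := h.2
        linarith [hz.1]
    · refine Set.disjoint_left.2 fun z h1 h2 => ?_
      have h3 : z.1 ≤ m := h2.1
      have h4 := h1.1
      linarith
    · exact measurableSet_Iic.prod measurableSet_Ioi
  have hlong := (tendsto_tail_ratio h0 hpos hsub zero_le_one).comp hnat
  have hsub' : Tendsto (fun n : ℕ => (Measure.conv ρ ρ).real (Set.Ioi ((n : ℝ) - 1)) / t n) atTop
      (𝓝 2) := by
    have h1 := ((hsub.comp (tendsto_atTop_add_const_right _ (-1) tendsto_id)).comp hnat).mul hlong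
    rw [mul_one] at h1
    refine h1.congr fun n => ?_
    simp only [Function.comp, id]
    rw [← sub_eq_add_neg, div_mul_div_cancel₀ (hpos _).ne']
  refine ⟨m, ?_⟩
  filter_upwards [eventually_ge_atTop m,
    hsub'.eventually_lt_const (show (2 : ℝ) < 2 + δ by linarith)] with n hn h1
  have hn0 : 0 < t n := hpos n
  have h2 := (div_lt_iff₀ (hpos (n : ℝ))).1 h1
  have h3 := hkey n hn
  have h4 := hprod n
  have h5 := hloA n hn
  have h6 : t n ≤ t ((n : ℝ) - 1) := tail_antitone (by linarith)
  have h7 : t m ≤ 1 := measureReal_le_one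
  have h8 : (1 - δ) * t n ≤ (1 - t m) * t ((n : ℝ) - 1) :=
    (mul_le_mul_of_nonneg_right (by linarith) hn0.le).trans
      (mul_le_mul_of_nonneg_left h6 (by linarith))
  have h9 : (ρ.prod ρ).real {z : ℝ × ℝ | (m : ℝ) < z.1 ∧ (n : ℝ) - 1 - z.2 < z.1} ≤
      (1 + 2 * δ) * t n := by
    simp only [ht] at *
    linarith
  have h10 := mul_le_mul_of_nonneg_left h9 (show 0 ≤ c + δ by positivity)
  have h11 := mul_le_mul_of_nonneg_right hδ hn0.le
  change ∑ k ∈ Finset.Ioc m n, a k * t ((n - k : ℕ) : ℝ) ≤ ε * t n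
  nlinarith

end HalfLineLaw

/-! ### Subexponential distribution functions -/

theorem positivePartLaw_Iio (ν : Measure ℝ) : positivePartLaw ν (Set.Iio 0) = 0 := by
  rw [positivePartLaw, Measure.map_apply (by fun_prop) measurableSet_Iio]
  convert measure_empty (μ := ν)
  ext x
  simp

theorem positivePartLaw_Ioi (ν : Measure ℝ) {x : ℝ} (hx : 0 ≤ x) :
    (positivePartLaw ν).real (Set.Ioi x) = ν.real (Set.Ioi x) := by
  rw [positivePartLaw, map_measureReal_apply (by fun_prop) measurableSet_Ioi]
  congr 1
  ext y
  simp [not_lt.2 hx]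

theorem isProbabilityMeasure_positivePartLaw (ν : Measure ℝ) [IsProbabilityMeasure ν] :
    IsProbabilityMeasure (positivePartLaw ν) :=
  Measure.isProbabilityMeasure_map (by fun_prop)

theorem isEquivalent_const_mul_iff {ι : Type*} {u v : ι → ℝ} {c : ℝ} (hc : c ≠ 0) {l : Filter ι}
    (hv : ∀ᶠ x in l, v x ≠ 0) :
    (u ~[l] fun x => c * v x) ↔ Tendsto (fun x => u x / v x) l (𝓝 c) := by
  rw [isEquivalent_iff_tendsto_one (hv.mono fun x hx => mul_ne_zero hc hx)]
  have h1 : (u / fun x => c * v x) = fun x => c⁻¹ * (u x / v x) := by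
    funext x
    simp only [Pi.div_apply]
    field_simp
  rw [h1]
  constructor
  · intro h
    have := h.const_mul c
    simpa [mul_inv_cancel_left₀ hc] using this
  · intro h
    have := h.const_mul c⁻¹
    rwa [inv_mul_cancel₀ hc] at this

/-- The law on the half-line behind a subexponential distribution function. -/
theorem IsSubexponential.exists_law {F : ℝ → ℝ} (h : IsSubexponential F) :
    ∃ ρ : Measure ℝ, IsProbabilityMeasure ρ ∧ ρ (Set.Iio 0) = 0 ∧
      (∀ x, 0 ≤ x → ρ.real (Set.Ioi x) = 1 - F x) ∧ (∀ x, 0 < ρ.real (Set.Ioi x)) ∧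
      Tendsto (fun x => (Measure.conv ρ ρ).real (Set.Ioi x) / ρ.real (Set.Ioi x)) atTop (𝓝 2) := by
  obtain ⟨ν, hν, hF, hpos, hequiv⟩ := h
  refine ⟨positivePartLaw ν, isProbabilityMeasure_positivePartLaw ν, positivePartLaw_Iio ν,
    fun x hx => ?_, hpos, (isEquivalent_const_mul_iff two_ne_zero (Eventually.of_forall fun x => (hpos x).ne')).1 hequiv⟩
  rw [positivePartLaw_Ioi ν hx, ← hF, HalfLineLaw.measureReal_Iic]
  ring

/-- `F` is realized by its Stieltjes measure. On `[0, ∞)` the positive part has tail `1 - F`, so the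
half-line criterion applies. -/
theorem isSubexponential_of_dominated {F : ℝ → ℝ} (hmono : Monotone F) (hcont : Continuous F)
    (hbot : Tendsto F atBot (𝓝 0)) (htop : Tendsto F atTop (𝓝 1)) (hlt : ∀ x, F x < 1)
    (hlong : ∀ y, 0 ≤ y → Tendsto (fun x => (1 - F (x - y)) / (1 - F x)) atTop (𝓝 1))
    {C : ℝ} (hdom : ∀ᶠ x in atTop, 1 - F (x / 2) ≤ C * (1 - F x)) : IsSubexponential F := by
  let f : StieltjesFunction ℝ := ⟨F, hmono, fun x => hcont.continuousWithinAt⟩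
  have hprob : IsProbabilityMeasure f.measure := f.isProbabilityMeasure hbot htop
  have hcdf : ∀ x, f.measure.real (Set.Iic x) = F x := by
    intro x
    rw [Measure.real, f.measure_Iic hbot, sub_zero]
    exact ENNReal.toReal_ofReal (hmono.le_of_tendsto hbot x)
  have hIoi : ∀ x, f.measure.real (Set.Ioi x) = 1 - F x := by
    intro x
    rw [← hcdf, HalfLineLaw.measureReal_Iic]
    ring
  have htail : ∀ x, 0 ≤ x → (positivePartLaw f.measure).real (Set.Ioi x) = 1 - F x := fun x hx => by
    rw [positivePartLaw_Ioi _ hx, hIoi]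
  have hP := isProbabilityMeasure_positivePartLaw f.measure
  have hpos : ∀ x, 0 < (positivePartLaw f.measure).real (Set.Ioi x) := by
    intro x
    have h1 := htail (max x 0) (le_max_right _ _)
    have h2 : (positivePartLaw f.measure).real (Set.Ioi (max x 0)) ≤
        (positivePartLaw f.measure).real (Set.Ioi x) := HalfLineLaw.tail_antitone (le_max_left _ _)
    linarith [hlt (max x 0)]
  refine ⟨f.measure, hprob, hcdf, hpos,
    (isEquivalent_const_mul_iff two_ne_zero (Eventually.of_forall fun x => (hpos x).ne')).2 ?_⟩
  refine HalfLineLaw.tendsto_conv_of_dominated (positivePartLaw_Iio _) hpos (fun y hy => ?_)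
    (C := C) ?_
  · refine (hlong y hy).congr' ?_
    filter_upwards [eventually_ge_atTop y] with x hx
    rw [htail _ (by linarith), htail _ (by linarith)]
  · filter_upwards [hdom, eventually_ge_atTop 0] with x hx hx0
    rw [htail _ (by linarith), htail _ hx0]
    exact hx

/-! ### Integrated tails of an integer random variable. -/

namespace RandomWalk

variable {Ω : Type*} [MeasurableSpace Ω] {P : Measure Ω} {Y : Ω → ℤ}

/-- The integrated tail `∫_x^∞ P(Y > t) dt`. -/
noncomputable def integratedTail (P : Measure Ω) (Y : Ω → ℤ) (x : ℝ) : ℝ :=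
  ∫ t in Set.Ioi x, P.real {ω | t < (Y ω : ℝ)}

theorem integratedTail_nonneg (x : ℝ) : 0 ≤ integratedTail P Y x :=
  integral_nonneg fun _ => measureReal_nonneg

theorem one_sub_integratedCDF (x : ℝ) :
    1 - integratedCDF P Y x = min (integratedTail P Y x) 1 := by
  rw [integratedCDF, show (∫ t in Set.Ioi x, P.real {ω | t < (Y ω : ℝ)}) = integratedTail P Y x
    from rfl]
  rcases le_total (integratedTail P Y x) 1 with h | h
  · rw [max_eq_left (by linarith), min_eq_left h]; ring
  · rw [max_eq_right (by linarith), min_eq_right h]; ring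

variable [IsProbabilityMeasure P]

theorem antitone_tail : Antitone fun t : ℝ => P.real {ω | t < (Y ω : ℝ)} := fun _ _ h =>
  measureReal_mono fun _ hω => lt_of_le_of_lt h hω

theorem integrableOn_tail (hint : Integrable (fun ω => (Y ω : ℝ)) P) (x : ℝ) :
    IntegrableOn (fun t : ℝ => P.real {ω | t < (Y ω : ℝ)}) (Set.Ioi x) := by
  have hmeas : Measurable fun t : ℝ => P.real {ω | t < (Y ω : ℝ)} := antitone_tail.measurable
  have h0 : IntegrableOn (fun t : ℝ => P.real {ω | t < (Y ω : ℝ)}) (Set.Ioi 0) := by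
    refine ⟨hmeas.aestronglyMeasurable, ?_⟩
    rw [hasFiniteIntegral_iff_ofReal (Eventually.of_forall fun t => measureReal_nonneg)]
    have h1 := lintegral_eq_lintegral_meas_lt P (f := fun ω => |(Y ω : ℝ)|)
      (Eventually.of_forall fun ω => abs_nonneg _) hint.abs.aestronglyMeasurable.aemeasurable
    have h2 : ∫⁻ ω, ENNReal.ofReal |(Y ω : ℝ)| ∂P < ⊤ := by
      rw [← ofReal_integral_eq_lintegral_ofReal hint.abs (Eventually.of_forall fun ω => abs_nonneg _)]
      exact ENNReal.ofReal_lt_top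
    rw [h1] at h2
    refine lt_of_le_of_lt (lintegral_mono fun t => ?_) h2
    rw [ofReal_measureReal]
    refine measure_mono fun ω hω => ?_
    have h3 : t < (Y ω : ℝ) := hω
    exact lt_of_lt_of_le h3 (le_abs_self _)
  have h1 : IntegrableOn (fun t : ℝ => P.real {ω | t < (Y ω : ℝ)}) (Set.Ioc x 0) :=
    Measure.integrableOn_of_bounded (M := 1) (by simp) hmeas.aestronglyMeasurable
      (Eventually.of_forall fun t => by
        rw [Real.norm_of_nonneg measureReal_nonneg]; exact measureReal_le_one)
  refine (h1.union h0).mono_set fun t ht => ?_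
  rcases le_or_gt t 0 with h | h
  · exact Or.inl ⟨ht, h⟩
  · exact Or.inr h

theorem integratedTail_eq_add (hint : Integrable (fun ω => (Y ω : ℝ)) P)
    {x y : ℝ} (hxy : x ≤ y) : integratedTail P Y x =
    (∫ t in Set.Ioc x y, P.real {ω | t < (Y ω : ℝ)}) + integratedTail P Y y := by
  have hi := integrableOn_tail hint x
  rw [integratedTail, integratedTail, ← setIntegral_union _ measurableSet_Ioi
    (hi.mono_set Set.Ioc_subset_Ioi_self) (hi.mono_set (Set.Ioi_subset_Ioi hxy)),
    Set.Ioc_union_Ioi_eq_Ioi hxy]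
  exact Set.disjoint_left.2 fun z h1 h2 => not_lt.2 h1.2 h2

/-- Monotonicity of the tail bounds the integral over `(x, y]` by the value at the left end; the
companion lower bound uses the right end. -/
theorem integratedTail_sub_le (hint : Integrable (fun ω => (Y ω : ℝ)) P)
    {x y : ℝ} (hxy : x ≤ y) : integratedTail P Y x ≤
    (y - x) * P.real {ω | x < (Y ω : ℝ)} + integratedTail P Y y := by
  rw [integratedTail_eq_add hint hxy]
  gcongr
  have hi := (integrableOn_tail hint x).mono_set
    (show Set.Ioc x y ⊆ Set.Ioi x from Set.Ioc_subset_Ioi_self)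
  have h := setIntegral_mono_on hi (integrableOn_const (C := P.real {ω | x < (Y ω : ℝ)})
    (by simp)) measurableSet_Ioc fun t ht => antitone_tail ht.1.le
  refine h.trans (le_of_eq ?_)
  simp [hxy]

theorem le_integratedTail_sub (hint : Integrable (fun ω => (Y ω : ℝ)) P)
    {x y : ℝ} (hxy : x ≤ y) :
    (y - x) * P.real {ω | y < (Y ω : ℝ)} + integratedTail P Y y ≤ integratedTail P Y x := by
  rw [integratedTail_eq_add hint hxy]
  gcongr
  have hi := (integrableOn_tail hint x).mono_set
    (show Set.Ioc x y ⊆ Set.Ioi x from Set.Ioc_subset_Ioi_self)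
  have h := setIntegral_mono_on (integrableOn_const (C := P.real {ω | y < (Y ω : ℝ)})
    (by simp)) hi measurableSet_Ioc fun t ht => antitone_tail ht.2
  refine le_trans (le_of_eq ?_) h
  simp [hxy]

theorem antitone_integratedTail (hint : Integrable (fun ω => (Y ω : ℝ)) P)
    : Antitone (integratedTail P Y) := fun x y hxy => by
  have h := le_integratedTail_sub hint hxy
  have : 0 ≤ (y - x) * P.real {ω | y < (Y ω : ℝ)} :=
    mul_nonneg (by linarith) measureReal_nonneg
  linarith

theorem continuous_integratedTail (hint : Integrable (fun ω => (Y ω : ℝ)) P)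
    : Continuous (integratedTail P Y) := by
  have h : ∀ x y, x ≤ y → |integratedTail P Y x - integratedTail P Y y| ≤ |x - y| := by
    intro x y hxy
    have h1 := antitone_integratedTail hint hxy
    have h2 := integratedTail_sub_le hint hxy
    have h3 : P.real {ω | x < (Y ω : ℝ)} ≤ 1 := measureReal_le_one
    rw [abs_of_nonneg (by linarith), abs_of_nonpos (by linarith)]
    nlinarith
  refine (LipschitzWith.of_dist_le_mul (K := 1) fun x y => ?_).continuous
  rw [Real.dist_eq, Real.dist_eq, NNReal.coe_one, one_mul]
  rcases le_total x y with hxy | hxy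
  · exact h x y hxy
  · rw [abs_sub_comm, abs_sub_comm x]
    exact h y x hxy

theorem tendsto_integratedTail (hint : Integrable (fun ω => (Y ω : ℝ)) P)
    : Tendsto (integratedTail P Y) atTop (𝓝 0) := by
  have h1 := intervalIntegral_tendsto_integral_Ioi 0 (integrableOn_tail hint 0) tendsto_id
  have h2 := h1.const_sub (integratedTail P Y 0)
  rw [show (∫ t in Set.Ioi (0 : ℝ), P.real {ω | t < (Y ω : ℝ)}) = integratedTail P Y 0 from rfl,
    sub_self] at h2
  refine h2.congr' ?_
  filter_upwards [eventually_ge_atTop 0] with x hx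
  rw [id, intervalIntegral.integral_of_le hx, integratedTail_eq_add hint hx]
  ring

theorem eventually_one_sub_integratedCDF (hint : Integrable (fun ω => (Y ω : ℝ)) P)
    :
    ∀ᶠ x in atTop, 1 - integratedCDF P Y x = integratedTail P Y x := by
  filter_upwards [(tendsto_integratedTail hint).eventually_lt_const zero_lt_one] with x hx
  rw [one_sub_integratedCDF, min_eq_left hx.le]

/-- A distribution with dominatedly varying tail has a subexponential integrated tail. -/
theorem isSubexponential_integratedCDF (hint : Integrable (fun ω => (Y ω : ℝ)) P)
    (hpos : ∀ x : ℝ, 0 < P.real {ω | x < (Y ω : ℝ)}) {C : ℝ}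
    (hdom : ∀ᶠ x : ℝ in atTop, P.real {ω | x / 2 < (Y ω : ℝ)} ≤ C * P.real {ω | x < (Y ω : ℝ)}) :
    IsSubexponential (integratedCDF P Y) := by
  have hC : 0 ≤ C := by
    obtain ⟨x, hx⟩ := hdom.exists
    by_contra hcon
    have := mul_neg_of_neg_of_pos (not_le.1 hcon) (hpos x)
    have := hpos (x / 2)
    linarith
  have hF : integratedCDF P Y = fun x => 1 - min (integratedTail P Y x) 1 := by
    funext x
    rw [← one_sub_integratedCDF]
    ring
  have hJpos : ∀ x, 0 < integratedTail P Y x := by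
    intro x
    have h1 := le_integratedTail_sub hint (show x ≤ x + 1 by linarith)
    have h2 := hpos (x + 1)
    have h3 := integratedTail_nonneg (P := P) (Y := Y) (x + 1)
    nlinarith
  have hev := eventually_one_sub_integratedCDF hint
  refine isSubexponential_of_dominated (C := C / 2) ?_ ?_ ?_ ?_ ?_ ?_ ?_
  · rw [hF]
    intro x y hxy
    have := antitone_integratedTail hint hxy
    have := min_le_min_right 1 this
    simp only
    linarith
  · rw [hF]
    exact continuous_const.sub ((continuous_integratedTail hint).min continuous_const)
  · refine tendsto_const_nhds.congr' ?_
    -- For such `x` the integral over `(x, 0]` is already at least `1`, so the distribution function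
    -- vanishes.
    filter_upwards [eventually_le_atBot (-(P.real {ω | (0 : ℝ) < (Y ω : ℝ)})⁻¹)] with x hx
    have h0 := hpos 0
    have hx0 : x ≤ 0 := hx.trans (by simp)
    have h1 := le_integratedTail_sub hint hx0
    have h2 := integratedTail_nonneg (P := P) (Y := Y) 0
    have h3 : 1 ≤ (0 - x) * P.real {ω | (0 : ℝ) < (Y ω : ℝ)} := by
      rw [← inv_mul_cancel₀ h0.ne']
      gcongr
      linarith
    rw [hF]
    simp only
    rw [min_eq_right (by linarith)]
    ring
  · rw [hF]
    have h1 := ((tendsto_integratedTail hint).min (tendsto_const_nhds (x := (1 : ℝ)))).const_sub 1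
    simpa using h1
  · intro x
    rw [hF]
    have := hJpos x
    simp only [sub_lt_self_iff]
    positivity
  · intro y hy
    have hsub : Tendsto (fun x : ℝ => x - y) atTop atTop :=
      tendsto_atTop_add_const_right _ (-y) tendsto_id
    have hdbl : Tendsto (fun x : ℝ => 2 * (x - y)) atTop atTop :=
      hsub.const_mul_atTop two_pos
    have hlim : Tendsto (fun x : ℝ => 1 + y * C / (x - 2 * y)) atTop (𝓝 1) := by
      have h1 : Tendsto (fun x : ℝ => x - 2 * y) atTop atTop :=
        tendsto_atTop_add_const_right _ (-(2 * y)) tendsto_id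
      simpa using (tendsto_const_nhds.div_atTop h1).const_add 1
    have h1 : Tendsto (fun x => integratedTail P Y (x - y) / integratedTail P Y x) atTop (𝓝 1) := by
      refine tendsto_of_tendsto_of_tendsto_of_le_of_le' tendsto_const_nhds hlim
        (Eventually.of_forall fun x => (one_le_div (hJpos x)).2
          (antitone_integratedTail hint (by linarith))) ?_
      -- The increment over `(x - y, x]` is at most `y * P(Y > x - y) ≤ y * C * P(Y > 2 * (x - y))`,
      -- while the integral over `(x, 2 * (x - y)]` is at least `x - 2 * y` times that last
      -- probability.
      filter_upwards [hdbl.eventually hdom, eventually_gt_atTop (2 * y)] with x hx hxy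
      rw [mul_div_cancel_left₀ _ (two_ne_zero' ℝ)] at hx
      have h2 := integratedTail_sub_le hint (show x - y ≤ x by linarith)
      have h3 := le_integratedTail_sub hint (show x ≤ 2 * (x - y) by linarith)
      have h4 := integratedTail_nonneg (P := P) (Y := Y) (2 * (x - y))
      have hd : 0 < x - 2 * y := by linarith
      rw [div_le_iff₀ (hJpos x), add_mul, one_mul, div_mul_eq_mul_div]
      have h5 : y * P.real {ω | x - y < (Y ω : ℝ)} ≤ y * C * integratedTail P Y x / (x - 2 * y) := by
        rw [le_div_iff₀ hd]
        calc _ ≤ y * (C * P.real {ω | 2 * (x - y) < (Y ω : ℝ)}) * (x - 2 * y) := by gcongr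
          _ = y * C * ((x - 2 * y) * P.real {ω | 2 * (x - y) < (Y ω : ℝ)}) := by ring
          _ ≤ _ := by
            gcongr
            linarith
      linarith
    refine h1.congr' ?_
    filter_upwards [hev, hsub.eventually hev] with x hx1 hx2
    rw [hx1, hx2]
  · obtain ⟨x₀, hx₀⟩ := eventually_atTop.1 hdom
    have hhalf : Tendsto (fun x : ℝ => x / 2) atTop atTop := tendsto_id.atTop_div_const two_pos
    filter_upwards [hev, hhalf.eventually hev, eventually_ge_atTop x₀] with x hx1 hx2 hx3
    rw [hx1, hx2]
    -- Substituting `t = s / 2` transfers domination of the tail to the integrated tail, with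
    -- constant `C / 2`.
    have h1 := integral_comp_mul_left_Ioi (fun t : ℝ => P.real {ω | t < (Y ω : ℝ)}) x
      (show (0 : ℝ) < 1 / 2 by norm_num)
    have h2 : integratedTail P Y (x / 2) =
        1 / 2 * ∫ s in Set.Ioi x, P.real {ω | 1 / 2 * s < (Y ω : ℝ)} := by
      rw [h1, integratedTail, show 1 / 2 * x = x / 2 by ring]
      simp
    have h3 : (∫ s in Set.Ioi x, P.real {ω | 1 / 2 * s < (Y ω : ℝ)}) ≤
        ∫ s in Set.Ioi x, C * P.real {ω | s < (Y ω : ℝ)} := by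
      refine setIntegral_mono_on ?_ ((integrableOn_tail hint x).const_mul C) measurableSet_Ioi
        fun s hs => ?_
      · exact (integrableOn_Ioi_comp_mul_left_iff
          (fun t : ℝ => P.real {ω | t < (Y ω : ℝ)}) x (show (0 : ℝ) < 1 / 2 by norm_num)).2
          (integrableOn_tail hint _)
      · have := hx₀ s (hx3.trans (le_of_lt hs))
        rwa [show s / 2 = 1 / 2 * s by ring] at this
    rw [integral_const_mul] at h3
    rw [h2]
    change _ ≤ C / 2 * ∫ t in Set.Ioi x, P.real {ω | t < (Y ω : ℝ)}
    linarith

/-- For integer `Y` the tail is constant on `[k, k + 1)`, so the integral is a sum of integer tails.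
-/
theorem hasSum_integratedTail (hint : Integrable (fun ω => (Y ω : ℝ)) P)
    (n : ℕ) :
    HasSum (fun j : ℕ => P.real {ω | ((n + j : ℕ) : ℤ) < Y ω}) (integratedTail P Y n) := by
  have hstep : ∀ k : ℕ, P.real {ω | ((k : ℕ) : ℤ) < Y ω} =
      integratedTail P Y k - integratedTail P Y (k + 1 : ℕ) := by
    intro k
    have hk : (k : ℝ) ≤ (k + 1 : ℕ) := by push_cast; linarith
    rw [integratedTail_eq_add hint hk, add_sub_cancel_right, ← integral_Ico_eq_integral_Ioc]
    have h1 : ∀ t ∈ Set.Ico (k : ℝ) (k + 1 : ℕ), P.real {ω | t < (Y ω : ℝ)} =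
        P.real {ω | ((k : ℕ) : ℤ) < Y ω} := by
      intro t ht
      congr 1
      ext ω
      simp only [Set.mem_ofPred_eq]
      have h2 := ht.1
      have h3 := ht.2
      constructor
      · intro h
        have : ((k : ℤ) : ℝ) < (Y ω : ℝ) := by push_cast; linarith
        exact_mod_cast this
      · intro h
        have h4 : (k : ℤ) + 1 ≤ Y ω := h
        have h5 : (((k : ℤ) + 1 : ℤ) : ℝ) ≤ (Y ω : ℝ) := by exact_mod_cast h4
        push_cast at h3 h5
        linarith
    rw [setIntegral_congr_fun measurableSet_Ico h1]
    simp
  rw [hasSum_iff_tendsto_nat_of_nonneg fun j => measureReal_nonneg]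
  have h1 : ∀ N : ℕ, ∑ j ∈ Finset.range N, P.real {ω | ((n + j : ℕ) : ℤ) < Y ω} =
      integratedTail P Y n - integratedTail P Y (n + N : ℕ) := by
    intro N
    simp only [hstep]
    exact Finset.sum_range_sub' (fun j : ℕ => integratedTail P Y (n + j : ℕ)) N
  simp only [h1]
  have h2 : Tendsto (fun N : ℕ => integratedTail P Y (n + N : ℕ)) atTop (𝓝 0) := by
    refine (tendsto_integratedTail hint).comp (tendsto_natCast_atTop_atTop.comp ?_)
    exact (tendsto_add_atTop_nat n).congr fun N => add_comm N n
  simpa using h2.const_sub (integratedTail P Y n)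

/-- Stable tails with a nontrivial right part are positive and dominatedly varying. -/
theorem HasStableTails.tail_dominated {α p q : ℝ} {L : ℝ → ℝ} (h : HasStableTails P Y α p q L)
    (hp : 0 < p) : (∀ x : ℝ, 0 < P.real {ω | x < (Y ω : ℝ)}) ∧
      ∀ᶠ x : ℝ in atTop, P.real {ω | x / 2 < (Y ω : ℝ)} ≤ 4 * P.real {ω | x < (Y ω : ℝ)} := by
  have hpos : ∀ x : ℝ, 0 < P.real {ω | x < (Y ω : ℝ)} := by
    intro x
    obtain ⟨y, hy, hxy⟩ := ((h.tail_right.eventually_const_lt hp).and (eventually_ge_atTop x)).exists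
    have h1 : P.real {ω | y < (Y ω : ℝ)} ≠ 0 := by
      intro h0
      rw [h0, zero_div] at hy
      exact lt_irrefl _ hy
    exact (measureReal_nonneg.lt_of_ne' h1).trans_le (antitone_tail hxy)
  refine ⟨hpos, ?_⟩
  have hhalf : Tendsto (fun x : ℝ => x / 2) atTop atTop := tendsto_id.atTop_div_const two_pos
  -- The product equals the tail at `x / 2` over the tail at `x`. Its limit is `2 ^ α`, less than
  -- `4` because `α < 2`.
  have h1 := ((h.tail_right.comp hhalf).div h.tail_right hp.ne').mul
    (((h.slowly_varying (1 / 2) (by norm_num))).mul_const ((2 : ℝ) ^ α))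
  rw [div_self hp.ne', one_mul, one_mul] at h1
  have h2 : (2 : ℝ) ^ α < 4 := by
    calc (2 : ℝ) ^ α < 2 ^ (2 : ℝ) := Real.rpow_lt_rpow_of_exponent_lt one_lt_two h.alpha_mem.2
      _ = 4 := by norm_num
  filter_upwards [h1.eventually_lt_const h2, h.eventually_pos, hhalf.eventually h.eventually_pos,
    eventually_gt_atTop 0] with x hx hL hL2 hx0
  have hx' := hpos x
  rw [← div_le_iff₀ hx']
  refine le_trans (le_of_eq ?_) hx.le
  simp only [Pi.div_apply, Function.comp_apply]
  rw [show 1 / 2 * x = x / 2 by ring, Real.div_rpow hx0.le two_pos.le, Real.rpow_neg two_pos.le]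
  have h3 : 0 < x ^ (-α) := Real.rpow_pos_of_pos hx0 _
  have h4 : (0 : ℝ) < 2 ^ α := Real.rpow_pos_of_pos two_pos _
  field_simp

end RandomWalk

/-! ### Green function and tail of the maximum -/

namespace RandomWalk

open IntConv RenewalSequence

variable {Ω : Type*} [MeasurableSpace Ω] {P : Measure Ω} {X : ℕ → Ω → ℤ}

theorem tsum_conv (a b : ℤ → ℝ≥0∞) : ∑' x, conv a b x = (∑' x, a x) * ∑' x, b x := by
  simp only [conv]
  rw [ENNReal.tsum_comm, ← ENNReal.tsum_mul_right]
  refine tsum_congr fun y => ?_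
  rw [ENNReal.tsum_mul_left]
  exact congrArg _ ((Equiv.subRight y).tsum_eq b)

/-- With constant weights the convolution is a tail, so identities between laws convert into
identities between tails. -/
theorem conv_massFun_reflect_one {Y : Ω → ℤ} (hY : Measurable Y) (x : ℤ) :
    conv (massFun P Y) (reflect fun _ => 1) x = P {ω | x ≤ Y ω} := by
  have hm : MeasurableSet {ω | x ≤ Y ω} := hY (MeasurableSet.of_discrete (s := Set.Ici x))
  rw [conv_massFun hY, ← lintegral_indicator_one hm]
  refine lintegral_congr fun ω => ?_
  by_cases h : x ≤ Y ω
  · rw [Set.indicator_of_mem (show ω ∈ {ω | x ≤ Y ω} from h), reflect, if_pos (by omega)]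
    simp
  · rw [Set.indicator_of_notMem (show ω ∉ {ω | x ≤ Y ω} from h), reflect, if_neg (by omega)]

theorem measure_le_eq_tsum {Y : Ω → ℤ} (hY : Measurable Y) (x : ℤ) :
    P {ω | x ≤ Y ω} = ∑' j : ℕ, massFun P Y (x + j) := by
  rw [← conv_massFun_reflect_one hY, conv_reflect]
  simp

theorem massFun_ne_top [IsFiniteMeasure P] {Y : Ω → ℤ} (x : ℤ) : massFun P Y x ≠ ⊤ :=
  measure_ne_top _ _

namespace IIDSteps

theorem neg (H : IIDSteps P X) : IIDSteps P fun i ω => -X i ω where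
  meas i := (H.meas i).neg
  indep := H.indep.comp (fun _ z => -z) fun _ => measurable_neg
  ident i := (H.ident i).comp measurable_neg

theorem measureReal_lt_walkSup (hbdd : ∀ᵐ ω ∂P, IsBddPath X ω) (x : ℝ) :
    P.real {ω | (x : EReal) < walkSup X ω} = P.real {ω | x < (maxAfter X 0 ω : ℝ)} := by
  refine measureReal_congr ?_
  filter_upwards [hbdd] with ω hω
  apply propext
  change (x : EReal) < walkSup X ω ↔ x < (maxAfter X 0 ω : ℝ)
  rw [hω.walkSup_eq, EReal.coe_lt_coe_iff]

variable [IsProbabilityMeasure P]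

/-- The Green function in terms of the law of the maximum and the descending renewal sequence. -/
theorem exists_green_eq (H : IIDSteps P X) (hint : Integrable (fun ω => (X 0 ω : ℝ)) P)
    (hneg : ∫ ω, (X 0 ω : ℝ) ∂P < 0) (haper : IsAperiodic P (X 0)) :
    ∃ (p : ℝ) (u : ℕ → ℝ), 0 < p ∧ (∀ n, 0 ≤ u n) ∧ (∀ n, u n ≤ 1) ∧
      Tendsto u atTop (𝓝 (p / |∫ ω, (X 0 ω : ℝ) ∂P|)) ∧
      (∀ x, conv (massFun P (maxAfter X 0)) (reflect u) x = ENNReal.ofReal p * green P X x) ∧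
      Pi.single 0 (ENNReal.ofReal p) + massFun P (maxAfter X 0) 0 •
        conv (massFun P (X 0)) (reflect u) =
        ENNReal.ofReal p • ladderMass P X + massFun P (maxAfter X 0) 0 • reflect u := by
  obtain ⟨p, u, hp, hu0, hu1, hlim, hpois⟩ := H.exists_descending_renewal hint hneg haper
  refine ⟨p, u, hp, hu0, hu1, hlim, fun x => ?_, ?_⟩
  · exact H.green_eq_of_poisson hint hneg (H.conv_max_le_one hu1) (H.tendsto_conv_max_atTop hu1)
      hpois x
  · exact ladder_eq_of_poisson
      (fun x => ne_top_of_le_ne_top ENNReal.one_ne_top (H.conv_max_le_one hu1 x)) hpois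
      (H.ladder (H.ae_isBddPath hint hneg))

/-- `p G(x)` is the mean of a function bounded by `1`, and `p > 0`. -/
theorem green_lt_top (H : IIDSteps P X) (hint : Integrable (fun ω => (X 0 ω : ℝ)) P)
    (hneg : ∫ ω, (X 0 ω : ℝ) ∂P < 0) (haper : IsAperiodic P (X 0)) (x : ℤ) :
    green P X x < ⊤ := by
  obtain ⟨p, u, hp, -, hu1, -, hg, -⟩ := H.exists_green_eq hint hneg haper
  rw [lt_top_iff_ne_top]
  intro htop
  have h1 := hg x
  rw [htop, ENNReal.mul_top (by simpa using hp)] at h1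
  have h2 := H.conv_max_le_one hu1 x
  rw [h1] at h2
  exact absurd h2 (by simp)

/-- The renewal theorem on the side to which the walk drifts. -/
theorem tendsto_green_atBot (H : IIDSteps P X) (hint : Integrable (fun ω => (X 0 ω : ℝ)) P)
    (hneg : ∫ ω, (X 0 ω : ℝ) ∂P < 0) (haper : IsAperiodic P (X 0)) :
    Tendsto (green P X) atBot (𝓝 (ENNReal.ofReal (1 / |∫ ω, (X 0 ω : ℝ) ∂P|))) := by
  obtain ⟨p, u, hp, -, hu1, hlim, hg, -⟩ := H.exists_green_eq hint hneg haper
  have h1 := ENNReal.Tendsto.const_mul (a := ENNReal.ofReal p⁻¹)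
    (H.tendsto_conv_max_atBot hu1 hlim) (Or.inr ENNReal.ofReal_ne_top)
  rw [← ENNReal.ofReal_mul (by positivity), ← mul_div_assoc, inv_mul_cancel₀ hp.ne'] at h1
  refine h1.congr fun x => ?_
  rw [hg, ← mul_assoc, ← ENNReal.ofReal_mul (by positivity), inv_mul_cancel₀ hp.ne',
    ENNReal.ofReal_one, one_mul]

/-- The reflected walk has negative drift, and its Green function at `-x` is the original one at
`x`. -/
theorem tendsto_green_atTop (H : IIDSteps P X) (hint : Integrable (fun ω => (X 0 ω : ℝ)) P)
    (hpos : 0 < ∫ ω, (X 0 ω : ℝ) ∂P) (haper : IsAperiodic P (X 0)) :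
    Tendsto (green P X) atTop (𝓝 (ENNReal.ofReal (1 / ∫ ω, (X 0 ω : ℝ) ∂P))) := by
  have hI : ∫ ω, ((-X 0 ω : ℤ) : ℝ) ∂P = -∫ ω, (X 0 ω : ℝ) ∂P := by
    simp only [Int.cast_neg, integral_neg]
  have haper' : IsAperiodic P fun ω => -X 0 ω := by
    rw [IsAperiodic, ← haper, ← AddSubgroup.closure_neg]
    congr 1
    ext z
    simp [neg_eq_iff_eq_neg]
  have h1 := H.neg.tendsto_green_atBot (by simpa using hint.neg) (by rw [hI]; linarith) haper'
  rw [hI, abs_neg, abs_of_pos hpos] at h1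
  refine (h1.comp tendsto_neg_atTop_atBot).congr fun x => ?_
  simp only [Function.comp, green]
  refine tsum_congr fun n => ?_
  congr 1
  ext ω
  simp [walk]

/-- The tail sums of the law of the maximum. -/
theorem hasSum_max (H : IIDSteps P X) (n : ℕ) :
    HasSum (fun j : ℕ => P.real {ω | maxAfter X 0 ω = ((n + j : ℕ) : ℤ)})
      (P.real {ω | (n : ℤ) ≤ maxAfter X 0 ω}) := by
  have h1 := measure_le_eq_tsum (P := P) (H.measurable_maxAfter 0) n
  have h2 : ∑' j : ℕ, massFun P (maxAfter X 0) (n + j) ≠ ⊤ := by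
    rw [← h1]; exact measure_ne_top _ _
  have h3 := ENNReal.hasSum_toReal h2
  rw [← ENNReal.tsum_toReal_eq (fun j => massFun_ne_top _), ← h1] at h3
  simpa only [massFun, Measure.real, Nat.cast_add] using h3

theorem tailSum_max (H : IIDSteps P X) (n : ℕ) :
    tailSum (fun j : ℕ => P.real {ω | maxAfter X 0 ω = (j : ℤ)}) n =
      P.real {ω | (n : ℤ) ≤ maxAfter X 0 ω} :=
  (H.hasSum_max n).tsum_eq

/-- If the maximum is long-tailed, its tail governs the Green function. -/
theorem tendsto_green_div (H : IIDSteps P X) (hint : Integrable (fun ω => (X 0 ω : ℝ)) P)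
    (hneg : ∫ ω, (X 0 ω : ℝ) ∂P < 0) (haper : IsAperiodic P (X 0))
    (hpos : ∀ n : ℕ, 0 < P.real {ω | (n : ℤ) ≤ maxAfter X 0 ω})
    (hlong : Tendsto (fun n : ℕ => P.real {ω | (n : ℤ) ≤ maxAfter X 0 ω} /
      P.real {ω | (n : ℤ) < maxAfter X 0 ω}) atTop (𝓝 1)) :
    Tendsto (fun n : ℕ => (green P X n).toReal / P.real {ω | (n : ℤ) < maxAfter X 0 ω}) atTop
      (𝓝 (1 / |∫ ω, (X 0 ω : ℝ) ∂P|)) := by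
  obtain ⟨p, u, hp, hu0, hu1, hlim, hg, -⟩ := H.exists_green_eq hint hneg haper
  set h : ℕ → ℝ := fun j => P.real {ω | maxAfter X 0 ω = (j : ℤ)} with hh
  have hsum : Summable h := by
    have := (H.hasSum_max 0).summable
    simpa only [zero_add] using this
  have hsucc : ∀ n : ℕ, P.real {ω | (n : ℤ) < maxAfter X 0 ω} = tailSum h (n + 1) := by
    intro n
    rw [H.tailSum_max]
    rfl
  -- The quotient is `1 - P(S* > k) / P(S* ≥ k)`.
  have hsmall : Tendsto (fun k => h k / tailSum h k) atTop (𝓝 0) := by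
    have h1 := (hlong.inv₀ one_ne_zero).const_sub 1
    rw [inv_one, sub_self] at h1
    refine h1.congr fun n => ?_
    have h2 := hpos n
    rw [← H.tailSum_max] at h2
    rw [hsucc, ← H.tailSum_max, inv_div, eq_div_iff h2.ne', sub_mul, div_mul_cancel₀ _ h2.ne',
      one_mul]
    linarith [tailSum_eq_add hsum n]
  have hmain := tendsto_weighted_tail hsum (fun n => measureReal_nonneg)
    (fun k => by rw [H.tailSum_max]; exact hpos k) hsmall hlim
  have hgreen : ∀ n : ℕ, (green P X n).toReal = p⁻¹ * ∑' y, h (n + y) * u y := by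
    intro n
    have h1 := congrArg ENNReal.toReal (hg n)
    rw [conv_reflect, ENNReal.toReal_mul, ENNReal.toReal_ofReal hp.le, ENNReal.tsum_toReal_eq] at h1
    · rw [← mul_right_inj' hp.ne', ← h1, mul_inv_cancel_left₀ hp.ne']
      refine tsum_congr fun y => ?_
      rw [ENNReal.toReal_mul, ENNReal.toReal_ofReal (hu0 y)]
      rfl
    · intro y
      exact ENNReal.mul_ne_top (measure_ne_top _ _) ENNReal.ofReal_ne_top
  have h1 := (hmain.const_mul p⁻¹).mul hlong
  rw [mul_one, ← mul_div_assoc, inv_mul_cancel₀ hp.ne'] at h1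
  refine h1.congr fun n => ?_
  rw [hgreen, H.tailSum_max, mul_assoc, div_mul_div_cancel₀ (hpos n).ne', mul_div_assoc]

theorem one_sub_measureReal_walkSup_le (H : IIDSteps P X) (hbdd : ∀ᵐ ω ∂P, IsBddPath X ω) (x : ℝ) :
    1 - P.real {ω | walkSup X ω ≤ (x : EReal)} = P.real {ω | x < (maxAfter X 0 ω : ℝ)} := by
  have hm : MeasurableSet {ω | (maxAfter X 0 ω : ℝ) ≤ x} :=
    ((measurable_of_countable fun z : ℤ => (z : ℝ)).comp (H.measurable_maxAfter 0))
      measurableSet_Iic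
  have h1 : P.real {ω | walkSup X ω ≤ (x : EReal)} = P.real {ω | (maxAfter X 0 ω : ℝ) ≤ x} := by
    refine measureReal_congr ?_
    filter_upwards [hbdd] with ω hω
    apply propext
    change walkSup X ω ≤ (x : EReal) ↔ (maxAfter X 0 ω : ℝ) ≤ x
    rw [hω.walkSup_eq, EReal.coe_le_coe_iff]
  rw [h1, ← probReal_compl_eq_one_sub hm]
  congr 1
  ext ω
  simp

/-- Subexponentiality enters through the long tail: `P(S* ≥ n) = P(S* > n - 1)` is equivalent to
`P(S* > n)`. -/
theorem green_isEquivalent (H : IIDSteps P X) (hint : Integrable (fun ω => (X 0 ω : ℝ)) P)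
    (hneg : ∫ ω, (X 0 ω : ℝ) ∂P < 0) (haper : IsAperiodic P (X 0))
    (hsub : IsSubexponential fun x : ℝ => P.real {ω | walkSup X ω ≤ (x : EReal)}) :
    (fun x : ℤ => (green P X x).toReal) ~[atTop] fun x : ℤ =>
      1 / |∫ ω, (X 0 ω : ℝ) ∂P| * P.real {ω | ((x : ℝ) : EReal) < walkSup X ω} := by
  have hbdd := H.ae_isBddPath hint hneg
  obtain ⟨ρ, hρ, hρ0, htail, hpos, hconv⟩ := hsub.exists_law
  simp only [H.one_sub_measureReal_walkSup_le hbdd] at htail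
  have htailn : ∀ n : ℕ, P.real {ω | (n : ℤ) < maxAfter X 0 ω} = ρ.real (Set.Ioi (n : ℝ)) := by
    intro n
    rw [htail n (Nat.cast_nonneg n)]
    congr 1
    ext ω
    simp only [Set.mem_ofPred_eq]
    exact_mod_cast Iff.rfl
  have hposlt : ∀ n : ℕ, 0 < P.real {ω | (n : ℤ) < maxAfter X 0 ω} := fun n => by
    rw [htailn]; exact hpos n
  have hposle : ∀ n : ℕ, 0 < P.real {ω | (n : ℤ) ≤ maxAfter X 0 ω} := fun n =>
    (hposlt n).trans_le (measureReal_mono fun ω (hω : (n : ℤ) < _) => show (n : ℤ) ≤ _ from hω.le)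
  have hlong : Tendsto (fun n : ℕ => P.real {ω | (n : ℤ) ≤ maxAfter X 0 ω} /
      P.real {ω | (n : ℤ) < maxAfter X 0 ω}) atTop (𝓝 1) := by
    have h1 := (HalfLineLaw.tendsto_tail_ratio hρ0 hpos hconv zero_le_one).comp
      (tendsto_natCast_atTop_atTop (R := ℝ))
    refine h1.congr' ?_
    filter_upwards [eventually_ge_atTop 1] with n hn
    obtain ⟨k, rfl⟩ := Nat.exists_eq_add_of_le' hn
    have h2 : {ω | ((k + 1 : ℕ) : ℤ) ≤ maxAfter X 0 ω} = {ω | (k : ℤ) < maxAfter X 0 ω} := by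
      ext ω
      simp only [Set.mem_ofPred_eq]
      omega
    rw [h2, htailn, htailn]
    simp
  have hmain := H.tendsto_green_div hint hneg haper hposle hlong
  have hcast : ∀ x : ℤ, P.real {ω | ((x : ℝ) : EReal) < walkSup X ω} =
      P.real {ω | x < maxAfter X 0 ω} := by
    intro x
    rw [measureReal_lt_walkSup hbdd]
    congr 1
    ext ω
    simp only [Set.mem_ofPred_eq]
    exact_mod_cast Iff.rfl
  simp only [hcast]
  have hc : 1 / |∫ ω, (X 0 ω : ℝ) ∂P| ≠ 0 := one_div_ne_zero (abs_ne_zero.2 hneg.ne)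
  rw [isEquivalent_const_mul_iff hc]
  · rw [← Nat.map_cast_int_atTop, tendsto_map'_iff]
    exact hmain
  · filter_upwards [eventually_ge_atTop 0] with x hx
    obtain ⟨n, rfl⟩ := Int.eq_ofNat_of_zero_le hx
    exact (hposlt n).ne'

end IIDSteps

end RandomWalk

/-! ### The tail of the maximum for subexponential integrated tails -/

namespace RandomWalk

open IntConv RenewalSequence

variable {Ω : Type*} [MeasurableSpace Ω] {P : Measure Ω} {X : ℕ → Ω → ℤ}

theorem tsum_int_eq_tsum_nat {g : ℤ → ℝ≥0∞} (hg : ∀ x < 0, g x = 0) :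
    ∑' x, g x = ∑' n : ℕ, g n := by
  rw [← Nat.cast_injective.tsum_eq (f := g)]
  intro x hx
  have h0 : 0 ≤ x := by
    by_contra hcon
    exact hx (hg x (not_le.1 hcon))
  exact ⟨x.toNat, Int.toNat_of_nonneg h0⟩

namespace IIDSteps

variable [IsProbabilityMeasure P]

/-- The ladder height is defective, with defect `P(S* = 0)`. -/
theorem hasSum_ladderMass (H : IIDSteps P X) (hbdd : ∀ᵐ ω ∂P, IsBddPath X ω) :
    (∀ x, ladderMass P X x ≠ ⊤) ∧
      HasSum (fun n : ℕ => (ladderMass P X n).toReal) (1 - (massFun P (maxAfter X 0) 0).toReal) := by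
  have h1 : (1 : ℝ≥0∞) = massFun P (maxAfter X 0) 0 + ∑' n : ℕ, ladderMass P X n := by
    have h2 : ∑' x, massFun P (maxAfter X 0) x =
        ∑' x, (Pi.single 0 (massFun P (maxAfter X 0) 0) +
          conv (ladderMass P X) (massFun P (maxAfter X 0)) : ℤ → ℝ≥0∞) x := by rw [← H.ladder hbdd]
    simp only [Pi.add_apply] at h2
    rw [ENNReal.tsum_add, tsum_conv, tsum_massFun (H.measurable_maxAfter 0), mul_one,
      tsum_pi_single, tsum_int_eq_tsum_nat fun x hx => ladderMass_of_nonpos hx.le] at h2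
    exact h2
  have h2 : ∑' n : ℕ, ladderMass P X n ≠ ⊤ :=
    ne_top_of_le_ne_top ENNReal.one_ne_top (by rw [h1]; exact le_add_self)
  have h3 : ∀ n : ℕ, ladderMass P X n ≠ ⊤ := ENNReal.ne_top_of_tsum_ne_top h2
  refine ⟨fun x => ?_, ?_⟩
  · rcases le_or_gt x 0 with hx | hx
    · rw [ladderMass_of_nonpos hx]
      exact ENNReal.zero_ne_top
    · have := h3 x.toNat
      rwa [Int.toNat_of_nonneg hx.le] at this
  · have h4 := ENNReal.hasSum_toReal h2
    rw [← ENNReal.tsum_toReal_eq h3] at h4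
    have h5 := congrArg ENNReal.toReal h1
    rw [ENNReal.toReal_add (massFun_ne_top _) h2, ENNReal.toReal_one] at h5
    rwa [h5, add_sub_cancel_left]

/-- The defective renewal equation for the tail of the maximum. -/
theorem max_tail_renewal (H : IIDSteps P X) (hbdd : ∀ᵐ ω ∂P, IsBddPath X ω) (n : ℕ) :
    P.real {ω | (n : ℤ) < maxAfter X 0 ω} =
      tailSum (fun k : ℕ => (ladderMass P X k).toReal) (n + 1) +
      ∑ k ∈ Finset.range (n + 1),
        (ladderMass P X k).toReal * P.real {ω | ((n - k : ℕ) : ℤ) < maxAfter X 0 ω} := by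
  have hm := H.measurable_maxAfter 0
  obtain ⟨hfin, -⟩ := H.hasSum_ladderMass hbdd
  -- The atom at `0` of the ladder equation contributes nothing to the tail at `n + 1 > 0`.
  have h1 : conv (massFun P (maxAfter X 0)) (reflect fun _ => 1) (n + 1) =
      conv (ladderMass P X) (conv (massFun P (maxAfter X 0)) (reflect fun _ => 1)) (n + 1) := by
    conv_lhs => rw [H.ladder hbdd]
    rw [add_conv, single_conv, conv_assoc, Pi.add_apply, Pi.smul_apply, reflect,
      if_neg (by omega), smul_zero, zero_add]
  have h2 : P {ω | (n : ℤ) < maxAfter X 0 ω} =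
      ∑ k ∈ Finset.range (n + 1),
        ladderMass P X k * P {ω | ((n - k : ℕ) : ℤ) < maxAfter X 0 ω} +
      ∑' j : ℕ, ladderMass P X ((n + 1 + j : ℕ) : ℤ) := by
    rw [conv_massFun_reflect_one hm, conv, tsum_int_eq_tsum_nat fun x hx => by
      rw [ladderMass_of_nonpos hx.le, zero_mul],
      ← ENNReal.summable.sum_add_tsum_nat_add' (k := n + 1)] at h1
    rw [show {ω | (n : ℤ) < maxAfter X 0 ω} = {ω | (n : ℤ) + 1 ≤ maxAfter X 0 ω} from rfl, h1]
    congr 1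
    · refine Finset.sum_congr rfl fun k hk => ?_
      rw [conv_massFun_reflect_one hm]
      congr 2
      ext ω
      have := Finset.mem_range.1 hk
      simp only [Set.mem_ofPred_eq]
      omega
    · refine tsum_congr fun j => ?_
      rw [conv_massFun_reflect_one hm]
      -- A ladder height of at least `n + 1` already exceeds `n`, whatever the nonnegative remaining
      -- maximum.
      have h3 : P {ω | (n : ℤ) + 1 - ((j + (n + 1) : ℕ) : ℤ) ≤ maxAfter X 0 ω} = 1 := by
        rw [← measure_univ (μ := P)]
        refine measure_congr (eventuallyEq_univ.2 ?_)
        filter_upwards [hbdd] with ω hω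
        have := hω.maxAfter_nonneg 0
        change (n : ℤ) + 1 - ((j + (n + 1) : ℕ) : ℤ) ≤ maxAfter X 0 ω
        omega
      rw [h3, mul_one, add_comm j]
  have htop : ∑' j : ℕ, ladderMass P X ((n + 1 + j : ℕ) : ℤ) ≠ ⊤ := by
    refine ne_top_of_le_ne_top (measure_ne_top P {ω | (n : ℤ) < maxAfter X 0 ω}) ?_
    rw [h2]
    exact le_add_self
  have h4 := congrArg ENNReal.toReal h2
  have hterm : ∀ k ∈ Finset.range (n + 1),
      ladderMass P X k * P {ω | ((n - k : ℕ) : ℤ) < maxAfter X 0 ω} ≠ ⊤ := fun k _ =>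
    ENNReal.mul_ne_top (hfin k) (measure_ne_top _ _)
  rw [ENNReal.toReal_add (ENNReal.sum_ne_top.2 hterm) htop, ENNReal.toReal_sum hterm,
    ENNReal.tsum_toReal_eq fun j => hfin _] at h4
  simp only [ENNReal.toReal_mul] at h4
  rw [add_comm]
  exact h4

/-- The tail of the ladder height is the tail of the step averaged by the descending renewal
sequence. -/
theorem ladder_tail_eq (H : IIDSteps P X) (hbdd : ∀ᵐ ω ∂P, IsBddPath X ω) {p : ℝ} {u : ℕ → ℝ}
    (hp : 0 < p) (hu0 : ∀ n, 0 ≤ u n)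
    (hwh : Pi.single 0 (ENNReal.ofReal p) + massFun P (maxAfter X 0) 0 •
        conv (massFun P (X 0)) (reflect u) =
        ENNReal.ofReal p • ladderMass P X + massFun P (maxAfter X 0) 0 • reflect u) (n : ℕ) :
    tailSum (fun k : ℕ => (ladderMass P X k).toReal) (n + 1) =
      (massFun P (maxAfter X 0) 0).toReal / p *
        ∑' y : ℕ, P.real {ω | ((n + y : ℕ) : ℤ) < X 0 ω} * u y := by
  obtain ⟨hfin, -⟩ := H.hasSum_ladderMass hbdd
  have h1 : ∀ k : ℕ, ENNReal.ofReal p * ladderMass P X ((n + 1 + k : ℕ) : ℤ) =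
      massFun P (maxAfter X 0) 0 *
        ∑' y : ℕ, massFun P (X 0) (((n + 1 + k : ℕ) : ℤ) + y) * ENNReal.ofReal (u y) := by
    intro k
    -- At positive points the Dirac mass and `reflect u` vanish, so the Wiener–Hopf identity
    -- expresses the ladder mass directly.
    have h2 := congrFun hwh ((n + 1 + k : ℕ) : ℤ)
    simp only [Pi.add_apply, Pi.smul_apply, smul_eq_mul] at h2
    rw [Pi.single_eq_of_ne (by omega), zero_add, reflect, if_neg (by omega), mul_zero, add_zero,
      conv_reflect] at h2
    exact h2.symm
  have h2 : ENNReal.ofReal p * ∑' k : ℕ, ladderMass P X ((n + 1 + k : ℕ) : ℤ) =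
      massFun P (maxAfter X 0) 0 *
        ∑' y : ℕ, P {ω | ((n + y : ℕ) : ℤ) < X 0 ω} * ENNReal.ofReal (u y) := by
    rw [← ENNReal.tsum_mul_left]
    simp only [h1]
    rw [ENNReal.tsum_mul_left, ENNReal.tsum_comm]
    congr 1
    refine tsum_congr fun y => ?_
    rw [ENNReal.tsum_mul_right]
    congr 1
    have h3 : {ω | ((n + y : ℕ) : ℤ) < X 0 ω} = {ω | ((n + y : ℕ) : ℤ) + 1 ≤ X 0 ω} := rfl
    rw [h3, measure_le_eq_tsum (H.meas 0)]
    refine tsum_congr fun k => ?_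
    congr 1
    push_cast
    ring
  have h3 := congrArg ENNReal.toReal h2
  rw [ENNReal.toReal_mul, ENNReal.toReal_mul, ENNReal.tsum_toReal_eq fun k => hfin _,
    ENNReal.tsum_toReal_eq fun y => ENNReal.mul_ne_top (measure_ne_top _ _) ENNReal.ofReal_ne_top,
    ENNReal.toReal_ofReal hp.le] at h3
  simp only [ENNReal.toReal_mul, ENNReal.toReal_ofReal (hu0 _)] at h3
  rw [div_mul_eq_mul_div, eq_div_iff hp.ne', mul_comm]
  exact h3

/-- **Veraverbeke's theorem** for integer walks, along the integers. -/
theorem tendsto_max_tail_div (H : IIDSteps P X) (hint : Integrable (fun ω => (X 0 ω : ℝ)) P)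
    (hneg : ∫ ω, (X 0 ω : ℝ) ∂P < 0) (haper : IsAperiodic P (X 0)) {ρ : Measure ℝ}
    [IsProbabilityMeasure ρ] (hρ0 : ρ (Set.Iio 0) = 0)
    (htail : ∀ x, 0 ≤ x → ρ.real (Set.Ioi x) = 1 - integratedCDF P (X 0) x)
    (hpos : ∀ x, 0 < ρ.real (Set.Ioi x))
    (hconv : Tendsto (fun x => (Measure.conv ρ ρ).real (Set.Ioi x) / ρ.real (Set.Ioi x)) atTop
      (𝓝 2)) :
    Tendsto (fun n : ℕ => P.real {ω | (n : ℤ) < maxAfter X 0 ω} / ρ.real (Set.Ioi (n : ℝ))) atTop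
      (𝓝 (1 / |∫ ω, (X 0 ω : ℝ) ∂P|)) := by
  have hbdd := H.ae_isBddPath hint hneg
  obtain ⟨p, u, hp, hu0, -, hlim, -, hwh⟩ := H.exists_green_eq hint hneg haper
  have hsum := (H.hasSum_ladderMass hbdd).2
  have hnat := tendsto_natCast_atTop_atTop (R := ℝ)
  set q := (massFun P (maxAfter X 0) 0).toReal with hq
  have hq0 : 0 < q := ENNReal.toReal_pos
    (H.massFun_max_zero_ne_zero hbdd (H.undershoot_pos hbdd hneg)) (massFun_ne_top _)
  set a : ℕ → ℝ := fun k => (ladderMass P X k).toReal with ha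
  have ha0 : ∀ k, 0 ≤ a k := fun k => ENNReal.toReal_nonneg
  set φ : ℕ → ℝ := fun j => P.real {ω | (j : ℤ) < X 0 ω} with hφ
  have hJ : ∀ n : ℕ, tailSum φ n = integratedTail P (X 0) n := fun n =>
    (hasSum_integratedTail hint n).tsum_eq
  have hφsum : Summable φ := by
    have := (hasSum_integratedTail hint 0).summable
    simpa only [zero_add] using this
  have hev : ∀ᶠ n : ℕ in atTop, ρ.real (Set.Ioi (n : ℝ)) = tailSum φ n := by
    filter_upwards [hnat.eventually (eventually_one_sub_integratedCDF hint)] with n hn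
    rw [htail n (Nat.cast_nonneg n), hn, hJ]
  have hJpos : ∀ n : ℕ, 0 < tailSum φ n := by
    intro n
    have h1 := hpos n
    rw [htail n (Nat.cast_nonneg n), one_sub_integratedCDF, ← hJ] at h1
    exact (lt_min_iff.1 h1).1
  have hlong : ∀ k : ℕ, Tendsto (fun n : ℕ => ρ.real (Set.Ioi ((n - k : ℕ) : ℝ)) /
      ρ.real (Set.Ioi (n : ℝ))) atTop (𝓝 1) := by
    intro k
    refine ((HalfLineLaw.tendsto_tail_ratio hρ0 hpos hconv (Nat.cast_nonneg k)).comp hnat).congr' ?_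
    filter_upwards [eventually_ge_atTop k] with n hn
    rw [Nat.cast_sub hn]
    rfl
  have hsmall : Tendsto (fun k => φ k / tailSum φ k) atTop (𝓝 0) := by
    have h1 := ((hlong 1).comp (tendsto_add_atTop_nat 1)).inv₀ one_ne_zero |>.const_sub 1
    rw [inv_one, sub_self] at h1
    refine h1.congr' ?_
    filter_upwards [hev, (tendsto_add_atTop_nat 1).eventually hev] with n h2 h3
    simp only [Function.comp, Nat.add_sub_cancel]
    rw [h2, h3, inv_div, eq_div_iff (hJpos n).ne', sub_mul, div_mul_cancel₀ _ (hJpos n).ne', one_mul]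
    linarith [tailSum_eq_add hφsum n]
  have hA : Tendsto (fun n : ℕ => tailSum a (n + 1) / ρ.real (Set.Ioi (n : ℝ))) atTop
      (𝓝 (q / |∫ ω, (X 0 ω : ℝ) ∂P|)) := by
    -- The weights tend to `p / |μ|`, and the prefactor `q / p` turns this limit into `q / |μ|`.
    have h1 := (tendsto_weighted_tail hφsum (fun n => measureReal_nonneg) hJpos hsmall
      hlim).const_mul (q / p)
    rw [div_mul_div_cancel₀ hp.ne'] at h1
    refine h1.congr' ?_
    filter_upwards [hev] with n hn
    rw [hn, H.ladder_tail_eq hbdd hp hu0 hwh, mul_div_assoc]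
  have hw : ∀ ε > 0, ∃ m : ℕ, ∀ᶠ n : ℕ in atTop,
      ∑ k ∈ Finset.Ioc m n, a k * ρ.real (Set.Ioi ((n - k : ℕ) : ℝ)) ≤
        ε * ρ.real (Set.Ioi (n : ℝ)) := fun ε hε =>
    HalfLineLaw.eventually_sum_le hρ0 hpos hconv (A := fun n => tailSum a (n + 1)) ha0
      (fun n => tsum_nonneg fun j => ha0 _) (fun n => tailSum_eq_add hsum.summable (n + 1)) hA hε
  have hmain := tendsto_div_of_defective_renewal (b := fun n : ℕ => ρ.real (Set.Ioi (n : ℝ)))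
    (T := fun n : ℕ => P.real {ω | (n : ℤ) < maxAfter X 0 ω}) ha0
    (by simp [ha, ladderMass_of_nonpos]) hsum (by linarith) (fun n => hpos n)
    (fun m n hmn => HalfLineLaw.tail_antitone (Nat.cast_le.2 hmn)) hlong hA
    (fun n => measureReal_nonneg) (fun n => H.max_tail_renewal hbdd n) hw
  -- The ladder mass is `1 - q`, so the defective renewal limit is `(q / |μ|) / q`.
  rwa [sub_sub_cancel, div_div_cancel_left' hq0.ne', ← one_div] at hmain

/-- **Veraverbeke's theorem** for integer walks. -/
theorem max_tail_isEquivalent (H : IIDSteps P X) (hint : Integrable (fun ω => (X 0 ω : ℝ)) P)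
    (hneg : ∫ ω, (X 0 ω : ℝ) ∂P < 0) (haper : IsAperiodic P (X 0))
    (hsub : IsSubexponential (integratedCDF P (X 0))) :
    (fun x : ℝ => P.real {ω | (x : EReal) < walkSup X ω}) ~[atTop] fun x : ℝ =>
      (1 - integratedCDF P (X 0) x) / |∫ ω, (X 0 ω : ℝ) ∂P| := by
  have hbdd := H.ae_isBddPath hint hneg
  obtain ⟨ρ, hρ, hρ0, htail, hpos, hconv⟩ := hsub.exists_law
  have hmain := H.tendsto_max_tail_div hint hneg haper hρ0 htail hpos hconv
  -- The maximum is an integer, so its tail at `x` is its tail at `⌊x⌋₊`; the long tail of `ρ`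
  -- absorbs the rounding.
  have hratio : Tendsto (fun x : ℝ => ρ.real (Set.Ioi ((⌊x⌋₊ : ℕ) : ℝ)) / ρ.real (Set.Ioi x)) atTop
      (𝓝 1) := by
    refine tendsto_of_tendsto_of_tendsto_of_le_of_le' tendsto_const_nhds
      (HalfLineLaw.tendsto_tail_ratio hρ0 hpos hconv zero_le_one) ?_ ?_
    · filter_upwards [eventually_ge_atTop 0] with x hx
      exact (one_le_div (hpos x)).2 (HalfLineLaw.tail_antitone (Nat.floor_le hx))
    · refine Eventually.of_forall fun x => div_le_div_of_nonneg_right ?_ (hpos x).le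
      exact HalfLineLaw.tail_antitone (by linarith [Nat.lt_floor_add_one x])
  have h1 := (hmain.comp (tendsto_nat_floor_atTop (α := ℝ))).mul hratio
  rw [mul_one] at h1
  have hc : 1 / |∫ ω, (X 0 ω : ℝ) ∂P| ≠ 0 := one_div_ne_zero (abs_ne_zero.2 hneg.ne)
  have h2 : (fun x : ℝ => P.real {ω | (x : EReal) < walkSup X ω}) ~[atTop] fun x : ℝ =>
      1 / |∫ ω, (X 0 ω : ℝ) ∂P| * ρ.real (Set.Ioi x) := by
    rw [isEquivalent_const_mul_iff hc (Eventually.of_forall fun x => (hpos x).ne')]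
    refine h1.congr' ?_
    filter_upwards [eventually_ge_atTop 0] with x hx
    simp only [Function.comp]
    rw [div_mul_div_cancel₀ (hpos _).ne', measureReal_lt_walkSup hbdd]
    congr 2
    ext ω
    simp only [Set.mem_ofPred_eq]
    constructor
    · intro h
      have h3 : ((⌊x⌋₊ : ℤ) + 1 : ℤ) ≤ maxAfter X 0 ω := h
      have h4 : (((⌊x⌋₊ : ℤ) + 1 : ℤ) : ℝ) ≤ (maxAfter X 0 ω : ℝ) := by exact_mod_cast h3
      push_cast at h4
      linarith [Nat.lt_floor_add_one x]
    · intro h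
      have h3 : ((⌊x⌋₊ : ℤ) : ℝ) < (maxAfter X 0 ω : ℝ) := by
        push_cast
        exact (Nat.floor_le hx).trans_lt h
      exact_mod_cast h3
  refine h2.congr_right ?_
  filter_upwards [eventually_ge_atTop 0] with x hx
  rw [htail x hx]
  ring

end IIDSteps

end RandomWalk

theorem theorem3p7 {Ω : Type*} [MeasurableSpace Ω] (P : Measure Ω) [IsProbabilityMeasure P]
    (X : ℕ → Ω → ℤ) (hmeas : ∀ i, Measurable (X i)) (hindep : iIndepFun X P)
    (hident : ∀ i, IdentDistrib (X i) (X 0) P P)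
    (haper : RandomWalk.IsAperiodic P (X 0))
    (hint : Integrable (fun ω => (X 0 ω : ℝ)) P)
    (m : ℝ) (hm : m = ∫ ω, (X 0 ω : ℝ) ∂P) (hm0 : m ≠ 0) :
    (0 < m → Tendsto (fun x : ℤ => RandomWalk.green P X x) atTop (𝓝 (ENNReal.ofReal (1 / m)))) ∧
    (m < 0 →
      (∀ᵐ ω ∂P, RandomWalk.walkSup X ω < ⊤) ∧
      (∀ x : ℤ, RandomWalk.green P X x < ⊤) ∧
      (IsSubexponential (fun x : ℝ => P.real {ω | RandomWalk.walkSup X ω ≤ (x : EReal)}) →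
        (fun x : ℤ => (RandomWalk.green P X x).toReal) ~[atTop]
          (fun x : ℤ => 1 / |m| * P.real {ω | ((x : ℝ) : EReal) < RandomWalk.walkSup X ω})) ∧
      (IsSubexponential (RandomWalk.integratedCDF P (X 0)) →
        (fun x : ℝ => P.real {ω | (x : EReal) < RandomWalk.walkSup X ω}) ~[atTop]
          (fun x : ℝ => (1 - RandomWalk.integratedCDF P (X 0) x) / |m|))) ∧
    (∀ (α p q : ℝ) (L : ℝ → ℝ), RandomWalk.HasStableTails P (X 0) α p q L → 0 < p →
      IsSubexponential (RandomWalk.integratedCDF P (X 0))) := by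
  have H : RandomWalk.IIDSteps P X := ⟨hmeas, hindep, hident⟩
  subst hm
  refine ⟨fun hpos => H.tendsto_green_atTop hint hpos haper, fun hneg => ⟨?_, ?_, ?_, ?_⟩,
    fun α p q L hL hp => ?_⟩
  · filter_upwards [H.ae_isBddPath hint hneg] with ω hω
    rw [hω.walkSup_eq]
    exact EReal.coe_lt_top _
  · exact H.green_lt_top hint hneg haper
  · exact H.green_isEquivalent hint hneg haper
  · exact H.max_tail_isEquivalent hint hneg haper
  · obtain ⟨hpos, hdom⟩ := hL.tail_dominated hp
    exact RandomWalk.isSubexponential_integratedCDF hint hpos hdom
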